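/- **Setting.** For $\lambda>0$ let $F(x,y)=(\lfloor\lambda x\rfloor-y,\,x)$ on $\mathbb Z^2$, and let $F_\lambda(z)=\lambda F(z/\lambda)$ on $(\lambda\mathbb Z)^2$; both are bijections. Let $G(x,y)=(y,x)$, and call the two-sided $F_\lambda$-orbit $\mathcal O(z)=\{F_\lambda^n(z):n\in\mathbb Z\}$ symmetric if $G(\mathcal O(z))=\mathcal O(z)$. Let $B_{m,n}=[m,m+1)\times[n,n+1)$ and $\mathbf w_{m,n}=(2n+1,-(2m+1))$ for $m,n\in\mathbb Z$. *Polygon classes.* Let $P(x)=\lfloor x\rfloor^2+(2\lfloor x\rfloor+1)\{x\}$ and $\mathscr P(x,y)=P(x)+P(y)$. Let $\mathscr E$ be the set of integers $a^2+b^2$ with $a,b\in\mathbb Z_{\ge0}$, and for $e\in\mathscr E$ let $\mathscr I^e=(e,e^+)$, where $e^+$ is the successor of $e$ in $\mathscr E$. For $\alpha\in\mathscr I^e$ the level set $\mathscr P=\alpha$ is a convex polygon whose vertices are its points having an integer coordinate; each vertex has exactly one non-integer coordinate $u$, and its type is $\lfloor|u|\rfloor$. The vertex list $V(e)=(v_1,\dots,v_k)$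 consists of the types of the vertices with $0\le y\le x$, enumerated clockwise from the half-line $x=y>0$ to the positive $x$-axis (it does not depend on $\alpha\in\mathscr I^e$). *Lattice.* Let $q$ be the least common multiple of $(2v_1+1)^2$ and all the products $(2v_j+1)(2v_{j+1}+1)$ with $v_j\ne v_{j+1}$, let $\mathbf L=\frac{q}{2v_1+1}(1,1)$, and let $\mathbb L^e\subset\mathbb Z^2$ be the $\mathbb Z$-module generated by $\mathbf L$ and $\tfrac12(\mathbf L-\mathbf w_{v_1,v_1})$. *Return map.* Let $d(z)$ be the distance of $z$ from the line $x=y$, and $$X=\{z\in(\lambda\mathbb Z_{\ge0})^2:\ d(z)\le d(F_\lambda^4(z)),\ d(z)<d(F_\lambda^{-4}(z))\}.$$ Let $\tau(z)=\min\{k\ge1:F_\lambda^k(z)\in X\}$, let $\Phi(z)=F_\lambda^{\tau(z)}(z)$ be the first return map to $X$, and let $\mathcal O_\tau(z)=\{F_\lambda^k(z):0\le k\le\tau(z)\}$. *Regular points.* Let $\Lambda$ be the set of $z\in(\lambda\mathbb Z)^2$ such that $z$ and $F_\lambda^4(z)$ lie in different boxes $B_{m,n}$, and let $\Sigma$ be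 the set of $z\in\Lambda$ with $\|z-(m,n)\|_\infty\le\lambda(\|\mathbf w_{m,n}\|_\infty+2)$ for some $m,n\in\mathbb Z$. A point $z\in X$ with $\mathscr P(z)\in\mathscr I^e$ is regular if $\tau(z)$ exists, $z,\Phi(z)\notin\Lambda$, $\mathscr P(\mathcal O_\tau(z))\subset\mathscr I^e$ and $\mathcal O_\tau(z)\cap\Sigma=\emptyset$. Let $I^e(\lambda)\subset\mathscr I^e$ be an interval of the largest possible length such that every $z\in X$ with $\mathscr P(z)\in I^e(\lambda)$ is regular, and let $X^e=\{z\in X:\mathscr P(z)\in I^e(\lambda)\}$. Let $$\delta(e,\lambda)=\frac{\#\{z\in X^e:\ G(\mathcal O(z))=\mathcal O(z),\ \Phi(z)=z\}}{\#X^e},\qquad \eta(e,\lambda)=\frac{\#\{z\in X^e:\ \Phi(z)=z\}}{\#X^e}.$$ **Theorem.** Let $e\in\mathscr E$ have vertex list $(v_1,\dots,v_k)$, and suppose that there is $i\in\{1,k\}$ such that $\gcd(2v_i+1,2v_j+1)=1$ for all $j\in\{1,\dots,k\}$ with $v_j\ne v_i$. Then for all sufficiently small $\lambda>0$ the interval $I^e(\lambda)$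 is uniquely determined, and the following hold. 1. The number of congruence classes modulo $\lambda\mathbb L^e$ that contain a symmetric fixed point of $\Phi$ in $X^e$ (a point $z\in X^e$ with $\Phi(z)=z$ and symmetric orbit) is non-zero and does not depend on $\lambda$, for all sufficiently small $\lambda>0$. 2. $\displaystyle\lim_{\lambda\to0^+}\delta(e,\lambda)=\frac1{(2\lfloor\sqrt e\rfloor+1)(2\lfloor\sqrt{e/2}\rfloor+1)}>0.$ 3. $\displaystyle\liminf_{\lambda\to0^+}\eta(e,\lambda)\ge\frac1{(2\lfloor\sqrt e\rfloor+1)(2\lfloor\sqrt{e/2}\rfloor+1)}.$ -/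

import Mathlib

open Filter Topology

noncomputable section

namespace DiscretisedRotation

/-! ## The lattice map

A point `z = λ (x, y)` of the scaled lattice `(λℤ)²` is represented by the integer point
`(x, y)`.  Under this identification (a bijection, as `λ > 0`) the scaled map
`F_λ (z) = λ F (z / λ)` becomes `F` itself, and the plane position of `(x, y)` is
`scaled lam (x, y)`. -/

/-- The discretised rotation `F (x, y) = (⌊λ x⌋ - y, x)`, as a permutation of `ℤ²`. -/
def F (lam : ℝ) : Equiv.Perm (ℤ × ℤ) where
  toFun p := (⌊lam * p.1⌋ - p.2, p.1)
  invFun p := (p.2, ⌊lam * p.2⌋ - p.1)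
  left_inv p := by simp
  right_inv p := by simp

/-- The point `λ (x, y)` of the plane. -/
def scaled (lam : ℝ) (p : ℤ × ℤ) : ℝ × ℝ := (lam * p.1, lam * p.2)

/-- The reflection `G (x, y) = (y, x)`. -/
def G (p : ℤ × ℤ) : ℤ × ℤ := (p.2, p.1)

/-- The two-sided orbit of `p` under `F`. -/
def orbit (lam : ℝ) (p : ℤ × ℤ) : Set (ℤ × ℤ) := {q | ∃ n : ℤ, q = (F lam ^ n) p}

/-- The orbit of `p` is symmetric: it is setwise invariant under `G`. -/
def HasSymmetricOrbit (lam : ℝ) (p : ℤ × ℤ) : Prop := G '' orbit lam p = orbit lam p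

/-! ## The Hamiltonian, its polygons, and their vertex lists -/

/-- `P x = ⌊x⌋² + (2⌊x⌋ + 1) {x}`. -/
def P (x : ℝ) : ℝ := (⌊x⌋ : ℝ) ^ 2 + (2 * (⌊x⌋ : ℝ) + 1) * Int.fract x

/-- The piecewise-affine Hamiltonian `𝒫 (x, y) = P x + P y`. -/
def ham (z : ℝ × ℝ) : ℝ := P z.1 + P z.2

/-- The vector field `w_{m,n} = (2n + 1, -(2m + 1))`. -/
def w (m n : ℤ) : ℤ × ℤ := (2 * n + 1, -(2 * m + 1))

/-- The label `(m, n)` of the box `B_{m,n} = [m, m+1) × [n, n+1)` containing `z`. -/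
def box (z : ℝ × ℝ) : ℤ × ℤ := (⌊z.1⌋, ⌊z.2⌋)

/-- The critical numbers: the sums of two squares. -/
def criticalNumbers : Set ℕ := {e | ∃ a b : ℕ, e = a ^ 2 + b ^ 2}

/-- The successor of `e` among the critical numbers. -/
def nextCritical (e : ℕ) : ℕ := sInf {f | f ∈ criticalNumbers ∧ e < f}

/-- The critical interval of `e`: the open interval from `e` to the next critical number. -/
def criticalInterval (e : ℕ) : Set ℝ := Set.Ioo (e : ℝ) (nextCritical e)

/-- The union `Δ` of the boundaries of the boxes. -/
def grid : Set (ℝ × ℝ) := {z | (z.1 - ⌊z.1⌋) * (z.2 - ⌊z.2⌋) = 0}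

/-- The vertices in the octant `0 ≤ y ≤ x` of the polygon `𝒫 = α`.  For a non-critical `α` the
vertices of the polygon are the points where it meets `Δ`, since it is a straight segment inside
every box and changes direction on every line of `Δ`. -/
def octantVertices (α : ℝ) : Set (ℝ × ℝ) :=
  {z | ham z = α ∧ z ∈ grid ∧ 0 ≤ z.2 ∧ z.2 ≤ z.1}

/-- The type of a vertex: `⌊|u|⌋`, where `u` is its non-integer coordinate. -/
def vertexType (z : ℝ × ℝ) : ℕ :=
  if z.1 = ⌊z.1⌋ then ⌊|z.2|⌋₊ else ⌊|z.1|⌋₊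

theorem P_injOn : Set.InjOn P (Set.Ici 0) := by
  have key : ∀ x y : ℝ, 0 ≤ x → x < y → P x < P y := by
    intro x y hx hxy
    have hn : (0 : ℝ) ≤ ⌊x⌋ := by exact_mod_cast Int.floor_nonneg.2 hx
    have hle : ⌊x⌋ ≤ ⌊y⌋ := Int.floor_le_floor hxy.le
    have h1 := Int.fract_lt_one x
    have h2 := Int.fract_nonneg y
    have h3 := Int.floor_add_fract x
    have h4 := Int.floor_add_fract y
    unfold P
    rcases hle.lt_or_eq with h | h
    · have h' : (⌊x⌋ : ℝ) + 1 ≤ ⌊y⌋ := by exact_mod_cast h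
      nlinarith [mul_nonneg (show (0 : ℝ) ≤ 2 * ⌊y⌋ + 1 by linarith) h2,
        mul_pos (show (0 : ℝ) < 2 * ⌊x⌋ + 1 by linarith) (sub_pos.2 h1)]
    · rw [← h] at h4 ⊢
      nlinarith
  intro x hx y hy h
  rcases lt_trichotomy x y with hl | hl | hl
  · exact absurd h (key x y hx hl).ne
  · exact hl
  · exact absurd h (key y x hy hl).ne'

theorem P_ge (x : ℝ) : x ^ 2 ≤ P x := by
  have h1 := Int.fract_lt_one x
  have h2 := Int.fract_nonneg x
  have h3 := Int.floor_add_fract x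
  have h5 : x ^ 2 = ((⌊x⌋ : ℝ) + Int.fract x) ^ 2 := by rw [h3]
  rw [h5]
  unfold P
  nlinarith

/-- A polygon has finitely many vertices in the octant, so they can be listed. -/
theorem octantVertices_finite (α : ℝ) : (octantVertices α).Finite := by
  obtain ⟨N, hN⟩ := exists_nat_ge (α + 1)
  have hb : ∀ z ∈ octantVertices α, 0 ≤ z.1 ∧ z.1 ≤ N ∧ 0 ≤ z.2 ∧ z.2 ≤ N := by
    rintro z ⟨h1, -, h3, h4⟩
    have a := P_ge z.1
    have b := P_ge z.2
    unfold ham at h1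
    refine ⟨by linarith, by nlinarith [sq_nonneg (z.1 - 1)], h3, by nlinarith [sq_nonneg (z.2 - 1)]⟩
  have hsub : octantVertices α ⊆
      ⋃ n ∈ Set.Icc (0 : ℤ) N,
        ({z | z ∈ octantVertices α ∧ z.1 = n} ∪ {z | z ∈ octantVertices α ∧ z.2 = n}) := by
    intro z hz
    obtain ⟨c1, c2, c3, c4⟩ := hb z hz
    simp only [Set.mem_iUnion, Set.mem_union, Set.mem_ofPred_eq, exists_prop]
    rcases mul_eq_zero.1 hz.2.1 with h | h
    · refine ⟨⌊z.1⌋, ⟨Int.floor_nonneg.2 c1, ?_⟩, Or.inl ⟨hz, by linarith⟩⟩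
      have : (⌊z.1⌋ : ℝ) ≤ (N : ℤ) := (Int.floor_le _).trans (by simpa using c2)
      exact_mod_cast this
    · refine ⟨⌊z.2⌋, ⟨Int.floor_nonneg.2 c3, ?_⟩, Or.inr ⟨hz, by linarith⟩⟩
      have : (⌊z.2⌋ : ℝ) ≤ (N : ℤ) := (Int.floor_le _).trans (by simpa using c4)
      exact_mod_cast this
  refine Set.Finite.subset (Set.Finite.biUnion (Set.finite_Icc _ _) fun n _ => ?_) hsub
  refine Set.Finite.union (Set.Subsingleton.finite ?_) (Set.Subsingleton.finite ?_)
  · rintro z ⟨hz, hz1⟩ z' ⟨hz', hz1'⟩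
    have h1 := hz.1
    have h2 := hz'.1
    unfold ham at h1 h2
    rw [hz1] at h1
    rw [hz1'] at h2
    exact Prod.ext (hz1.trans hz1'.symm) (P_injOn (hb z hz).2.2.1 (hb z' hz').2.2.1 (by linarith))
  · rintro z ⟨hz, hz1⟩ z' ⟨hz', hz1'⟩
    have h1 := hz.1
    have h2 := hz'.1
    unfold ham at h1 h2
    rw [hz1] at h1
    rw [hz1'] at h2
    exact Prod.ext (P_injOn (hb z hz).1 (hb z' hz').1 (by linarith)) (hz1.trans hz1'.symm)

/-- The vertex list `(v₁, …, v_k)` of the polygon `𝒫 = α`: the types of the vertices from the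
half-line `x = y > 0` to the positive `x`-axis, enumerated clockwise.  Along this arc the
abscissa increases strictly, so the clockwise order is the order of increasing abscissa. -/
def vertexList (α : ℝ) : List ℕ :=
  (((octantVertices_finite α).toFinset.map toLex.toEmbedding).sort (· ≤ ·)).map
    fun z => vertexType (ofLex z)

/-- The coprimality condition on a vertex list: there is `v`, the first or the last entry, such
that `2 v + 1` is coprime to `2 v' + 1` for every entry `v' ≠ v`. -/
def CoprimalityCondition (V : List ℕ) : Prop :=
  ∃ v : ℕ, (V.head? = some v ∨ V.getLast? = some v) ∧
    ∀ v' ∈ V, v' ≠ v → Nat.Coprime (2 * v + 1) (2 * v' + 1)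

/-! ## The lattice of a polygon class -/

/-- The least common multiple of `(2v₁ + 1)²` and all products `(2v_j + 1)(2v_{j+1} + 1)` over
consecutive distinct entries. -/
def q (V : List ℕ) : ℕ :=
  (V.zip V.tail).foldr
    (fun p r => if p.1 = p.2 then r else Nat.lcm ((2 * p.1 + 1) * (2 * p.2 + 1)) r)
    ((2 * V.headI + 1) ^ 2)

/-- The vector `L = q / (2v₁ + 1) · (1, 1)`; the division is exact. -/
def latticeVector (V : List ℕ) : ℤ × ℤ :=
  ((q V : ℤ) / (2 * V.headI + 1), (q V : ℤ) / (2 * V.headI + 1))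

/-- The lattice generated by `L` and `(L - w_{v₁,v₁}) / 2`; the halves are exact, as `q`
is odd. -/
def lattice (V : List ℕ) : AddSubgroup (ℤ × ℤ) :=
  AddSubgroup.closure {latticeVector V,
    ((latticeVector V - w V.headI V.headI).1 / 2, (latticeVector V - w V.headI V.headI).2 / 2)}

/-! ## The return map -/

/-- The perpendicular distance of `λ p` from the line `x = y`. -/
def diagDist (lam : ℝ) (p : ℤ × ℤ) : ℝ :=
  |(scaled lam p).1 - (scaled lam p).2| / √2

/-- The domain `X` of the return map. -/
def X (lam : ℝ) : Set (ℤ × ℤ) :=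
  {p | 0 ≤ p.1 ∧ 0 ≤ p.2 ∧ diagDist lam p ≤ diagDist lam ((F lam ^ (4 : ℤ)) p) ∧
    diagDist lam p < diagDist lam ((F lam ^ (-4 : ℤ)) p)}

/-- The positive orbit of `p` meets `X`. -/
def Returns (lam : ℝ) (p : ℤ × ℤ) : Prop := ∃ k : ℕ, 0 < k ∧ (F lam ^ k) p ∈ X lam

/-- The transit time to `X`: the least `k ≥ 1` with `F^k p ∈ X`. -/
def τ (lam : ℝ) (p : ℤ × ℤ) : ℕ := sInf {k : ℕ | 0 < k ∧ (F lam ^ k) p ∈ X lam}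

/-- The first return map. -/
def Φ (lam : ℝ) (p : ℤ × ℤ) : ℤ × ℤ := (F lam ^ τ lam p) p

/-- The return orbit `{F^k p : 0 ≤ k ≤ τ p}`. -/
def returnOrbit (lam : ℝ) (p : ℤ × ℤ) : Set (ℤ × ℤ) :=
  {r | ∃ k : ℕ, k ≤ τ lam p ∧ r = (F lam ^ k) p}

/-! ## Regular domains -/

/-- The set `Λ` of transition points: `p` and `F⁴ p` lie in different boxes. -/
def Λ (lam : ℝ) : Set (ℤ × ℤ) :=
  {p | box (scaled lam ((F lam ^ (4 : ℤ)) p)) ≠ box (scaled lam p)}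

/-- The set `Σ`: transition points within `λ (‖w_{m,n}‖_∞ + 2)` of a point `(m, n)` of `ℤ²`, in
the sup norm. -/
def cornerSet (lam : ℝ) : Set (ℤ × ℤ) :=
  {p | p ∈ Λ lam ∧ ∃ m n : ℤ,
    max |(scaled lam p).1 - m| |(scaled lam p).2 - n| ≤
      lam * (((max |(w m n).1| |(w m n).2| : ℤ) : ℝ) + 2)}

/-- A point of `X` in the polygon class of `e` is regular.  (`Returns` only says that the return
map is defined at the point.) -/
def IsRegular (e : ℕ) (lam : ℝ) (p : ℤ × ℤ) : Prop :=
  p ∈ X lam ∧ ham (scaled lam p) ∈ criticalInterval e ∧ Returns lam p ∧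
  (p ∉ Λ lam ∧ Φ lam p ∉ Λ lam) ∧
  (∀ r ∈ returnOrbit lam p, ham (scaled lam r) ∈ criticalInterval e) ∧
  (∀ r ∈ returnOrbit lam p, r ∉ cornerSet lam)

/-- The points of `X` whose value of the Hamiltonian lies in `J`. -/
def domain (lam : ℝ) (J : Set ℝ) : Set (ℤ × ℤ) := {p | p ∈ X lam ∧ ham (scaled lam p) ∈ J}

/-- `J` is an interval contained in the critical interval of `e` such that all points of
`domain lam J` are regular. -/
def IsRegularInterval (e : ℕ) (lam : ℝ) (J : Set ℝ) : Prop :=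
  J.OrdConnected ∧ J ⊆ criticalInterval e ∧ ∀ p ∈ domain lam J, IsRegular e lam p

/-- `J` is a largest such interval (it has the maximal length): `J = I^e(λ)`, and
`domain lam J = X^e`. -/
def IsLargestRegularInterval (e : ℕ) (lam : ℝ) (J : Set ℝ) : Prop :=
  IsRegularInterval e lam J ∧
    ∀ J', IsRegularInterval e lam J' → MeasureTheory.volume J' ≤ MeasureTheory.volume J

/-! ## Fixed points and densities -/

/-- The fixed points of the return map in `S`. -/
def fixedPoints (lam : ℝ) (S : Set (ℤ × ℤ)) : Set (ℤ × ℤ) := {p | p ∈ S ∧ Φ lam p = p}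

/-- The symmetric fixed points of the return map in `S`. -/
def symmetricFixedPoints (lam : ℝ) (S : Set (ℤ × ℤ)) : Set (ℤ × ℤ) :=
  {p | p ∈ S ∧ HasSymmetricOrbit lam p ∧ Φ lam p = p}

/-- The fraction of symmetric fixed points in `S`. -/
def δ (lam : ℝ) (S : Set (ℤ × ℤ)) : ℝ := (symmetricFixedPoints lam S).ncard / S.ncard

/-- The fraction of fixed points in `S`. -/
def η (lam : ℝ) (S : Set (ℤ × ℤ)) : ℝ := (fixedPoints lam S).ncard / S.ncard

/-- The number of congruence classes modulo the subgroup `L` that meet `S`. -/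
def countModulo (L : AddSubgroup (ℤ × ℤ)) (S : Set (ℤ × ℤ)) : ℕ :=
  ((fun p : ℤ × ℤ => (QuotientAddGroup.mk p : (ℤ × ℤ) ⧸ L)) '' S).ncard

end DiscretisedRotation

end

open DiscretisedRotation

/-! The abscissas `x_t` of an orbit of `F` satisfy `x_{t+1} + x_{t-1} = ⌊λ x_t⌋`.  As long as four
consecutive steps do not meet a line of the grid, `F⁴` is the translation by the vector `w_{m,n}` of
the box, along which the Hamiltonian `𝒫` is constant.  On its way around, an orbit is near the grid
a bounded number of times, so that `𝒫` changes by `O(λ)` until the return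
(`Outgoing.energy_sub_le`).  Up to the return, the points `F^{4i}` move away from the diagonal in
the first quadrant, across the positive `x`-axis, and `F^{4i+1}` come back to the diagonal from the
other side; the return time is `4 j + 1`, where `j` is the first minimum of the distance of
`F^{4i+1}` from the diagonal (`Outgoing.tau_eq`).

Hence all points of `X` whose Hamiltonian is farther than a constant times `λ` from the ends of the
critical interval are regular (`isRegular_of_mid`).  The values of the Hamiltonian at the other
points are finite in number, and all lie within `O(λ)` of the ends, so the largest regular interval
is the component of the middle of the critical interval (`isLargestRegularInterval_iff`), which
proves the uniqueness.

A regular orbit passes through the boxes along its polygon in a fixed order and stays away from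
their corners.  Its passage from a box to the next one is therefore an explicit piecewise shear,
and the composition of these maps gives the ordinate at which the orbit arrives at the positive
`x`-axis in the last column.  This ordinate, an integer modulo `2 ⌊√e⌋ + 1`, is the `label` of the
point; it is constant along the orbit (`IsOrbit.label_step`, `IsOrbit.label_axis`).  The recursion
is reversible, so a symmetric fixed point is symmetric about two indices, one on the diagonal and
one on the `x`-axis.  The first symmetry forces the point to be of the form `(x, x)` or
`(x, x + 2 v₁ + 1)`; the second one means that the label has one particular value, the
`centralLabel` (`ReturnArc.label_eq_of_symm`).  Conversely, these two conditions give two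
symmetries, whose composition is a period, and the period is the return time
(`ReturnArc.symm_fixed_of_label`).

It remains to count.  The crossing maps commute with shifts transversal to the direction of the
box, and at a vertex between columns or rows of different types the shift by `q / (2 v_j + 1)` is
congruent to the one by `q / (2 v_{j+1} + 1)`, because `q` is a multiple of
`(2 v_j + 1) (2 v_{j+1} + 1)`.  So the label is invariant under the lattice (`label_periodic`), and
the number of classes of symmetric fixed points is the number of residues of `x` modulo
`q / (2 v₁ + 1)` for which `(x, x)` has the central label (`countModulo_eq`).  The coprimality
hypothesis makes all labels equally frequent on the diagonal (`diagLabel_count`).  If the first type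
is coprime to the others, the points `(x, x)`, for `x` modulo `q / (2 v₁ + 1)`, run once through a
fundamental domain of a lattice under which the label is invariant, and there the label is
equidistributed, as the crossing maps permute the classes modulo such lattices
(`label_equidistributed`).  If the last type is coprime to the others, a suitable shift along the
diagonal adds to the label a unit modulo `2 ⌊√e⌋ + 1` (`label_twist`).

Finally, away from the ends `X` has `2 v₁ + 1` points on each line `x + y = s`, one of which is on
the two lines of candidates for symmetric fixed points.  The points near the ends are bounded in
number, whereas the number of lines tends to infinity, so the density of the symmetric fixed points
tends to `1 / ((2 ⌊√e⌋ + 1) (2 ⌊√(e/2)⌋ + 1))` (`tendsto_delta`).  As `δ ≤ η`, this is also a lower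
bound for the limit inferior of `η`. -/

namespace DiscretisedRotation

/-! ### The profile `P` and the critical numbers -/

theorem P_eq_line (x : ℝ) : P x = (2 * (⌊x⌋ : ℝ) + 1) * x - (⌊x⌋ : ℝ) * (⌊x⌋ + 1) := by
  have h := Int.floor_add_fract x
  unfold P
  linear_combination (2 * (⌊x⌋ : ℝ) + 1) * h

/-- `P` is the supremum of the chords of `x ↦ x²` between consecutive integers; in particular it
is convex. -/
theorem line_le_P (k : ℤ) (x : ℝ) : (2 * (k : ℝ) + 1) * x - (k : ℝ) * (k + 1) ≤ P x := by
  rw [P_eq_line]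
  have h1 := Int.floor_le x
  have h2 := Int.lt_floor_add_one x
  rcases lt_trichotomy k ⌊x⌋ with h | h | h
  · have h' : (k : ℝ) + 1 ≤ ⌊x⌋ := by exact_mod_cast h
    nlinarith [mul_nonneg (show (0 : ℝ) ≤ ⌊x⌋ - k by linarith) (sub_nonneg.2 h1)]
  · rw [h]
  · have h' : (⌊x⌋ : ℝ) + 1 ≤ k := by exact_mod_cast h
    nlinarith [mul_nonneg (show (0 : ℝ) ≤ k - ⌊x⌋ by linarith) (sub_nonneg.2 h2.le)]

theorem P_eq_of_mem {n : ℤ} {x : ℝ} (h1 : (n : ℝ) ≤ x) (h2 : x ≤ n + 1) :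
    P x = (2 * (n : ℝ) + 1) * x - (n : ℝ) * (n + 1) := by
  rcases h2.lt_or_eq with h | h
  · have : ⌊x⌋ = n := Int.floor_eq_iff.2 ⟨h1, h⟩
    rw [P_eq_line, this]
  · have : ⌊x⌋ = n + 1 := by rw [h]; simp
    rw [P_eq_line, this, h]
    push_cast
    ring

theorem P_intCast (n : ℤ) : P n = (n : ℝ) ^ 2 := by
  simp [P]

theorem P_natCast (n : ℕ) : P n = (n : ℝ) ^ 2 := by
  have := P_intCast n
  simpa using this

theorem P_neg (x : ℝ) : P (-x) = P x := by
  have key : ∀ y : ℝ, P y ≤ P (-y) := by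
    intro y
    have := line_le_P (-⌊y⌋ - 1) (-y)
    rw [P_eq_line y]
    push_cast at this
    linarith
  refine le_antisymm ?_ (key x)
  simpa using key (-x)

theorem P_nonneg (x : ℝ) : 0 ≤ P x := (sq_nonneg x).trans (P_ge x)

theorem abs_le_P (x : ℝ) : |x| ≤ P x := by
  have h1 := line_le_P 0 x
  have h2 := line_le_P (-1) x
  push_cast at h1 h2
  exact abs_le.2 ⟨by linarith, by linarith⟩

theorem P_lt_P {x y : ℝ} (hx : 0 ≤ x) (h : x < y) : P x < P y := by
  have h1 := line_le_P ⌊x⌋ y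
  have hn : (0 : ℝ) ≤ ⌊x⌋ := by exact_mod_cast Int.floor_nonneg.2 hx
  rw [P_eq_line x]
  nlinarith

theorem P_le_P {x y : ℝ} (hx : 0 ≤ x) (h : x ≤ y) : P x ≤ P y := by
  rcases h.lt_or_eq with h | h
  · exact (P_lt_P hx h).le
  · rw [h]

theorem add_sub_le_P {x y : ℝ} (hx : 0 ≤ x) (h : x ≤ y) : P x + (y - x) ≤ P y := by
  have h1 := line_le_P ⌊x⌋ y
  have hn : (0 : ℝ) ≤ ⌊x⌋ := by exact_mod_cast Int.floor_nonneg.2 hx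
  rw [P_eq_line x]
  nlinarith

/-- `P` is Lipschitz on `[-N, N]` with constant `2 N + 1`. -/
theorem abs_P_sub_le {N : ℕ} {x y : ℝ} (hx : |x| ≤ N) (hy : |y| ≤ N) :
    |P x - P y| ≤ (2 * N + 1) * |x - y| := by
  have key : ∀ x y : ℝ, |x| ≤ N → P x - P y ≤ (2 * N + 1) * |x - y| := by
    intro x y hx
    obtain ⟨h1, h2⟩ := abs_le.1 hx
    have h3 := line_le_P ⌊x⌋ y
    have h4 : (⌊x⌋ : ℝ) ≤ N := (Int.floor_le x).trans h2
    have h5 : (-(N : ℤ)) ≤ ⌊x⌋ := Int.le_floor.2 (by push_cast; exact h1)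
    have h5' : -(N : ℝ) ≤ ⌊x⌋ := by exact_mod_cast h5
    have h6 : P x - P y ≤ (2 * (⌊x⌋ : ℝ) + 1) * (x - y) := by
      rw [P_eq_line x]
      linarith
    refine h6.trans ((le_abs_self _).trans ?_)
    rw [abs_mul]
    refine mul_le_mul_of_nonneg_right ?_ (abs_nonneg _)
    exact abs_le.2 ⟨by linarith, by linarith⟩
  refine abs_le.2 ⟨?_, key x y hx⟩
  have := key y x hy
  rw [abs_sub_comm] at this
  linarith

theorem exists_critical_gt (e : ℕ) : ∃ f, f ∈ criticalNumbers ∧ e < f :=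
  ⟨(e + 1) ^ 2, ⟨e + 1, 0, by ring⟩, by nlinarith⟩

theorem lt_nextCritical (e : ℕ) : e < nextCritical e :=
  (Nat.sInf_mem (exists_critical_gt e)).2

theorem nextCritical_le {e a b : ℕ} (h : e < a ^ 2 + b ^ 2) : nextCritical e ≤ a ^ 2 + b ^ 2 :=
  Nat.sInf_le ⟨⟨a, b, rfl⟩, h⟩

/-- Sums of two squares of integers do not lie strictly between `e` and its successor. -/
theorem sq_add_sq_le_or (e : ℕ) (a b : ℤ) :
    (a : ℝ) ^ 2 + (b : ℝ) ^ 2 ≤ e ∨ (nextCritical e : ℝ) ≤ (a : ℝ) ^ 2 + (b : ℝ) ^ 2 := by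
  have h : (a : ℝ) ^ 2 + (b : ℝ) ^ 2 = ((a.natAbs ^ 2 + b.natAbs ^ 2 : ℕ) : ℝ) := by
    push_cast
    simp [Nat.cast_natAbs]
  rw [h]
  rcases le_or_gt (a.natAbs ^ 2 + b.natAbs ^ 2) e with h1 | h1
  · left
    exact_mod_cast h1
  · right
    exact_mod_cast nextCritical_le h1

theorem sq_add_sq_le_of_lt {e : ℕ} {a b : ℕ} (h : (a : ℝ) ^ 2 + (b : ℝ) ^ 2 < nextCritical e) :
    a ^ 2 + b ^ 2 ≤ e := by
  rcases sq_add_sq_le_or e a b with h1 | h1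
  · exact_mod_cast h1
  · push_cast at h1
    linarith

theorem nextCritical_le_of_lt {e : ℕ} {a b : ℕ} (h : e < a ^ 2 + b ^ 2) :
    (nextCritical e : ℝ) ≤ (a : ℝ) ^ 2 + (b : ℝ) ^ 2 := by
  exact_mod_cast nextCritical_le h

/-- The column (and row) of the box that the polygons of `e` meet on the diagonal. -/
def diagIndex (e : ℕ) : ℕ := Nat.sqrt (e / 2)

theorem diagIndex_le (e : ℕ) : diagIndex e ^ 2 + diagIndex e ^ 2 ≤ e := by
  have := Nat.sqrt_le' (e / 2)
  unfold diagIndex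
  omega

theorem lt_diagIndex (e : ℕ) : e < (diagIndex e + 1) ^ 2 + (diagIndex e + 1) ^ 2 := by
  have := Nat.lt_succ_sqrt' (e / 2)
  unfold diagIndex
  rw [Nat.succ_eq_add_one] at this
  omega

theorem diagIndex_unique {e m : ℕ} (h1 : m ^ 2 + m ^ 2 ≤ e)
    (h2 : e < (m + 1) ^ 2 + (m + 1) ^ 2) : m = diagIndex e := by
  have h3 := diagIndex_le e
  have h4 := lt_diagIndex e
  apply le_antisymm
  · by_contra h
    have : diagIndex e + 1 ≤ m := by omega
    have := Nat.pow_le_pow_left this 2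
    omega
  · by_contra h
    have : m + 1 ≤ diagIndex e := by omega
    have := Nat.pow_le_pow_left this 2
    omega

noncomputable section

/-! ### The boxes along a polygon and its vertex list -/

/-- Induction along the boxes `(m, n)` met by the polygons of `e` in the octant.  Such a polygon
leaves the box through its right side if the corner `(m + 1, n)` is inside the polygon, and
through its bottom side otherwise; the path ends at the positive `x`-axis. -/
theorem path_induction (e : ℕ) {p : ℕ → ℕ → Prop}
    (hV : ∀ m n, (m + 1) ^ 2 + n ^ 2 ≤ e → p (m + 1) n → p m n)
    (h0 : ∀ m, ¬ (m + 1) ^ 2 + 0 ^ 2 ≤ e → p m 0)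
    (hH : ∀ m n, ¬ (m + 1) ^ 2 + (n + 1) ^ 2 ≤ e → p m n → p m (n + 1)) (m n : ℕ) : p m n := by
  induction h : n + (e - m) using Nat.strong_induction_on generalizing m n with
  | _ s ih =>
    by_cases hc : (m + 1) ^ 2 + n ^ 2 ≤ e
    · have : m + 1 ≤ e := by nlinarith
      exact hV m n hc (ih (n + (e - (m + 1))) (by omega) _ _ rfl)
    · cases n with
      | zero => exact h0 m hc
      | succ n => exact hH m n hc (ih (n + (e - m)) (by omega) _ _ rfl)

/-- The types of the vertices met from the box `(m, n)` on. -/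
def types (e m n : ℕ) : List ℕ :=
  if (m + 1) ^ 2 + n ^ 2 ≤ e then n :: types e (m + 1) n
  else match n with
    | 0 => [m]
    | n + 1 => m :: types e m n
termination_by n + (e - m)
decreasing_by
  · have : m + 1 ≤ e := by nlinarith
    omega
  · omega

theorem types_right {e m n : ℕ} (h : (m + 1) ^ 2 + n ^ 2 ≤ e) :
    types e m n = n :: types e (m + 1) n := by
  rw [types.eq_def, if_pos h]

theorem types_zero {e m : ℕ} (h : ¬ (m + 1) ^ 2 + 0 ^ 2 ≤ e) : types e m 0 = [m] := by
  rw [types, if_neg h]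

theorem types_down {e m n : ℕ} (h : ¬ (m + 1) ^ 2 + (n + 1) ^ 2 ≤ e) :
    types e m (n + 1) = m :: types e m n := by
  rw [types, if_neg h]

/-- The vertices of the polygon `𝒫 = α` met from the box `(m, n)` on. -/
def vertices (e : ℕ) (α : ℝ) (m n : ℕ) : List (ℝ × ℝ) :=
  if (m + 1) ^ 2 + n ^ 2 ≤ e then
    ((m : ℝ) + 1, n + (α - ((m : ℝ) + 1) ^ 2 - (n : ℝ) ^ 2) / (2 * n + 1)) :: vertices e α (m + 1) n
  else match n with
    | 0 => [((m : ℝ) + (α - (m : ℝ) ^ 2) / (2 * m + 1), 0)]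
    | n + 1 => ((m : ℝ) + (α - (m : ℝ) ^ 2 - ((n : ℝ) + 1) ^ 2) / (2 * m + 1), (n : ℝ) + 1) ::
        vertices e α m n
termination_by n + (e - m)
decreasing_by
  · have : m + 1 ≤ e := by nlinarith
    omega
  · omega

theorem vertices_right {e m n : ℕ} {α : ℝ} (h : (m + 1) ^ 2 + n ^ 2 ≤ e) :
    vertices e α m n = ((m : ℝ) + 1, n + (α - ((m : ℝ) + 1) ^ 2 - (n : ℝ) ^ 2) / (2 * n + 1)) ::
      vertices e α (m + 1) n := by
  rw [vertices.eq_def, if_pos h]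

theorem vertices_zero {e m : ℕ} {α : ℝ} (h : ¬ (m + 1) ^ 2 + 0 ^ 2 ≤ e) :
    vertices e α m 0 = [((m : ℝ) + (α - (m : ℝ) ^ 2) / (2 * m + 1), 0)] := by
  rw [vertices, if_neg h]

theorem vertices_down {e m n : ℕ} {α : ℝ} (h : ¬ (m + 1) ^ 2 + (n + 1) ^ 2 ≤ e) :
    vertices e α m (n + 1) =
      ((m : ℝ) + (α - (m : ℝ) ^ 2 - ((n : ℝ) + 1) ^ 2) / (2 * m + 1), (n : ℝ) + 1) ::
        vertices e α m n := by
  rw [vertices, if_neg h]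

/-- The point `u = k + (β - k²) / (2 k + 1)` solves `P u = β` for `k² < β < (k + 1)²`. -/
theorem P_solve {k : ℕ} {β : ℝ} (h1 : (k : ℝ) ^ 2 < β) (h2 : β < ((k : ℝ) + 1) ^ 2) :
    (k : ℝ) < k + (β - (k : ℝ) ^ 2) / (2 * k + 1) ∧
    k + (β - (k : ℝ) ^ 2) / (2 * k + 1) < (k : ℝ) + 1 ∧
      P (k + (β - (k : ℝ) ^ 2) / (2 * k + 1)) = β := by
  have hk : (0 : ℝ) < 2 * k + 1 := by positivity
  have a1 : 0 < (β - (k : ℝ) ^ 2) / (2 * k + 1) := div_pos (by linarith) hk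
  have a2 : (β - (k : ℝ) ^ 2) / (2 * k + 1) < 1 := by rw [div_lt_one hk]; nlinarith
  refine ⟨by linarith, by linarith, ?_⟩
  rw [P_eq_of_mem (n := k) (by push_cast; linarith) (by push_cast; linarith)]
  push_cast
  field_simp
  ring

theorem eq_floor_of_mem_grid {z : ℝ × ℝ} (h : z ∈ grid) : z.1 = ⌊z.1⌋ ∨ z.2 = ⌊z.2⌋ := by
  rcases mul_eq_zero.1 h with h | h
  · left; linarith
  · right; linarith

theorem mem_grid_of_left {z : ℝ × ℝ} (k : ℤ) (h : z.1 = k) : z ∈ grid := by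
  simp [grid, h]

theorem mem_grid_of_right {z : ℝ × ℝ} (k : ℤ) (h : z.2 = k) : z ∈ grid := by
  simp [grid, h]

/-- The list `vertices e α m n` is the set of the vertices of the polygon `𝒫 = α` to the right of
the line `x = m` and below the line `y = n + 1`, in the order of increasing abscissa, and
`types e m n` is the list of their types. -/
theorem vertices_spec {e : ℕ} {α : ℝ} (hα : α ∈ criticalInterval e) (m n : ℕ) :
    m ^ 2 + n ^ 2 ≤ e → e < (m + 1) ^ 2 + (n + 1) ^ 2 →
    (∀ z, z ∈ vertices e α m n ↔
      ham z = α ∧ z ∈ grid ∧ 0 ≤ z.2 ∧ z.2 < n + 1 ∧ (m : ℝ) < z.1) ∧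
    ((vertices e α m n).map toLex).SortedLT ∧
    (vertices e α m n).map vertexType = types e m n := by
  obtain ⟨hα1, hα2⟩ := hα
  have inside : ∀ a b : ℕ, a ^ 2 + b ^ 2 ≤ e → (a : ℝ) ^ 2 + (b : ℝ) ^ 2 < α := fun a b h =>
    lt_of_le_of_lt (by exact_mod_cast h) hα1
  have outside : ∀ a b : ℕ, e < a ^ 2 + b ^ 2 → α < (a : ℝ) ^ 2 + (b : ℝ) ^ 2 := fun a b h =>
    hα2.trans_le (nextCritical_le_of_lt h)
  induction m, n using path_induction e with
  | hV m n hc ih =>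
    intro h1 h2
    obtain ⟨ih1, ih2, ih3⟩ := ih hc
      (h2.trans_le (Nat.add_le_add_right (Nat.pow_le_pow_left (by omega) 2) _))
    have b1 := inside _ _ hc
    have b2 := outside _ _ h2
    push_cast at b1 b2
    obtain ⟨y1, y2, y3⟩ := P_solve (k := n) (β := α - ((m : ℝ) + 1) ^ 2) (by linarith) (by linarith)
    set y := (n : ℝ) + (α - ((m : ℝ) + 1) ^ 2 - (n : ℝ) ^ 2) / (2 * n + 1) with hy
    have hPm : P ((m : ℝ) + 1) = ((m : ℝ) + 1) ^ 2 := by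
      have := P_natCast (m + 1)
      push_cast at this
      exact this
    have hn0 : (0 : ℝ) ≤ n := by positivity
    have hm0 : (0 : ℝ) ≤ m := by positivity
    rw [vertices_right hc, types_right hc]
    refine ⟨fun z => ?_, ?_, ?_⟩
    · rw [List.mem_cons, ih1]
      constructor
      · rintro (rfl | ⟨a1, a2, a3, a4, a5⟩)
        · refine ⟨?_, mem_grid_of_left (m + 1) (by push_cast; rfl), ?_, ?_, ?_⟩
          · unfold ham; rw [hPm, y3]; ring
          · show (0 : ℝ) ≤ y; linarith
          · exact y2
          · show (m : ℝ) < m + 1; linarith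
        · push_cast at a5
          exact ⟨a1, a2, a3, a4, by linarith⟩
      · rintro ⟨a1, a2, a3, a4, a5⟩
        rcases lt_trichotomy z.1 ((m : ℝ) + 1) with h | h | h
        · exfalso
          have hz1 : ⌊z.1⌋ = (m : ℤ) :=
            Int.floor_eq_iff.2 ⟨by push_cast; linarith, by push_cast; exact h⟩
          have hz2 : z.2 = ⌊z.2⌋ := by
            rcases eq_floor_of_mem_grid a2 with h' | h'
            · rw [hz1] at h'; push_cast at h'; linarith
            · exact h'
          have hz3 : z.2 ≤ n := by
            have : ⌊z.2⌋ < (n : ℤ) + 1 := Int.floor_lt.2 (by push_cast; exact a4)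
            have : ⌊z.2⌋ ≤ (n : ℤ) := by omega
            rw [hz2]; exact_mod_cast this
          have c1 := P_lt_P (hm0.trans a5.le) h
          have c2 := P_le_P a3 hz3
          rw [P_natCast] at c2
          unfold ham at a1
          linarith
        · left
          refine Prod.ext h ?_
          have : P z.2 = P y := by
            unfold ham at a1
            rw [h, hPm] at a1
            linarith
          exact P_injOn a3 (show (0 : ℝ) ≤ y by linarith) this
        · right
          push_cast
          exact ⟨a1, a2, a3, a4, h⟩
    · rw [List.map_cons, List.sortedLT_iff_pairwise, List.pairwise_cons]
      refine ⟨?_, ih2.pairwise⟩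
      intro a ha
      obtain ⟨z, hz, rfl⟩ := List.mem_map.1 ha
      have := ((ih1 z).1 hz).2.2.2.2
      rw [Prod.Lex.toLex_lt_toLex]
      left
      push_cast at this
      exact this
    · rw [List.map_cons, ih3]
      congr 1
      have : ((m : ℝ) + 1) = ⌊(m : ℝ) + 1⌋ := by
        rw [show (m : ℝ) + 1 = ((m + 1 : ℤ) : ℝ) by push_cast; rfl, Int.floor_intCast]
      unfold vertexType
      rw [if_pos this]
      simp only
      rw [abs_of_nonneg (by linarith)]
      exact (Nat.floor_eq_iff (by linarith)).2 ⟨y1.le, y2⟩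
  | h0 m hc =>
    intro h1 h2
    have b1 := inside _ _ h1
    have b2 := outside (m + 1) 0 (by omega)
    push_cast at b1 b2
    obtain ⟨y1, y2, y3⟩ := P_solve (k := m) (β := α) (by linarith) (by linarith)
    set y := (m : ℝ) + (α - (m : ℝ) ^ 2) / (2 * m + 1) with hy
    have hm0 : (0 : ℝ) ≤ m := by positivity
    have hP0 : P 0 = 0 := by simpa using P_natCast 0
    rw [vertices_zero hc, types_zero hc]
    refine ⟨fun z => ?_, by simp [List.sortedLT_iff_pairwise], ?_⟩
    · rw [List.mem_singleton]
      constructor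
      · rintro rfl
        refine ⟨?_, mem_grid_of_right 0 (by simp), le_rfl, by norm_num, y1⟩
        unfold ham; rw [hP0, y3]; ring
      · rintro ⟨a1, a2, a3, a4, a5⟩
        have hz2 : z.2 = 0 := by
          rcases eq_floor_of_mem_grid a2 with h' | h'
          · exfalso
            have : (m : ℤ) < ⌊z.1⌋ := by
              have : ((m : ℤ) : ℝ) < ⌊z.1⌋ := by rw [← h']; exact_mod_cast a5
              exact_mod_cast this
            have : ((m : ℝ) + 1) ≤ z.1 := by rw [h']; exact_mod_cast this
            have c1 := P_le_P (by positivity) this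
            have c2 := P_natCast (m + 1)
            push_cast at c2
            have c3 := P_nonneg z.2
            unfold ham at a1
            linarith
          · have : ⌊z.2⌋ < 1 := Int.floor_lt.2 (by push_cast; push_cast at a4; linarith)
            have h0 : 0 ≤ ⌊z.2⌋ := Int.floor_nonneg.2 a3
            have : ⌊z.2⌋ = 0 := by omega
            rw [h', this]; simp
        refine Prod.ext ?_ hz2
        have : P z.1 = P y := by
          unfold ham at a1
          rw [hz2, hP0] at a1
          linarith
        exact P_injOn (show (0 : ℝ) ≤ z.1 by linarith) (show (0 : ℝ) ≤ y by linarith) this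
    · rw [List.map_singleton]
      congr 1
      have : ¬ y = ⌊y⌋ := by
        have : ⌊y⌋ = (m : ℤ) := Int.floor_eq_iff.2 ⟨by push_cast; linarith, by push_cast; linarith⟩
        rw [this]; push_cast; linarith
      unfold vertexType
      rw [if_neg this]
      simp only
      rw [abs_of_nonneg (by linarith)]
      exact (Nat.floor_eq_iff (by linarith)).2 ⟨y1.le, y2⟩
  | hH m n hc ih =>
    intro h1 h2
    obtain ⟨ih1, ih2, ih3⟩ := ih
      (le_trans (Nat.add_le_add_left (Nat.pow_le_pow_left (by omega) 2) _) h1) (by omega)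
    have b1 := inside _ _ h1
    have b2 := outside (m + 1) (n + 1) (by omega)
    push_cast at b1 b2
    obtain ⟨y1, y2, y3⟩ := P_solve (k := m) (β := α - ((n : ℝ) + 1) ^ 2) (by linarith) (by linarith)
    have hcomm : α - ((n : ℝ) + 1) ^ 2 - (m : ℝ) ^ 2 =
        α - (m : ℝ) ^ 2 - ((n : ℝ) + 1) ^ 2 := by ring
    rw [hcomm] at y1 y2 y3
    set y := (m : ℝ) + (α - (m : ℝ) ^ 2 - ((n : ℝ) + 1) ^ 2) / (2 * m + 1) with hy
    have hPn : P ((n : ℝ) + 1) = ((n : ℝ) + 1) ^ 2 := by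
      have := P_natCast (n + 1)
      push_cast at this
      exact this
    have hn0 : (0 : ℝ) ≤ n := by positivity
    have hm0 : (0 : ℝ) ≤ m := by positivity
    rw [vertices_down hc, types_down hc]
    refine ⟨fun z => ?_, ?_, ?_⟩
    · rw [List.mem_cons, ih1]
      constructor
      · rintro (rfl | ⟨a1, a2, a3, a4, a5⟩)
        · refine ⟨?_, mem_grid_of_right (n + 1) (by push_cast; rfl), ?_, ?_, y1⟩
          · unfold ham; rw [hPn, y3]; ring
          · show (0 : ℝ) ≤ n + 1; linarith
          · push_cast; linarith
        · push_cast
          exact ⟨a1, a2, a3, by linarith, a5⟩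
      · rintro ⟨a1, a2, a3, a4, a5⟩
        push_cast at a4
        rcases lt_trichotomy z.2 ((n : ℝ) + 1) with h | h | h
        · right
          exact ⟨a1, a2, a3, h, a5⟩
        · left
          refine Prod.ext ?_ h
          have : P z.1 = P y := by
            unfold ham at a1
            rw [h, hPn] at a1
            linarith
          exact P_injOn (show (0 : ℝ) ≤ z.1 by linarith) (show (0 : ℝ) ≤ y by linarith) this
        · exfalso
          have hz2 : ⌊z.2⌋ = (n : ℤ) + 1 :=
            Int.floor_eq_iff.2 ⟨by push_cast; linarith, by push_cast; linarith⟩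
          have hz1 : z.1 = ⌊z.1⌋ := by
            rcases eq_floor_of_mem_grid a2 with h' | h'
            · exact h'
            · rw [hz2] at h'; push_cast at h'; linarith
          have hz3 : (m : ℝ) + 1 ≤ z.1 := by
            have : (m : ℤ) < ⌊z.1⌋ := by
              have : ((m : ℤ) : ℝ) < ⌊z.1⌋ := by rw [← hz1]; exact_mod_cast a5
              exact_mod_cast this
            rw [hz1]; exact_mod_cast this
          have c1 := P_le_P (by positivity) hz3
          have c2 := P_lt_P (by positivity) h
          have c3 := P_natCast (m + 1)
          push_cast at c3
          unfold ham at a1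
          linarith
    · rw [List.map_cons, List.sortedLT_iff_pairwise, List.pairwise_cons]
      refine ⟨?_, ih2.pairwise⟩
      intro a ha
      obtain ⟨z, hz, rfl⟩ := List.mem_map.1 ha
      obtain ⟨a1, a2, a3, a4, a5⟩ := (ih1 z).1 hz
      rw [Prod.Lex.toLex_lt_toLex]
      left
      show y < z.1
      by_contra hcon
      have c1 := P_le_P (show (0 : ℝ) ≤ z.1 by linarith) (not_lt.1 hcon)
      have c2 := P_lt_P a3 a4
      unfold ham at a1
      linarith
    · rw [List.map_cons, ih3]
      congr 1
      have : ¬ y = ⌊y⌋ := by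
        have : ⌊y⌋ = (m : ℤ) := Int.floor_eq_iff.2 ⟨by push_cast; linarith, by push_cast; linarith⟩
        rw [this]; push_cast; linarith
      unfold vertexType
      rw [if_neg this]
      simp only
      rw [abs_of_nonneg (by linarith)]
      exact (Nat.floor_eq_iff (by linarith)).2 ⟨y1.le, y2⟩

/-- The vertex list is read off from the path of boxes, which depends on `e` only. -/
theorem vertexList_eq {e : ℕ} {α : ℝ} (hα : α ∈ criticalInterval e) :
    vertexList α = types e (diagIndex e) (diagIndex e) := by
  set M := diagIndex e with hM
  obtain ⟨h1, h2, h3⟩ := vertices_spec hα M M (diagIndex_le e) (lt_diagIndex e)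
  obtain ⟨hα1, hα2⟩ := hα
  have b1 : (M : ℝ) ^ 2 + (M : ℝ) ^ 2 < α := lt_of_le_of_lt (by exact_mod_cast diagIndex_le e) hα1
  have b2 := hα2.trans_le (nextCritical_le_of_lt (lt_diagIndex e))
  rw [← hM] at b2
  push_cast at b2
  have hmem : ∀ z, z ∈ octantVertices α ↔ z ∈ vertices e α M M := by
    intro z
    rw [h1]
    have hPM : P ((M : ℝ) + 1) = ((M : ℝ) + 1) ^ 2 := by
      have := P_natCast (M + 1)
      push_cast at this
      exact this
    constructor
    · rintro ⟨a1, a2, a3, a4⟩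
      unfold ham at a1
      refine ⟨a1, a2, a3, ?_, ?_⟩
      · by_contra h
        have c1 := P_le_P (by positivity) (not_lt.1 h)
        have c2 := P_le_P a3 a4
        linarith
      · by_contra h
        have c1 := P_le_P (a3.trans a4) (not_lt.1 h)
        have c2 := P_le_P a3 a4
        rw [P_natCast] at c1
        linarith
    · rintro ⟨a1, a2, a3, a4, a5⟩
      refine ⟨a1, a2, a3, ?_⟩
      by_contra h
      have d1 : z.1 < M + 1 := by linarith
      have d2 : ⌊z.1⌋ = (M : ℤ) :=
        Int.floor_eq_iff.2 ⟨by push_cast; linarith, by push_cast; linarith⟩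
      have d3 : ⌊z.2⌋ = (M : ℤ) :=
        Int.floor_eq_iff.2 ⟨by push_cast; linarith, by push_cast; linarith⟩
      rcases eq_floor_of_mem_grid a2 with h' | h'
      · rw [d2] at h'; push_cast at h'; linarith
      · rw [d3] at h'; push_cast at h'; linarith
  have hset : (octantVertices_finite α).toFinset.map toLex.toEmbedding =
      ((vertices e α M M).map toLex).toFinset := by
    ext z
    simp only [Finset.mem_map, Set.Finite.mem_toFinset, List.mem_toFinset, List.mem_map, hmem]
    rfl
  unfold vertexList
  rw [hset, (List.toFinset_sort (· ≤ ·) h2.nodup).2 h2.sortedLE.pairwise, ← h3, List.map_map]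
  rfl

end

noncomputable section

/-! ### Sums of periodic functions -/

theorem periodic_mul {h : ℤ → ℕ} {t : ℤ} (ht : ∀ y, h (y + t) = h y) (y k : ℤ) :
    h (y + t * k) = h y := by
  have : Function.Periodic h t := ht
  have := this.int_mul k y
  rwa [mul_comm] at this

/-- An arithmetic progression of `t` terms whose difference is coprime to `t` runs once over the
residues modulo `t`. -/
theorem sum_affine {h : ℤ → ℕ} {t : ℕ} (ht0 : 0 < t) (ht : ∀ y, h (y + t) = h y) {a : ℤ}
    (ha : IsCoprime a t) (b : ℤ) :
    ∑ j ∈ Finset.range t, h (b + a * j) = ∑ j ∈ Finset.range t, h j := by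
  have htz : (0 : ℤ) < t := by exact_mod_cast ht0
  have hnn : ∀ j : ℤ, 0 ≤ j % t := fun j => Int.emod_nonneg _ htz.ne'
  have hlt : ∀ j : ℤ, j % t < t := fun j => Int.emod_lt_of_pos _ htz
  have hmaps : ∀ j ∈ Finset.range t, ((b + a * j) % t).toNat ∈ Finset.range t := by
    intro j _
    rw [Finset.mem_range]
    have := hnn (b + a * j)
    have := hlt (b + a * j)
    omega
  have hinj : Set.InjOn (fun j : ℕ => ((b + a * j) % t).toNat) (Finset.range t : Set ℕ) := by
    intro i hi j hj hij
    simp only [Finset.coe_range, Set.mem_Iio] at hi hj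
    have h1 : (b + a * i) % t = (b + a * j) % t := by
      have := hnn (b + a * i)
      have := hnn (b + a * j)
      simp only at hij
      omega
    have h2 : (t : ℤ) ∣ a * (j - i) := by
      have := Int.ModEq.dvd (show (b + a * i) ≡ (b + a * j) [ZMOD t] from h1)
      have e : b + a * j - (b + a * i) = a * (j - i) := by ring
      rwa [e] at this
    have h3 : (t : ℤ) ∣ (j : ℤ) - i := ha.symm.dvd_of_dvd_mul_left h2
    obtain ⟨k, hk⟩ := h3
    have hk0 : k = 0 := by
      by_contra hne
      rcases lt_or_gt_of_ne hne with hl | hl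
      · nlinarith
      · nlinarith
    rw [hk0] at hk
    omega
  refine Finset.sum_nbij (fun j : ℕ => ((b + a * j) % t).toNat) hmaps hinj ?_ ?_
  · exact Finset.surjOn_of_injOn_of_card_le _ hmaps hinj le_rfl
  · intro j _
    rw [Int.toNat_of_nonneg (hnn _)]
    conv_lhs => rw [← Int.emod_add_mul_ediv (b + a * j) t]
    exact periodic_mul ht _ _

theorem sum_shift {h : ℤ → ℕ} {t : ℕ} (ht0 : 0 < t) (ht : ∀ y, h (y + t) = h y) (b : ℤ) :
    ∑ j ∈ Finset.range t, h (b + j) = ∑ j ∈ Finset.range t, h j := by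
  simpa using sum_affine ht0 ht isCoprime_one_left b

theorem sum_range_mul (h : ℤ → ℕ) (t k : ℕ) :
    ∑ j ∈ Finset.range (t * k), h j =
      ∑ i ∈ Finset.range k, ∑ j ∈ Finset.range t, h (j + t * i) := by
  induction k with
  | zero => simp
  | succ k ih =>
    rw [Nat.mul_succ, Finset.sum_range_add, ih, Finset.sum_range_succ]
    congr 1
    refine Finset.sum_congr rfl fun j _ => ?_
    congr 1
    push_cast
    ring

theorem sum_range_mul_of_periodic {h : ℤ → ℕ} {t : ℕ} (ht : ∀ y, h (y + t) = h y) (k : ℕ) :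
    ∑ j ∈ Finset.range (t * k), h j = k * ∑ j ∈ Finset.range t, h j := by
  rw [sum_range_mul]
  simp only [periodic_mul ht]
  simp

/-- Two fundamental rectangles of the lattice generated by `(u, -u')` and `(0, u' s)`, which also
contains `(u s, 0)`, give the same sum of a function invariant under the lattice. -/
theorem sum_rectangle_swap {f : ℤ → ℤ → ℕ} {u u' s : ℕ} (hs : 0 < s) (hu : 0 < u) (hu' : 0 < u')
    (hw : ∀ x y, f (x + u) (y - u') = f x y) (hp : ∀ x y, f x (y + (u' * s : ℕ)) = f x y) :
    ∑ x ∈ Finset.range u, ∑ y ∈ Finset.range (u' * s), f x y =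
      ∑ y ∈ Finset.range u', ∑ x ∈ Finset.range (u * s), f x y := by
  have hwk : ∀ (k : ℕ) x y, f (x + u * k) (y - u' * k) = f x y := by
    intro k
    induction k with
    | zero => intro x y; simp
    | succ k ih =>
      intro x y
      rw [← ih x y, ← hw (x + u * k) (y - u' * k)]
      congr 1 <;> push_cast <;> ring
  have hp' : ∀ y x, f (x + (u * s : ℕ)) y = f x y := by
    intro y x
    have h1 := hwk s x (y + (u' * s : ℕ))
    rw [hp] at h1
    rw [← h1]
    congr 1
    push_cast
    ring
  have hx : ∀ x : ℤ, (∑ y ∈ Finset.range (u' * s), f (x + u) y) =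
      ∑ y ∈ Finset.range (u' * s), f x y := by
    intro x
    have h1 : ∀ y : ℤ, f (x + u) y = f x (u' + y) := by
      intro y
      rw [← hw x (u' + y)]
      congr 1
      ring
    simp only [h1]
    exact sum_shift (by positivity) (hp x) _
  have hy : ∀ y : ℤ, (∑ x ∈ Finset.range (u * s), f x (y + u')) =
      ∑ x ∈ Finset.range (u * s), f x y := by
    intro y
    have h1 : ∀ x : ℤ, f x (y + u') = f (u + x) y := by
      intro x
      rw [← hw x (y + u'), add_comm x]
      congr 1
      ring
    simp only [h1]
    exact sum_shift (h := fun x => f x y) (by positivity) (hp' y) _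
  have e1 := sum_range_mul_of_periodic (h := fun x => ∑ y ∈ Finset.range (u' * s), f x y) hx s
  have e2 := sum_range_mul_of_periodic (h := fun y => ∑ x ∈ Finset.range (u * s), f x y) hy s
  rw [Finset.sum_comm] at e1
  exact Nat.eq_of_mul_eq_mul_left hs (e1.symm.trans e2)

/-! ### The crossing maps -/

/-- Within a box, points that differ by a multiple of `(u, -u')` lie on the same orbit of `F⁴`.
The map moves `(a, b)` along this direction until `N ≤ a < N + u`, and then applies a shear, with
step `σ` in the direction of `a`, which describes the passage to the next box. -/
def turn (u u' N σ : ℤ) (g : ℤ → ℤ) (a b : ℤ) : ℤ × ℤ :=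
  (N + (a - N) % u + σ, b + (a - N) / u * u' + g (N + (a - N) % u))

/-- Points on the same orbit have the same image. -/
theorem turn_translate {u : ℤ} (hu : u ≠ 0) (u' N σ : ℤ) (g : ℤ → ℤ) (a b k : ℤ) :
    turn u u' N σ g (a + u * k) (b - u' * k) = turn u u' N σ g a b := by
  have h : a + u * k - N = a - N + u * k := by ring
  unfold turn
  rw [h, Int.add_mul_emod_self_left, Int.add_mul_ediv_left _ _ hu]
  congr 1
  ring

/-- Shifts transversal to the direction of the crossing commute with it. -/
theorem turn_add (u u' N σ : ℤ) (g : ℤ → ℤ) (a b t : ℤ) :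
    turn u u' N σ g a (b + t) =
      ((turn u u' N σ g a b).1, (turn u u' N σ g a b).2 + t) := by
  unfold turn
  refine Prod.ext rfl ?_
  simp only
  ring

theorem turn_of_mem {u N a : ℤ} (h1 : N ≤ a) (h2 : a < N + u) (u' σ : ℤ) (g : ℤ → ℤ) (b : ℤ) :
    turn u u' N σ g a b = (a + σ, b + g a) := by
  unfold turn
  rw [Int.emod_eq_of_lt (by omega) (by omega), Int.ediv_eq_zero_of_lt (by omega) (by omega)]
  simp

/-- The downward step of `F⁴` in the row `n`, as a function of the abscissa. -/
def rowStep (lam : ℝ) (n : ℕ) (x : ℤ) : ℤ := ⌊lam * x⌋ - ⌊lam * (-(x + n + 1) : ℤ)⌋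

/-- The step of `F⁴` to the right in the column `m`, as a function of the ordinate. -/
def colStep (lam : ℝ) (m : ℕ) (y : ℤ) : ℤ := ⌊lam * (y - (2 * m + 1) : ℤ)⌋ - ⌊lam * (m - y : ℤ)⌋

/-- The passage from the box `(m, n)` to `(m + 1, n)`. -/
def crossRight (lam : ℝ) (m n : ℕ) (p : ℤ × ℤ) : ℤ × ℤ :=
  turn (2 * n + 1) (2 * m + 1) (⌈((m : ℝ) + 1) / lam⌉ - (2 * n + 1)) (2 * n + 1)
    (fun x => -rowStep lam n x) p.1 p.2

/-- The passage from the box `(m, n)` to `(m, n - 1)`. -/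
def crossDown (lam : ℝ) (m n : ℕ) (p : ℤ × ℤ) : ℤ × ℤ :=
  (turn (2 * m + 1) (2 * n + 1) ⌈(n : ℝ) / lam⌉ (-(2 * m + 1)) (colStep lam m) p.2 p.1).swap

/-- The residue, modulo the number `2 m + 1` of the last column `m`, of the ordinates at which the
orbit of `p` under `F⁴` arrives at the positive `x`-axis, for a point `p` in the box `(m, n)` of
the path of `e`. -/
def label (e : ℕ) (lam : ℝ) (m n : ℕ) (p : ℤ × ℤ) : ℤ :=
  if (m + 1) ^ 2 + n ^ 2 ≤ e then label e lam (m + 1) n (crossRight lam m n p)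
  else match n with
    | 0 => p.2 % (2 * m + 1)
    | n + 1 => label e lam m n (crossDown lam m (n + 1) p)
termination_by n + (e - m)
decreasing_by
  · have : m + 1 ≤ e := by nlinarith
    omega
  · omega

variable {e m n : ℕ} {lam : ℝ}

theorem label_right (h : (m + 1) ^ 2 + n ^ 2 ≤ e) (p : ℤ × ℤ) :
    label e lam m n p = label e lam (m + 1) n (crossRight lam m n p) := by
  rw [label.eq_def, if_pos h]

theorem label_zero (h : ¬ (m + 1) ^ 2 + 0 ^ 2 ≤ e) (p : ℤ × ℤ) :
    label e lam m 0 p = p.2 % (2 * m + 1) := by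
  rw [label, if_neg h]

theorem label_down (h : ¬ (m + 1) ^ 2 + (n + 1) ^ 2 ≤ e) (p : ℤ × ℤ) :
    label e lam m (n + 1) p = label e lam m n (crossDown lam m (n + 1) p) := by
  rw [label, if_neg h]

/-- Points on the same orbit in a box have the same label. -/
theorem label_translate (x y k : ℤ) :
    label e lam m n (x + (2 * n + 1) * k, y - (2 * m + 1) * k) = label e lam m n (x, y) := by
  by_cases h : (m + 1) ^ 2 + n ^ 2 ≤ e
  · rw [label_right h, label_right h, crossRight, crossRight]
    simp only
    rw [turn_translate (by omega)]
  · cases n with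
    | zero =>
      rw [label_zero h, label_zero h]
      simp only
      rw [Int.sub_mul_emod_self_left]
    | succ n =>
      rw [label_down h, label_down h, crossDown, crossDown]
      simp only
      have := turn_translate (u := 2 * (m : ℤ) + 1) (by omega) (2 * ((n + 1 : ℕ) : ℤ) + 1)
        ⌈((n + 1 : ℕ) : ℝ) / lam⌉ (-(2 * m + 1)) (colStep lam m) y x (-k)
      rw [show y - (2 * (m : ℤ) + 1) * k = y + (2 * (m : ℤ) + 1) * -k by ring,
        show x + (2 * ((n + 1 : ℕ) : ℤ) + 1) * k = x - (2 * ((n + 1 : ℕ) : ℤ) + 1) * -k by ring,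
        this]

/-- The crossing to the right is equivariant with respect to vertical shifts. -/
theorem label_right_add (h : (m + 1) ^ 2 + n ^ 2 ≤ e) (x y : ℤ) : ∃ x' y' : ℤ, ∀ t : ℤ,
    label e lam m n (x, y + t) = label e lam (m + 1) n (x', y' + t) := by
  refine ⟨(crossRight lam m n (x, y)).1, (crossRight lam m n (x, y)).2, fun t => ?_⟩
  rw [label_right h]
  unfold crossRight
  simp only
  rw [turn_add]

/-- The crossing downwards is equivariant with respect to horizontal shifts. -/
theorem label_down_add (h : ¬ (m + 1) ^ 2 + (n + 1) ^ 2 ≤ e) (x y : ℤ) : ∃ x' y' : ℤ, ∀ t : ℤ,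
    label e lam m (n + 1) (x + t, y) = label e lam m n (x' + t, y') := by
  refine ⟨(crossDown lam m (n + 1) (x, y)).1, (crossDown lam m (n + 1) (x, y)).2, fun t => ?_⟩
  rw [label_down h]
  unfold crossDown
  simp only
  rw [turn_add]
  rfl

/-- The shifts by `Q / (2 n + 1)` upwards and by `Q / (2 m + 1)` to the right are congruent modulo
the direction of the box `(m, n)`. -/
theorem label_up_eq_right {Q : ℕ} (h : (2 * n + 1) * (2 * m + 1) ∣ Q) (x y : ℤ) :
    label e lam m n (x, y + (Q / (2 * n + 1) : ℕ)) =
      label e lam m n (x + (Q / (2 * m + 1) : ℕ), y) := by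
  obtain ⟨s, rfl⟩ := h
  rw [show (2 * n + 1) * (2 * m + 1) * s / (2 * n + 1) = (2 * m + 1) * s by
      rw [mul_assoc, Nat.mul_div_cancel_left _ (by omega)],
    show (2 * n + 1) * (2 * m + 1) * s / (2 * m + 1) = (2 * n + 1) * s by
      rw [mul_comm (2 * n + 1), mul_assoc, Nat.mul_div_cancel_left _ (by omega)],
    ← label_translate x (y + _) s]
  congr 2
  push_cast
  ring

/-! ### Equivariance of the label -/

/-- The type of the first vertex met from the box `(m, n)` on. -/
def headType (e m n : ℕ) : ℕ := if (m + 1) ^ 2 + n ^ 2 ≤ e then n else m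

theorem types_eq_cons (e m n : ℕ) : ∃ l, types e m n = headType e m n :: l := by
  unfold headType
  split_ifs with h
  · exact ⟨_, types_right h⟩
  · cases n with
    | zero => exact ⟨_, types_zero h⟩
    | succ n => exact ⟨_, types_down h⟩

/-- Consecutive distinct entries `a`, `b` of `l` outside `S` satisfy `(2 a + 1) (2 b + 1) ∣ Q`. -/
def DivChain (S : Set ℕ) (Q : ℕ) (l : List ℕ) : Prop :=
  l.IsChain fun a b => a ≠ b → b ∉ S → (2 * a + 1) * (2 * b + 1) ∣ Q

theorem DivChain.tail {S : Set ℕ} {Q a : ℕ} {l : List ℕ} (h : DivChain S Q (a :: l)) :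
    DivChain S Q l := by
  unfold DivChain at h ⊢
  exact h.tail

theorem DivChain.head {S : Set ℕ} {Q a : ℕ} (h : DivChain S Q (a :: types e m n)) :
    a ≠ headType e m n → headType e m n ∉ S → (2 * a + 1) * (2 * headType e m n + 1) ∣ Q := by
  obtain ⟨l, hl⟩ := types_eq_cons e m n
  rw [hl] at h
  unfold DivChain at h
  rw [List.isChain_cons_cons] at h
  exact h.1

theorem headType_of_right (h : (m + 1) ^ 2 + n ^ 2 ≤ e) : headType e m n = n := if_pos h

theorem headType_of_not (h : ¬ (m + 1) ^ 2 + n ^ 2 ≤ e) : headType e m n = m := if_neg h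

/-- The label is invariant under the shift by `Q / (2 v + 1)` along the line that contains the
first vertex, of type `v`, if `Q` is divisible by `2 v + 1` and by the products of the consecutive
distinct numbers `2 v_j + 1`. -/
theorem label_periodic {Q : ℕ} (hmn : n ≤ m) (hd : DivChain ∅ Q (types e m n)) :
    ((m + 1) ^ 2 + n ^ 2 ≤ e →
      ∀ x y : ℤ, label e lam m n (x, y + (Q / (2 * n + 1) : ℕ)) = label e lam m n (x, y)) ∧
    (¬ (m + 1) ^ 2 + n ^ 2 ≤ e →
      ∀ x y : ℤ, label e lam m n (x + (Q / (2 * m + 1) : ℕ), y) = label e lam m n (x, y)) := by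
  induction m, n using path_induction e with
  | hV m n hc ih =>
    rw [types_right hc] at hd
    obtain ⟨ih1, ih2⟩ := ih (by omega) hd.tail
    refine ⟨fun _ x y => ?_, fun h => absurd hc h⟩
    obtain ⟨x', y', hxy⟩ := label_right_add (lam := lam) hc x y
    have h0 := hxy 0
    rw [add_zero, add_zero] at h0
    rw [hxy, h0]
    by_cases hc' : (m + 1 + 1) ^ 2 + n ^ 2 ≤ e
    · exact ih1 hc' _ _
    · have hh := hd.head
      rw [headType_of_not hc'] at hh
      rw [label_up_eq_right (hh (by omega) (by simp))]
      exact ih2 hc' _ _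
  | h0 m hc =>
    refine ⟨fun h => absurd h hc, fun _ x y => ?_⟩
    rw [label_zero hc, label_zero hc]
  | hH m n hc ih =>
    rw [types_down hc] at hd
    obtain ⟨ih1, ih2⟩ := ih (by omega) hd.tail
    refine ⟨fun h => absurd h hc, fun _ x y => ?_⟩
    obtain ⟨x', y', hxy⟩ := label_down_add (lam := lam) hc x y
    have h0 := hxy 0
    rw [add_zero, add_zero] at h0
    rw [hxy, h0]
    by_cases hc' : (m + 1) ^ 2 + n ^ 2 ≤ e
    · have hh := hd.head
      rw [headType_of_right hc', mul_comm] at hh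
      rw [← label_up_eq_right (hh (by omega) (by simp))]
      exact ih1 hc' _ _
    · exact ih2 hc' _ _

/-- In the last column, the label is the residue of the ordinate. -/
theorem label_last_column (hm : e < (m + 1) ^ 2) (p : ℤ × ℤ) :
    label e lam m n p = p.2 % (2 * m + 1) := by
  induction n generalizing p with
  | zero => exact label_zero (by omega) p
  | succ n ih =>
    have hc : ¬ (m + 1) ^ 2 + (n + 1) ^ 2 ≤ e := by
      have := Nat.zero_le ((n + 1) ^ 2)
      omega
    rw [label_down hc, ih]
    unfold crossDown turn
    simp only [Prod.swap_prod_mk]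
    set N := ⌈((n + 1 : ℕ) : ℝ) / lam⌉
    have := Int.emod_add_mul_ediv (p.2 - N) (2 * m + 1)
    rw [show N + (p.2 - N) % (2 * m + 1) + -(2 * m + 1) =
      p.2 + (2 * m + 1) * (-((p.2 - N) / (2 * m + 1)) - 1) by linear_combination this,
      Int.add_mul_emod_self_left]

/-- If `2 v + 1`, where `v = ⌊√e⌋` is the last type, is coprime to `Q`, and the products of the
other consecutive distinct numbers `2 v_j + 1` divide `Q`, then the shift by `Q / (2 v₁ + 1)` along
the line of the first vertex, of type `v₁ ≠ v`, adds a unit to the label. -/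
theorem label_twist {Q mf : ℕ} (hmf : mf ^ 2 ≤ e) (hmf' : e < (mf + 1) ^ 2) (hmn : n ≤ m)
    (hm : m < mf) (hd : DivChain {mf} Q (types e m n)) (hQ : Nat.Coprime Q (2 * mf + 1))
    (hh : 2 * headType e m n + 1 ∣ Q) :
    ∃ κ : ℤ, IsCoprime κ (2 * mf + 1) ∧
    ((m + 1) ^ 2 + n ^ 2 ≤ e → ∀ x y : ℤ, label e lam m n (x, y + (Q / (2 * n + 1) : ℕ)) ≡
      label e lam m n (x, y) + κ [ZMOD 2 * mf + 1]) ∧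
    (¬ (m + 1) ^ 2 + n ^ 2 ≤ e → ∀ x y : ℤ, label e lam m n (x + (Q / (2 * m + 1) : ℕ), y) ≡
      label e lam m n (x, y) + κ [ZMOD 2 * mf + 1]) := by
  induction m, n using path_induction e with
  | hV m n hc ih =>
    rw [types_right hc] at hd
    rw [headType_of_right hc] at hh
    rcases Nat.lt_or_ge (m + 1) mf with hm' | hm'
    · have hhd : 2 * headType e (m + 1) n + 1 ∣ Q := by
        by_cases hne : n = headType e (m + 1) n
        · rwa [← hne]
        · refine (Dvd.intro_left _ rfl).trans (hd.head hne ?_)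
          have : headType e (m + 1) n ≤ m + 1 := by unfold headType; split_ifs <;> omega
          simp only [Set.mem_singleton_iff]
          omega
      obtain ⟨κ, hκ, ih1, ih2⟩ := ih (by omega) hm' hd.tail hhd
      refine ⟨κ, hκ, fun _ x y => ?_, fun h => absurd hc h⟩
      obtain ⟨x', y', hxy⟩ := label_right_add (lam := lam) hc x y
      have h0 := hxy 0
      rw [add_zero, add_zero] at h0
      rw [hxy, h0]
      by_cases hc' : (m + 1 + 1) ^ 2 + n ^ 2 ≤ e
      · exact ih1 hc' _ _
      · have hh := hd.head
        rw [headType_of_not hc'] at hh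
        rw [label_up_eq_right (hh (by omega) (by simp only [Set.mem_singleton_iff]; omega))]
        exact ih2 hc' _ _
    · obtain rfl : mf = m + 1 := by omega
      refine ⟨(Q / (2 * n + 1) : ℕ), ?_, fun _ x y => ?_, fun h => absurd hc h⟩
      · have := Nat.isCoprime_iff_coprime.2 (hQ.coprime_dvd_left (Nat.div_dvd_of_dvd hh))
        exact_mod_cast this
      · obtain ⟨x', y', hxy⟩ := label_right_add (lam := lam) hc x y
        have h0 := hxy 0
        rw [add_zero, add_zero] at h0
        rw [hxy, h0, label_last_column hmf', label_last_column hmf']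
        push_cast
        exact (Int.mod_modEq _ _).trans ((Int.mod_modEq _ _).symm.add_right _)
  | h0 m hc =>
    exfalso
    have := Nat.pow_le_pow_left (show m + 1 ≤ mf by omega) 2
    omega
  | hH m n hc ih =>
    rw [types_down hc] at hd
    rw [headType_of_not hc] at hh
    have hhd : 2 * headType e m n + 1 ∣ Q := by
      by_cases hne : m = headType e m n
      · rwa [← hne]
      · refine (Dvd.intro_left _ rfl).trans (hd.head hne ?_)
        have : headType e m n ≤ m := by unfold headType; split_ifs <;> omega
        simp only [Set.mem_singleton_iff]
        omega
    obtain ⟨κ, hκ, ih1, ih2⟩ := ih (by omega) hm hd.tail hhd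
    refine ⟨κ, hκ, fun h => absurd h hc, fun _ x y => ?_⟩
    obtain ⟨x', y', hxy⟩ := label_down_add (lam := lam) hc x y
    have h0 := hxy 0
    rw [add_zero, add_zero] at h0
    rw [hxy, h0]
    by_cases hc' : (m + 1) ^ 2 + n ^ 2 ≤ e
    · have hh := hd.head
      rw [headType_of_right hc', mul_comm] at hh
      rw [← label_up_eq_right (hh (by omega) (by simp only [Set.mem_singleton_iff]; omega))]
      exact ih1 hc' _ _
    · exact ih2 hc' _ _

end

noncomputable section

/-! ### Equidistribution of the label -/

/-- The sum of a function invariant under the lattice generated by `(u, -u')` and `(0, t)` over a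
fundamental domain made of `u` columns of height `t` does not depend on the positions of the
columns. -/
theorem sum_rectangle_shift {f : ℤ → ℤ → ℕ} {u t : ℕ} {u' : ℤ} (hu : 0 < u) (ht : 0 < t)
    (hw : ∀ x y, f (x + u) (y - u') = f x y) (hp : ∀ x y, f x (y + t) = f x y) (a : ℤ)
    (b : ℤ → ℤ) :
    ∑ x ∈ Finset.range u, ∑ y ∈ Finset.range t, f (a + x) (b (a + x) + y) =
      ∑ x ∈ Finset.range u, ∑ y ∈ Finset.range t, f x y := by
  have h1 : ∀ x : ℤ, ∑ y ∈ Finset.range t, f x (b x + y) = ∑ y ∈ Finset.range t, f x y :=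
    fun x => sum_shift ht (hp x) (b x)
  simp only [h1]
  refine sum_shift (h := fun x => ∑ y ∈ Finset.range t, f x y) hu (fun x => ?_) a
  have h2 : ∀ y : ℤ, f (x + u) y = f x (u' + y) := by
    intro y
    rw [← hw x (u' + y)]
    congr 1
    ring
  simp only [h2]
  exact sum_shift ht (hp x) _

variable {e m n : ℕ} {lam : ℝ}

/-- The indicator of the points with label `c`. -/
def labelIndicator (e : ℕ) (lam : ℝ) (m n : ℕ) (c x y : ℤ) : ℕ :=
  if label e lam m n (x, y) = c then 1 else 0

theorem labelIndicator_translate (c x y k : ℤ) :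
    labelIndicator e lam m n c (x + (2 * n + 1) * k) (y - (2 * m + 1) * k) =
      labelIndicator e lam m n c x y := by
  unfold labelIndicator
  rw [label_translate]

theorem crossRight_of_mem {x : ℤ} (h1 : ⌈((m : ℝ) + 1) / lam⌉ - (2 * n + 1) ≤ x)
    (h2 : x < ⌈((m : ℝ) + 1) / lam⌉) (y : ℤ) :
    crossRight lam m n (x, y) = (x + (2 * n + 1), y - rowStep lam n x) := by
  unfold crossRight
  rw [turn_of_mem h1 (by linarith)]
  rfl

theorem crossDown_of_mem {y : ℤ} (h1 : ⌈(n : ℝ) / lam⌉ ≤ y)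
    (h2 : y < ⌈(n : ℝ) / lam⌉ + (2 * m + 1)) (x : ℤ) :
    crossDown lam m n (x, y) = (x + colStep lam m y, y - (2 * m + 1)) := by
  unfold crossDown
  rw [turn_of_mem h1 h2]
  rfl

/-- The label takes every value with the same frequency on the points of the plane lattice: the
passages between the boxes preserve the number of points in a fundamental domain. -/
theorem label_equidistributed {Q mf : ℕ} (hQ : 0 < Q) (hmf' : e < (mf + 1) ^ 2) (hmf : mf ^ 2 ≤ e)
    {c : ℤ} (hc0 : 0 ≤ c) (hc1 : c < 2 * mf + 1) (hmn : n ≤ m) (hm : m ≤ mf)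
    (hd : DivChain ∅ Q (types e m n)) (hh : 2 * headType e m n + 1 ∣ Q) :
    ((m + 1) ^ 2 + n ^ 2 ≤ e →
      (2 * mf + 1) * ∑ x ∈ Finset.range (2 * n + 1), ∑ y ∈ Finset.range (Q / (2 * n + 1)),
        labelIndicator e lam m n c x y = Q) ∧
    (¬ (m + 1) ^ 2 + n ^ 2 ≤ e →
      (2 * mf + 1) * ∑ y ∈ Finset.range (2 * m + 1), ∑ x ∈ Finset.range (Q / (2 * m + 1)),
        labelIndicator e lam m n c x y = Q) := by
  induction m, n using path_induction e with
  | hV m n hc ih =>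
    rw [types_right hc] at hd
    rw [headType_of_right hc] at hh
    refine ⟨fun _ => ?_, fun h => absurd hc h⟩
    have hm' : m + 1 ≤ mf := by
      by_contra hcon
      have := Nat.pow_le_pow_left (show mf + 1 ≤ m + 1 by omega) 2
      have := Nat.zero_le (n ^ 2)
      omega
    have hhd : 2 * headType e (m + 1) n + 1 ∣ Q := by
      by_cases hne : n = headType e (m + 1) n
      · rwa [← hne]
      · exact (Dvd.intro_left _ rfl).trans (hd.head hne (by simp))
    obtain ⟨ih1, ih2⟩ := ih (by omega) hm' hd.tail hhd
    obtain ⟨p1, p2⟩ := label_periodic (lam := lam) (show n ≤ m + 1 by omega) hd.tail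
    have ht : 0 < Q / (2 * n + 1) := Nat.div_pos (Nat.le_of_dvd hQ hh) (by omega)
    have hper : ∀ x y : ℤ, label e lam (m + 1) n (x, y + (Q / (2 * n + 1) : ℕ)) =
        label e lam (m + 1) n (x, y) := by
      intro x y
      by_cases hc' : (m + 1 + 1) ^ 2 + n ^ 2 ≤ e
      · exact p1 hc' x y
      · have hh := hd.head
        rw [headType_of_not hc'] at hh
        rw [label_up_eq_right (hh (by omega) (by simp)), p2 hc']
    have hper0 : ∀ x y : ℤ, label e lam m n (x, y + (Q / (2 * n + 1) : ℕ)) =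
        label e lam m n (x, y) := by
      intro x y
      obtain ⟨x', y', hxy⟩ := label_right_add (lam := lam) hc x y
      have h0 := hxy 0
      rw [add_zero, add_zero] at h0
      rw [hxy, h0, hper]
    have key : ∑ x ∈ Finset.range (2 * n + 1), ∑ y ∈ Finset.range (Q / (2 * n + 1)),
        labelIndicator e lam m n c x y =
        ∑ x ∈ Finset.range (2 * n + 1), ∑ y ∈ Finset.range (Q / (2 * n + 1)),
        labelIndicator e lam (m + 1) n c x y := by
      set N := ⌈((m : ℝ) + 1) / lam⌉ with hN
      rw [← sum_rectangle_shift (f := labelIndicator e lam m n c) (u' := 2 * m + 1) (by omega) ht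
          (fun x y => by
            rw [← labelIndicator_translate c x y 1]; push_cast; ring_nf)
          (fun x y => by unfold labelIndicator; rw [hper0]) (N - (2 * n + 1)) (fun _ => 0),
        ← sum_rectangle_shift (f := labelIndicator e lam (m + 1) n c) (u' := 2 * (m + 1 : ℕ) + 1)
          (by omega) ht
          (fun x y => by
            rw [← labelIndicator_translate c x y 1]; push_cast; ring_nf)
          (fun x y => by unfold labelIndicator; rw [hper]) N
          (fun x => -rowStep lam n (x - (2 * n + 1)))]
      refine Finset.sum_congr rfl fun i hi => Finset.sum_congr rfl fun j _ => ?_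
      rw [Finset.mem_range] at hi
      unfold labelIndicator
      rw [label_right hc, crossRight_of_mem (by omega) (by omega)]
      rw [show N - (2 * (n : ℤ) + 1) + i + (2 * n + 1) = N + i by ring,
        show N - (2 * (n : ℤ) + 1) + i = N + i - (2 * n + 1) by ring,
        show (0 : ℤ) + j - rowStep lam n (N + i - (2 * n + 1)) =
          -rowStep lam n (N + i - (2 * n + 1)) + j by ring]
    rw [key]
    by_cases hc' : (m + 1 + 1) ^ 2 + n ^ 2 ≤ e
    · exact ih1 hc'
    · refine Eq.trans ?_ (ih2 hc')
      congr 1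
      have hh := hd.head
      rw [headType_of_not hc'] at hh
      obtain ⟨s, hs⟩ := hh (by omega) (by simp)
      have e1 : Q / (2 * n + 1) = (2 * (m + 1) + 1) * s := by
        rw [hs, mul_assoc, Nat.mul_div_cancel_left _ (by omega)]
      have e2 : Q / (2 * (m + 1) + 1) = (2 * n + 1) * s := by
        rw [hs, mul_comm (2 * n + 1), mul_assoc, Nat.mul_div_cancel_left _ (by omega)]
      have hs0 : 0 < s := by
        rcases Nat.eq_zero_or_pos s with h | h
        · rw [h] at hs; omega
        · exact h
      rw [e2]
      rw [e1] at hper ⊢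
      exact sum_rectangle_swap hs0 (by omega) (by omega)
        (fun x y => by
          rw [← labelIndicator_translate c x y 1]; push_cast; ring_nf)
        (fun x y => by unfold labelIndicator; rw [hper])
  | h0 m hc =>
    refine ⟨fun h => absurd h hc, fun _ => ?_⟩
    obtain rfl : m = mf := by
      by_contra hcon
      have := Nat.pow_le_pow_left (show m + 1 ≤ mf by omega) 2
      omega
    rw [headType_of_not hc] at hh
    have h1 : ∀ y ∈ Finset.range (2 * m + 1), ∑ x ∈ Finset.range (Q / (2 * m + 1)),
        labelIndicator e lam m 0 c x y = if y = c.toNat then Q / (2 * m + 1) else 0 := by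
      intro y hy
      rw [Finset.mem_range] at hy
      have h2 : ∀ x : ℤ, labelIndicator e lam m 0 c x y = if y = c.toNat then 1 else 0 := by
        intro x
        unfold labelIndicator
        rw [label_zero hc]
        simp only
        rw [Int.emod_eq_of_lt (by omega) (by omega)]
        congr 1
        exact propext ⟨fun h => by omega, fun h => by omega⟩
      simp only [h2]
      split_ifs <;> simp
    rw [Finset.sum_congr rfl h1, Finset.sum_ite_eq' (Finset.range (2 * m + 1)), if_pos]
    · exact Nat.mul_div_cancel' hh
    · rw [Finset.mem_range]; omega
  | hH m n hc ih =>
    rw [types_down hc] at hd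
    rw [headType_of_not hc] at hh
    refine ⟨fun h => absurd h hc, fun _ => ?_⟩
    have hhd : 2 * headType e m n + 1 ∣ Q := by
      by_cases hne : m = headType e m n
      · rwa [← hne]
      · exact (Dvd.intro_left _ rfl).trans (hd.head hne (by simp))
    obtain ⟨ih1, ih2⟩ := ih (by omega) hm hd.tail hhd
    obtain ⟨p1, p2⟩ := label_periodic (lam := lam) (show n ≤ m by omega) hd.tail
    have ht : 0 < Q / (2 * m + 1) := Nat.div_pos (Nat.le_of_dvd hQ hh) (by omega)
    have hper : ∀ x y : ℤ, label e lam m n (x + (Q / (2 * m + 1) : ℕ), y) =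
        label e lam m n (x, y) := by
      intro x y
      by_cases hc' : (m + 1) ^ 2 + n ^ 2 ≤ e
      · have hh := hd.head
        rw [headType_of_right hc', mul_comm] at hh
        rw [← label_up_eq_right (hh (by omega) (by simp)), p1 hc']
      · exact p2 hc' x y
    have hper0 : ∀ x y : ℤ, label e lam m (n + 1) (x + (Q / (2 * m + 1) : ℕ), y) =
        label e lam m (n + 1) (x, y) := by
      intro x y
      obtain ⟨x', y', hxy⟩ := label_down_add (lam := lam) hc x y
      have h0 := hxy 0
      rw [add_zero, add_zero] at h0
      rw [hxy, h0, hper]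
    have key : ∑ y ∈ Finset.range (2 * m + 1), ∑ x ∈ Finset.range (Q / (2 * m + 1)),
        labelIndicator e lam m (n + 1) c x y =
        ∑ y ∈ Finset.range (2 * m + 1), ∑ x ∈ Finset.range (Q / (2 * m + 1)),
        labelIndicator e lam m n c x y := by
      set N := ⌈((n + 1 : ℕ) : ℝ) / lam⌉ with hN
      rw [← sum_rectangle_shift (f := fun y x => labelIndicator e lam m (n + 1) c x y)
          (u' := 2 * (n + 1 : ℕ) + 1) (by omega) ht
          (fun y x => by
            rw [← labelIndicator_translate c x y (-1)]; push_cast; ring_nf)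
          (fun y x => by unfold labelIndicator; rw [hper0]) N (fun _ => 0),
        ← sum_rectangle_shift (f := fun y x => labelIndicator e lam m n c x y) (u' := 2 * n + 1)
          (by omega) ht
          (fun y x => by
            rw [← labelIndicator_translate c x y (-1)]; push_cast; ring_nf)
          (fun y x => by unfold labelIndicator; rw [hper]) (N - (2 * m + 1))
          (fun y => colStep lam m (y + (2 * m + 1)))]
      refine Finset.sum_congr rfl fun i hi => Finset.sum_congr rfl fun j _ => ?_
      rw [Finset.mem_range] at hi
      unfold labelIndicator
      rw [label_down hc, crossDown_of_mem (by omega) (by omega)]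
      rw [show N - (2 * (m : ℤ) + 1) + i + (2 * m + 1) = N + i by ring,
        show N - (2 * (m : ℤ) + 1) + i = N + i - (2 * m + 1) by ring,
        show (0 : ℤ) + j + colStep lam m (N + i) = colStep lam m (N + i) + j by ring]
    rw [key]
    by_cases hc' : (m + 1) ^ 2 + n ^ 2 ≤ e
    · refine Eq.trans ?_ (ih1 hc')
      congr 1
      have hh := hd.head
      rw [headType_of_right hc'] at hh
      obtain ⟨s, hs⟩ := hh (by omega) (by simp)
      have e1 : Q / (2 * m + 1) = (2 * n + 1) * s := by
        rw [hs, mul_assoc, Nat.mul_div_cancel_left _ (by omega)]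
      have e2 : Q / (2 * n + 1) = (2 * m + 1) * s := by
        rw [hs, mul_comm (2 * m + 1), mul_assoc, Nat.mul_div_cancel_left _ (by omega)]
      have hs0 : 0 < s := by
        rcases Nat.eq_zero_or_pos s with h | h
        · rw [h] at hs; omega
        · exact h
      rw [e2]
      rw [e1] at hper ⊢
      exact sum_rectangle_swap (f := fun y x => labelIndicator e lam m n c x y) hs0 (by omega)
        (by omega)
        (fun y x => by
          rw [← labelIndicator_translate c x y (-1)]; push_cast; ring_nf)
        (fun y x => by unfold labelIndicator; rw [hper])
    · exact ih2 hc'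

end

noncomputable section

/-! ### The modulus `q` and the count of the points with a given label -/

theorem q_dvd_iff (V : List ℕ) (D : ℕ) : q V ∣ D ↔ (2 * V.headI + 1) ^ 2 ∣ D ∧
    ∀ a b, (a, b) ∈ V.zip V.tail → a ≠ b → (2 * a + 1) * (2 * b + 1) ∣ D := by
  unfold q
  generalize V.zip V.tail = l
  generalize (2 * V.headI + 1) ^ 2 = r
  induction l with
  | nil => simp
  | cons p l ih =>
    rw [List.foldr_cons]
    obtain ⟨a, b⟩ := p
    simp only
    split_ifs with h
    · rw [ih]
      constructor
      · rintro ⟨h1, h2⟩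
        refine ⟨h1, fun c d hcd hne => ?_⟩
        rcases List.mem_cons.1 hcd with h' | h'
        · cases h'; exact absurd h hne
        · exact h2 c d h' hne
      · rintro ⟨h1, h2⟩
        exact ⟨h1, fun c d hcd hne => h2 c d (List.mem_cons_of_mem _ hcd) hne⟩
    · rw [Nat.lcm_dvd_iff, ih]
      constructor
      · rintro ⟨h0, h1, h2⟩
        refine ⟨h1, fun c d hcd hne => ?_⟩
        rcases List.mem_cons.1 hcd with h' | h'
        · cases h'; exact h0
        · exact h2 c d h' hne
      · rintro ⟨h1, h2⟩
        exact ⟨h2 a b List.mem_cons_self h, h1,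
          fun c d hcd hne => h2 c d (List.mem_cons_of_mem _ hcd) hne⟩

/-- The list of consecutive pairs in the definition of `q` and the chain condition agree. -/
theorem divChain_of_zip {S : Set ℕ} {Q : ℕ} {V : List ℕ}
    (h : ∀ a b, (a, b) ∈ V.zip V.tail → a ≠ b → b ∉ S → (2 * a + 1) * (2 * b + 1) ∣ Q) :
    DivChain S Q V := by
  unfold DivChain
  induction V with
  | nil => exact List.IsChain.nil
  | cons a l ih =>
    cases l with
    | nil => exact List.IsChain.singleton _
    | cons b l =>
      rw [List.isChain_cons_cons]
      exact ⟨h a b (by simp), ih fun c d hcd => h c d (by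
        simp only [List.tail_cons, List.zip_cons_cons, List.mem_cons] at hcd ⊢
        exact Or.inr hcd)⟩

/-- The square of the product of the numbers `2 u + 1` over the types `u ≠ v`. -/
def coprimePart (V : List ℕ) (v : ℕ) : ℕ := (∏ u ∈ V.toFinset.erase v, (2 * u + 1)) ^ 2

theorem dvd_coprimePart {V : List ℕ} {v a : ℕ} (ha : a ∈ V) (hav : a ≠ v) :
    2 * a + 1 ∣ coprimePart V v :=
  (Finset.dvd_prod_of_mem (fun u => 2 * u + 1)
    (Finset.mem_erase.2 ⟨hav, List.mem_toFinset.2 ha⟩)).trans (Dvd.intro_left _ (by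
      unfold coprimePart; rw [sq]))

theorem mul_dvd_coprimePart {V : List ℕ} {v a b : ℕ} (ha : a ∈ V) (hav : a ≠ v) (hb : b ∈ V)
    (hbv : b ≠ v) : (2 * a + 1) * (2 * b + 1) ∣ coprimePart V v := by
  unfold coprimePart
  rw [sq]
  exact mul_dvd_mul
    (Finset.dvd_prod_of_mem (fun u => 2 * u + 1) (Finset.mem_erase.2 ⟨hav, List.mem_toFinset.2 ha⟩))
    (Finset.dvd_prod_of_mem (fun u => 2 * u + 1) (Finset.mem_erase.2 ⟨hbv, List.mem_toFinset.2 hb⟩))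

theorem coprime_coprimePart {V : List ℕ} {v : ℕ}
    (h : ∀ v' ∈ V, v' ≠ v → Nat.Coprime (2 * v + 1) (2 * v' + 1)) :
    Nat.Coprime (coprimePart V v) (2 * v + 1) := by
  refine Nat.Coprime.pow_left 2 (Nat.Coprime.prod_left fun u hu => ?_)
  obtain ⟨h1, h2⟩ := Finset.mem_erase.1 hu
  exact (h u (List.mem_toFinset.1 h2) h1).symm

theorem coprimePart_coprime_two (V : List ℕ) (v : ℕ) : Nat.Coprime (coprimePart V v) 2 := by
  refine Nat.Coprime.pow_left 2 (Nat.Coprime.prod_left fun u _ => ?_)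
  rw [Nat.coprime_two_right]
  exact ⟨u, rfl⟩

theorem mem_of_zip_tail {V : List ℕ} {a b : ℕ} (h : (a, b) ∈ V.zip V.tail) : a ∈ V ∧ b ∈ V :=
  ⟨(List.of_mem_zip h).1, List.mem_of_mem_tail (List.of_mem_zip h).2⟩

/-- A list whose last entry differs from its first one has a consecutive pair of distinct entries
that ends with the last one. -/
theorem exists_zip_getLast (l : List ℕ) (a v : ℕ) (h : (a :: l).getLast? = some v) (ha : a ≠ v) :
    ∃ c, c ≠ v ∧ (c, v) ∈ (a :: l).zip l := by
  induction l generalizing a with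
  | nil => simp at h; exact absurd h ha
  | cons b l ih =>
    by_cases hb : b = v
    · exact ⟨a, ha, by simp [hb]⟩
    · rw [List.getLast?_cons_cons] at h
      obtain ⟨c, hc, hcv⟩ := ih b h hb
      exact ⟨c, hc, by rw [List.zip_cons_cons]; exact List.mem_cons_of_mem _ hcv⟩

variable {e m n : ℕ} {lam : ℝ}

theorem sqrt_unique {m : ℕ} (h1 : m ^ 2 ≤ e) (h2 : e < (m + 1) ^ 2) : m = Nat.sqrt e := by
  rw [Nat.eq_sqrt']
  exact ⟨h1, h2⟩

theorem le_sqrt_of_sq {m n : ℕ} (h : m ^ 2 + n ^ 2 ≤ e) : m ≤ Nat.sqrt e :=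
  Nat.le_sqrt'.2 (by have := Nat.zero_le (n ^ 2); omega)

theorem types_getLast? (h : m ^ 2 + n ^ 2 ≤ e) :
    (types e m n).getLast? = some (Nat.sqrt e) := by
  induction m, n using path_induction e with
  | hV m n hc ih =>
    obtain ⟨l, hl⟩ := types_eq_cons e (m + 1) n
    rw [types_right hc]
    rw [hl] at ih ⊢
    rw [List.getLast?_cons_cons]
    exact ih hc
  | h0 m hc =>
    rw [types_zero hc, ← sqrt_unique (m := m) (by omega) (by omega)]
    rfl
  | hH m n hc ih =>
    obtain ⟨l, hl⟩ := types_eq_cons e m n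
    rw [types_down hc]
    rw [hl] at ih ⊢
    rw [List.getLast?_cons_cons]
    exact ih (le_trans (Nat.add_le_add_left (Nat.pow_le_pow_left (by omega) 2) _) h)

theorem label_mem (h : m ^ 2 + n ^ 2 ≤ e) (p : ℤ × ℤ) :
    0 ≤ label e lam m n p ∧ label e lam m n p < 2 * Nat.sqrt e + 1 := by
  induction m, n using path_induction e generalizing p with
  | hV m n hc ih =>
    rw [label_right hc]
    exact ih hc _
  | h0 m hc =>
    rw [label_zero hc, ← sqrt_unique (m := m) (by omega) (by omega)]
    exact ⟨Int.emod_nonneg _ (by omega), Int.emod_lt_of_pos _ (by omega)⟩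
  | hH m n hc ih =>
    rw [label_down hc]
    exact ih (le_trans (Nat.add_le_add_left (Nat.pow_le_pow_left (by omega) 2) _) h) _

theorem headType_diag (e m : ℕ) : headType e m m = m := by
  unfold headType
  split_ifs <;> rfl

theorem types_headI (e m : ℕ) : (types e m m).headI = m := by
  obtain ⟨l, hl⟩ := types_eq_cons e m m
  rw [hl, headType_diag]
  rfl

theorem q_dvd_prod (V : List ℕ) : q V ∣ (2 * V.headI + 1) ^ 2 *
    ∏ u ∈ V.toFinset ×ˢ V.toFinset, (2 * u.1 + 1) * (2 * u.2 + 1) := by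
  rw [q_dvd_iff]
  refine ⟨Dvd.intro _ rfl, fun a b hab _ => Dvd.dvd.mul_left ?_ _⟩
  obtain ⟨ha, hb⟩ := mem_of_zip_tail hab
  exact Finset.dvd_prod_of_mem (fun u : ℕ × ℕ => (2 * u.1 + 1) * (2 * u.2 + 1))
    (Finset.mk_mem_product (List.mem_toFinset.2 ha) (List.mem_toFinset.2 hb))

theorem q_odd (V : List ℕ) : Odd (q V) := by
  refine Odd.of_dvd_nat ?_ (q_dvd_prod V)
  rw [← Nat.coprime_two_right]
  refine Nat.Coprime.mul_left ?_ (Nat.Coprime.prod_left fun u _ => ?_)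
  · rw [Nat.coprime_two_right]; exact (odd_two_mul_add_one _).pow
  · rw [Nat.coprime_two_right]; exact (odd_two_mul_add_one _).mul (odd_two_mul_add_one _)

/-- The number `q / (2 v₁ + 1)`, the common coordinate of the lattice vector `L`. -/
def diagPeriod (e : ℕ) : ℕ :=
  q (types e (diagIndex e) (diagIndex e)) / (2 * diagIndex e + 1)

/-- The label of the point `(x, x)` on the diagonal. -/
def diagLabel (e : ℕ) (lam : ℝ) (x : ℤ) : ℤ := label e lam (diagIndex e) (diagIndex e) (x, x)

theorem sq_dvd_q (e : ℕ) :
    (2 * diagIndex e + 1) ^ 2 ∣ q (types e (diagIndex e) (diagIndex e)) := by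
  have := ((q_dvd_iff (types e (diagIndex e) (diagIndex e)) _).1 dvd_rfl).1
  rwa [types_headI] at this

theorem dvd_diagPeriod (e : ℕ) : 2 * diagIndex e + 1 ∣ diagPeriod e := by
  obtain ⟨k, hk⟩ := sq_dvd_q e
  unfold diagPeriod
  rw [hk, sq, mul_assoc, Nat.mul_div_cancel_left _ (by omega)]
  exact Dvd.intro _ rfl

theorem mul_diagPeriod (e : ℕ) :
    (2 * diagIndex e + 1) * diagPeriod e = q (types e (diagIndex e) (diagIndex e)) :=
  Nat.mul_div_cancel' ((Dvd.intro_left _ (sq _).symm).trans (sq_dvd_q e))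

theorem diagPeriod_odd (e : ℕ) : Odd (diagPeriod e) :=
  (q_odd (types e (diagIndex e) (diagIndex e))).of_dvd_nat
    (Dvd.intro_left _ (mul_diagPeriod e))

theorem diagPeriod_pos (e : ℕ) : 0 < diagPeriod e := (diagPeriod_odd e).pos

/-- A shift of length `2 t`, with `2 v₁ + 1 ∣ t`, along the line of the first vertex is congruent
to the shift by `(t, t)`, modulo the direction of the box on the diagonal. -/
theorem label_diag_shift {t k : ℤ} (ht : t = (2 * m + 1) * k) (x y : ℤ) :
    label e lam m m (x + t, y + t) = label e lam m m (x, y + t + t) ∧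
      label e lam m m (x + t, y + t) = label e lam m m (x + t + t, y) := by
  constructor
  · rw [← label_translate x (y + t + t) k]
    congr 2
    · rw [ht]
    · rw [ht]; ring
  · rw [← label_translate (x + t) (y + t) k]
    congr 2
    · rw [ht]
    · rw [ht]; ring

/-- The shift of length `q / (2 v₁ + 1)` along the line of the first vertex preserves the label. -/
theorem label_period {V : List ℕ} (hV : V = types e (diagIndex e) (diagIndex e)) :
    ((diagIndex e + 1) ^ 2 + diagIndex e ^ 2 ≤ e → ∀ x y : ℤ,
      label e lam (diagIndex e) (diagIndex e) (x, y + diagPeriod e) =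
        label e lam (diagIndex e) (diagIndex e) (x, y)) ∧
    (¬ (diagIndex e + 1) ^ 2 + diagIndex e ^ 2 ≤ e → ∀ x y : ℤ,
      label e lam (diagIndex e) (diagIndex e) (x + diagPeriod e, y) =
        label e lam (diagIndex e) (diagIndex e) (x, y)) := by
  have hd : DivChain ∅ (q V) V := divChain_of_zip fun a b hab hne _ =>
    ((q_dvd_iff V _).1 dvd_rfl).2 a b hab hne
  subst hV
  exact label_periodic le_rfl hd

theorem diagLabel_periodic (x : ℤ) : diagLabel e lam (x + diagPeriod e) = diagLabel e lam x := by
  obtain ⟨k, hk⟩ := dvd_diagPeriod e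
  obtain ⟨h1, h2⟩ := label_period (e := e) (lam := lam) rfl
  obtain ⟨h3, h4⟩ := label_diag_shift (e := e) (lam := lam) (m := diagIndex e)
    (t := diagPeriod e) (k := k) (by exact_mod_cast hk) x x
  unfold diagLabel
  by_cases hc : (diagIndex e + 1) ^ 2 + diagIndex e ^ 2 ≤ e
  · rw [h3, h1 hc, h1 hc]
  · rw [h4, h2 hc, h2 hc]

/-- The number of `x` modulo `q / (2 v₁ + 1)` for which the label of `(x, x)` is `c`. -/
theorem diagLabel_count (hcop : CoprimalityCondition (types e (diagIndex e) (diagIndex e)))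
    {c : ℤ} (hc0 : 0 ≤ c) (hc1 : c < 2 * Nat.sqrt e + 1) :
    (2 * Nat.sqrt e + 1) * ∑ x ∈ Finset.range (diagPeriod e),
      (if diagLabel e lam x = c then 1 else 0) = diagPeriod e := by
  set M := diagIndex e with hM
  set mf := Nat.sqrt e with hmf
  set V := types e M M with hV
  have hq := (q_dvd_iff V (q V)).1 dvd_rfl
  have hMe : M ^ 2 + M ^ 2 ≤ e := diagIndex_le e
  have hMmf : M ≤ mf := le_sqrt_of_sq hMe
  have hlast : V.getLast? = some mf := types_getLast? hMe
  have hhead : V.headI = M := types_headI e M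
  obtain ⟨l, hl⟩ : ∃ l, V = M :: l := by
    obtain ⟨l, hl⟩ := types_eq_cons e M M
    rw [headType_diag] at hl
    exact ⟨l, hl⟩
  have hMV : M ∈ V := by rw [hl]; exact List.mem_cons_self
  have hqR : q V = (2 * M + 1) * diagPeriod e := (mul_diagPeriod e).symm
  have hmf1 : mf ^ 2 ≤ e := Nat.sqrt_le' e
  have hmf2 : e < (mf + 1) ^ 2 := Nat.lt_succ_sqrt' e
  obtain ⟨v, hv, hvc⟩ := hcop
  by_cases hvM : v = M
  · -- The first type is coprime to the other ones.  Modulo the direction of the first box, the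
    -- points `(x, x)` with `x = j + (2 v₁ + 1) i` are the points `(j, j + 2 (2 v₁ + 1) i)`, which
    -- run over a fundamental domain, on which the label is equidistributed.
    subst hvM
    obtain ⟨q'', hq''⟩ := dvd_diagPeriod e
    rw [← hM] at hq''
    have hqq : q V = (2 * M + 1) ^ 2 * q'' := by rw [hqR, hq'']; ring
    have hdiv : q V ∣ (2 * M + 1) ^ 2 * coprimePart V M := by
      rw [q_dvd_iff, hhead]
      refine ⟨Dvd.intro _ rfl, fun a b hab hne => ?_⟩
      obtain ⟨ha, hb⟩ := mem_of_zip_tail hab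
      by_cases haM : a = M
      · rw [haM]
        exact mul_dvd_mul (Dvd.intro_left _ (sq _).symm) (dvd_coprimePart hb (by omega))
      · by_cases hbM : b = M
        · rw [hbM, mul_comm (2 * a + 1)]
          exact mul_dvd_mul (Dvd.intro_left _ (sq _).symm) (dvd_coprimePart ha haM)
        · exact (mul_dvd_coprimePart ha haM hb hbM).mul_left _
    have hq''d : q'' ∣ coprimePart V M := by
      rw [hqq] at hdiv
      exact Nat.dvd_of_mul_dvd_mul_left (by positivity) hdiv
    have hcopR : Nat.Coprime q'' (2 * M + 1) := (coprime_coprimePart hvc).coprime_dvd_left hq''d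
    have hcop2 : Nat.Coprime q'' 2 := (coprimePart_coprime_two V M).coprime_dvd_left hq''d
    have hfac : ∀ d, Nat.Coprime d (2 * M + 1) → d ∣ q V → d ∣ q'' := by
      intro d hd1 hd2
      rw [hqq] at hd2
      exact (Nat.Coprime.pow_right 2 hd1).dvd_of_dvd_mul_left hd2
    have hchain : DivChain ∅ (diagPeriod e) V := by
      refine divChain_of_zip fun a b hab hne _ => ?_
      have hqab := hq.2 a b hab hne
      obtain ⟨ha, hb⟩ := mem_of_zip_tail hab
      rw [hq'']
      by_cases haM : a = M
      · subst haM
        exact mul_dvd_mul dvd_rfl (hfac _ (hvc b hb (Ne.symm hne)).symm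
          ((Dvd.intro_left _ rfl).trans hqab))
      · by_cases hbM : b = M
        · rw [hbM, mul_comm (2 * a + 1)]
          exact mul_dvd_mul dvd_rfl (hfac _ (hvc a ha haM).symm ((Dvd.intro _ rfl).trans hqab))
        · exact (hfac _ (Nat.Coprime.mul_left (hvc a ha haM).symm (hvc b hb hbM).symm)
            hqab).mul_left _
    have hper := label_periodic (lam := lam) (le_refl M) hchain
    have hequi := label_equidistributed (lam := lam) (diagPeriod_pos e) hmf2 hmf1 hc0 hc1
      (le_refl M) hMmf hchain (by rw [headType_diag]; exact dvd_diagPeriod e)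
    have hdq : diagPeriod e / (2 * M + 1) = q'' := by
      rw [hq'', Nat.mul_div_cancel_left _ (by omega)]
    rw [hdq] at hper hequi
    have hq''0 : 0 < q'' := by
      rcases Nat.eq_zero_or_pos q'' with h | h
      · have := diagPeriod_pos e
        rw [hq'', h] at this
        omega
      · exact h
    have hcop2R : IsCoprime (2 * (2 * (M : ℤ) + 1)) q'' := by
      have := Nat.isCoprime_iff_coprime.2 (Nat.Coprime.mul_right hcop2 hcopR).symm
      exact_mod_cast this
    have hsum := sum_range_mul (fun x => if diagLabel e lam x = c then 1 else 0) (2 * M + 1) q''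
    rw [← hq'', Finset.sum_comm] at hsum
    by_cases hdir : (M + 1) ^ 2 + M ^ 2 ≤ e
    · refine Eq.trans ?_ (hequi.1 hdir)
      congr 1
      rw [hsum]
      refine Finset.sum_congr rfl fun j _ => ?_
      rw [← sum_affine (h := fun y => labelIndicator e lam M M c j y) hq''0
        (fun y => by unfold labelIndicator; rw [hper.1 hdir]) hcop2R j]
      refine Finset.sum_congr rfl fun i _ => ?_
      unfold labelIndicator diagLabel
      rw [(label_diag_shift (by push_cast; rfl) (j : ℤ) (j : ℤ)).1]
      push_cast
      rw [show (j : ℤ) + (2 * M + 1) * i + (2 * M + 1) * i = j + 2 * (2 * M + 1) * i by ring]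
    · refine Eq.trans ?_ (hequi.2 hdir)
      congr 1
      rw [hsum]
      refine Finset.sum_congr rfl fun j _ => ?_
      rw [← sum_affine (h := fun x => labelIndicator e lam M M c x j) hq''0
        (fun y => by unfold labelIndicator; rw [hper.2 hdir]) hcop2R j]
      refine Finset.sum_congr rfl fun i _ => ?_
      unfold labelIndicator diagLabel
      rw [(label_diag_shift (by push_cast; rfl) (j : ℤ) (j : ℤ)).2]
      push_cast
      rw [show (j : ℤ) + (2 * M + 1) * i + (2 * M + 1) * i = j + 2 * (2 * M + 1) * i by ring]
  · -- The last type is coprime to the other ones.  The shift by `q' / (2 v₁ + 1)` along the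
    -- diagonal, where `q = q' (2 ⌊√e⌋ + 1)`, adds a unit to the label, which therefore takes
    -- every value once in `2 ⌊√e⌋ + 1` such shifts.
    have hvmf : v = mf := by
      rcases hv with h | h
      · rw [hl] at h
        simp at h
        exact absurd h.symm hvM
      · rw [hlast] at h
        simpa using h.symm
    subst hvmf
    have hMlt : M < mf := lt_of_le_of_ne hMmf (Ne.symm hvM)
    have hQq : 2 * mf + 1 ∣ q V := by
      obtain ⟨c, hc, hcv⟩ := exists_zip_getLast l M mf (by rw [← hl]; exact hlast) hMlt.ne
      have : (c, mf) ∈ V.zip V.tail := by rw [hl]; exact hcv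
      exact (Dvd.intro_left _ rfl).trans (hq.2 c mf this hc)
    obtain ⟨q', hq'⟩ := hQq
    have hdiv : q V ∣ (2 * mf + 1) * coprimePart V mf := by
      rw [q_dvd_iff, hhead]
      refine ⟨?_, fun a b hab hne => ?_⟩
      · rw [sq]
        exact (mul_dvd_coprimePart hMV hMlt.ne hMV hMlt.ne).mul_left _
      · obtain ⟨ha, hb⟩ := mem_of_zip_tail hab
        by_cases haM : a = mf
        · rw [haM]
          exact mul_dvd_mul dvd_rfl (dvd_coprimePart hb (by omega))
        · by_cases hbM : b = mf
          · rw [hbM, mul_comm (2 * a + 1)]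
            exact mul_dvd_mul dvd_rfl (dvd_coprimePart ha haM)
          · exact (mul_dvd_coprimePart ha haM hb hbM).mul_left _
    have hq'd : q' ∣ coprimePart V mf := by
      rw [hq'] at hdiv
      exact Nat.dvd_of_mul_dvd_mul_left (by positivity) hdiv
    have hcopQ : Nat.Coprime q' (2 * mf + 1) := (coprime_coprimePart hvc).coprime_dvd_left hq'd
    have hfac : ∀ d, Nat.Coprime d (2 * mf + 1) → d ∣ q V → d ∣ q' := by
      intro d hd1 hd2
      rw [hq'] at hd2
      exact hd1.dvd_of_dvd_mul_left hd2
    have hcopM : Nat.Coprime (2 * M + 1) (2 * mf + 1) := (hvc M hMV hMlt.ne).symm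
    have hR2 : (2 * M + 1) ^ 2 ∣ q' := hfac _ (Nat.Coprime.pow_left 2 hcopM) (by
      have := hq.1; rwa [hhead] at this)
    have hchain : DivChain {mf} q' V := by
      refine divChain_of_zip fun a b hab hne hbS => ?_
      have hbM : b ≠ mf := by simpa using hbS
      have hqab := hq.2 a b hab hne
      obtain ⟨ha, hb⟩ := mem_of_zip_tail hab
      by_cases haM : a = mf
      · -- The last type never precedes a different type
        exfalso
        subst haM
        have key : ∀ m n, m ^ 2 + n ^ 2 ≤ e → n ≤ m → ∀ b,
            (mf, b) ∈ (types e m n).zip (types e m n).tail → b = mf ∨ mf = n := by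
          intro m n
          induction m, n using path_induction e with
          | hV m n hc ih =>
            intro h1 h2 b hb
            have hm1 : m + 1 ≤ mf := le_sqrt_of_sq hc
            rw [types_right hc, List.tail_cons] at hb
            obtain ⟨l', hl'⟩ := types_eq_cons e (m + 1) n
            rw [hl', List.zip_cons_cons] at hb
            rcases List.mem_cons.1 hb with h | h
            · injection h with h _
              omega
            · rcases ih hc (by omega) b (by rw [hl', List.tail_cons]; exact h) with h' | h'
              · exact Or.inl h'
              · exact Or.inr h'
          | h0 m hc =>
            intro h1 h2 b hb
            rw [types_zero hc] at hb
            simp at hb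
          | hH m n hc ih =>
            intro h1 h2 b hb
            have hle : m ^ 2 + n ^ 2 ≤ e :=
              le_trans (Nat.add_le_add_left (Nat.pow_le_pow_left (by omega) 2) _) h1
            have hm1 : m ≤ mf := le_sqrt_of_sq hle
            rw [types_down hc, List.tail_cons] at hb
            obtain ⟨l', hl'⟩ := types_eq_cons e m n
            rw [hl', List.zip_cons_cons] at hb
            rcases List.mem_cons.1 hb with h | h
            · injection h with h h'
              left
              rw [h', headType_of_not, h]
              have := Nat.zero_le (n ^ 2)
              rw [← h]
              omega
            · rcases ih hle (by omega) b (by rw [hl', List.tail_cons]; exact h) with h' | h'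
              · exact Or.inl h'
              · omega
        rcases key M M hMe le_rfl b hab with h | h
        · exact hbM h
        · omega
      · exact hfac _ (Nat.Coprime.mul_left (hvc a ha haM).symm (hvc b hb hbM).symm) hqab
    have hRq' : 2 * M + 1 ∣ q' := (Dvd.intro_left _ (sq _).symm).trans hR2
    obtain ⟨κ, hκ, ht1, ht2⟩ := label_twist (lam := lam) hmf1 hmf2 (le_refl M) hMlt hchain hcopQ
      (by rw [headType_diag]; exact hRq')
    obtain ⟨k, hk⟩ := hR2
    have hl' : q' / (2 * M + 1) = (2 * M + 1) * k := by
      rw [hk, sq, mul_assoc, Nat.mul_div_cancel_left _ (by omega)]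
    rw [hl'] at ht1 ht2
    have hper : diagPeriod e = (2 * M + 1) * k * (2 * mf + 1) := by
      refine Nat.eq_of_mul_eq_mul_left (show 0 < 2 * M + 1 by omega) ?_
      rw [← hqR, hq', hk]
      ring
    have hshift : ∀ (x : ℤ), diagLabel e lam (x + ((2 * M + 1) * k : ℕ)) ≡
        diagLabel e lam x + 2 * κ [ZMOD 2 * mf + 1] := by
      intro x
      unfold diagLabel
      obtain ⟨h3, h4⟩ := label_diag_shift (e := e) (lam := lam) (m := M)
        (t := ((2 * M + 1) * k : ℕ)) (k := k) (by push_cast; ring) x x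
      by_cases hc : (M + 1) ^ 2 + M ^ 2 ≤ e
      · rw [h3]
        refine (ht1 hc _ _).trans ?_
        rw [show ∀ z : ℤ, z + 2 * κ = z + κ + κ by intro z; ring]
        exact (ht1 hc _ _).add_right _
      · rw [h4]
        refine (ht2 hc _ _).trans ?_
        rw [show ∀ z : ℤ, z + 2 * κ = z + κ + κ by intro z; ring]
        exact (ht2 hc _ _).add_right _
    have hshifts : ∀ (x : ℤ) (i : ℕ), diagLabel e lam (x + ((2 * M + 1) * k : ℕ) * i) ≡
        diagLabel e lam x + 2 * κ * i [ZMOD 2 * mf + 1] := by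
      intro x i
      induction i with
      | zero => simp
      | succ i ih =>
        have h1 := (hshift (x + ((2 * M + 1) * k : ℕ) * i)).trans (ih.add_right _)
        convert h1 using 1
        · congr 1; push_cast; ring
        · push_cast; ring
    have hcop2 : IsCoprime (2 * κ) ((2 * mf + 1 : ℕ) : ℤ) := by
      push_cast
      exact IsCoprime.mul_left ⟨-mf, 1, by ring⟩ hκ
    rw [hper, sum_range_mul (fun x => if diagLabel e lam x = c then 1 else 0), Finset.sum_comm]
    have hone : ∀ j ∈ Finset.range ((2 * M + 1) * k), ∑ i ∈ Finset.range (2 * mf + 1),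
        (if diagLabel e lam ((j : ℤ) + ((2 * M + 1) * k : ℕ) * i) = c then 1 else 0) = 1 := by
      intro j _
      have h1 : ∀ i : ℕ, (if diagLabel e lam ((j : ℤ) + ((2 * M + 1) * k : ℕ) * i) = c then 1
          else 0) = (fun z : ℤ => if z % (2 * mf + 1) = c then 1 else 0)
            (diagLabel e lam j + 2 * κ * i) := by
        intro i
        obtain ⟨r1, r2⟩ := label_mem (lam := lam) hMe
          ((j : ℤ) + ((2 * M + 1) * k : ℕ) * i, (j : ℤ) + ((2 * M + 1) * k : ℕ) * i)
        have h2 := hshifts j i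
        unfold Int.ModEq at h2
        simp only
        rw [← h2, Int.emod_eq_of_lt (a := diagLabel e lam _) r1 r2]
      rw [Finset.sum_congr rfl fun i _ => h1 i,
        sum_affine (h := fun z : ℤ => if z % (2 * mf + 1) = c then 1 else 0) (by omega)
          (fun y => by push_cast; rw [Int.add_emod_right]) hcop2,
        Finset.sum_eq_single_of_mem c.toNat (Finset.mem_range.2 (by omega))]
      · rw [Int.toNat_of_nonneg hc0, Int.emod_eq_of_lt hc0 hc1, if_pos rfl]
      · intro b hb hbc
        rw [Finset.mem_range] at hb
        rw [Int.emod_eq_of_lt (by omega) (by omega), if_neg]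
        omega
    rw [Finset.sum_congr rfl hone]
    simp
    ring

end

noncomputable section

/-! ### Orbits as solutions of a second-order recursion -/

/-- The abscissas `x_t` of the orbit of `p`; they satisfy `x_{t+1} + x_{t-1} = ⌊λ x_t⌋`, and the
orbit is `t ↦ (x_t, x_{t-1})`. -/
def seq (lam : ℝ) (p : ℤ × ℤ) (t : ℤ) : ℤ := ((F lam ^ t) p).1

/-- The integer part `⌊λ x⌋`. -/
abbrev fl (lam : ℝ) (x : ℤ) : ℤ := ⌊lam * (x : ℝ)⌋

theorem F_zpow_add_one (lam : ℝ) (p : ℤ × ℤ) (t : ℤ) :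
    (F lam ^ (t + 1)) p = F lam ((F lam ^ t) p) := by
  rw [add_comm, zpow_add, zpow_one, Equiv.Perm.mul_apply]

theorem F_zpow_eq (lam : ℝ) (p : ℤ × ℤ) (t : ℤ) :
    (F lam ^ t) p = (seq lam p t, seq lam p (t - 1)) := by
  refine Prod.ext rfl ?_
  have h := F_zpow_add_one lam p (t - 1)
  rw [sub_add_cancel] at h
  rw [h]
  rfl

theorem seq_add_one (lam : ℝ) (p : ℤ × ℤ) (t : ℤ) :
    seq lam p (t + 1) = fl lam (seq lam p t) - seq lam p (t - 1) := by
  unfold seq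
  rw [F_zpow_add_one, F_zpow_eq]
  rfl

theorem seq_zero (lam : ℝ) (p : ℤ × ℤ) : seq lam p 0 = p.1 := by simp [seq]

theorem seq_neg_one (lam : ℝ) (p : ℤ × ℤ) : seq lam p (-1) = p.2 := by
  have := F_zpow_eq lam p 0
  rw [zpow_zero, Equiv.Perm.one_apply] at this
  rw [this]
  rfl

theorem seq_zpow (lam : ℝ) (p : ℤ × ℤ) (s t : ℤ) :
    seq lam ((F lam ^ s) p) t = seq lam p (t + s) := by
  unfold seq
  rw [zpow_add, Equiv.Perm.mul_apply]

/-- The recursion `x_{t+1} + x_{t-1} = ⌊λ x_t⌋`. -/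
def IsOrbit (lam : ℝ) (x : ℤ → ℤ) : Prop := ∀ t, x (t + 1) = fl lam (x t) - x (t - 1)

theorem isOrbit_seq (lam : ℝ) (p : ℤ × ℤ) : IsOrbit lam (seq lam p) := seq_add_one lam p

/-- The condition that `(x_t, x_{t-1})` lies in the domain `X` of the return map. -/
def InX (x : ℤ → ℤ) (t : ℤ) : Prop :=
  0 ≤ x t ∧ 0 ≤ x (t - 1) ∧ |x t - x (t - 1)| ≤ |x (t + 4) - x (t + 3)| ∧
    |x t - x (t - 1)| < |x (t - 4) - x (t - 5)|

theorem diagDist_eq {lam : ℝ} (hlam : 0 < lam) (p : ℤ × ℤ) :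
    diagDist lam p = (|p.1 - p.2| : ℤ) * (lam / √2) := by
  unfold diagDist scaled
  simp only
  rw [← mul_sub, abs_mul, abs_of_pos hlam]
  push_cast
  ring

theorem mem_X_iff {lam : ℝ} (hlam : 0 < lam) (p : ℤ × ℤ) (t : ℤ) :
    (F lam ^ t) p ∈ X lam ↔ InX (seq lam p) t := by
  have hpos : 0 < lam / √2 := by positivity
  unfold X InX
  rw [Set.mem_ofPred_eq, ← Equiv.Perm.mul_apply, ← Equiv.Perm.mul_apply, ← zpow_add, ← zpow_add,
    diagDist_eq hlam, diagDist_eq hlam, diagDist_eq hlam, mul_le_mul_iff_left₀ hpos,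
    mul_lt_mul_iff_left₀ hpos, Int.cast_le, Int.cast_lt, F_zpow_eq, F_zpow_eq, F_zpow_eq]
  rw [show (4 : ℤ) + t = t + 4 by ring, show (-4 : ℤ) + t = t - 4 by ring,
    show t + 4 - 1 = t + 3 by ring, show t - 4 - 1 = t - 5 by ring]

theorem mem_X_iff_zero {lam : ℝ} (hlam : 0 < lam) (p : ℤ × ℤ) :
    p ∈ X lam ↔ InX (seq lam p) 0 := by
  rw [← mem_X_iff hlam, zpow_zero, Equiv.Perm.one_apply]

theorem fl_nonneg {lam : ℝ} (hlam : 0 < lam) {x : ℤ} (hx : 0 ≤ x) : 0 ≤ fl lam x :=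
  Int.floor_nonneg.2 (mul_nonneg hlam.le (by exact_mod_cast hx))

theorem fl_neg {lam : ℝ} (hlam : 0 < lam) {x : ℤ} (hx : x < 0) : fl lam x ≤ -1 := by
  have : fl lam x < 0 := Int.floor_lt.2 (by
    push_cast
    exact mul_neg_of_pos_of_neg hlam (by exact_mod_cast hx))
  omega

theorem abs_fl_le {lam : ℝ} {x N : ℤ} (h : |lam * x| ≤ N) : |fl lam x| ≤ N := by
  obtain ⟨h1, h2⟩ := abs_le.1 h
  rw [abs_le]
  constructor
  · exact Int.le_floor.2 (by push_cast; exact h1)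
  · have : (fl lam x : ℝ) ≤ N := (Int.floor_le _).trans h2
    exact_mod_cast this

/-- The point `(x, y)` is at distance at most `E` from the origin in the scaled picture, and at
distance at least `100 (E + 1)` in the lattice. -/
def Rough (E : ℕ) (lam : ℝ) (x y : ℤ) : Prop :=
  |lam * x| ≤ E ∧ |lam * y| ≤ E ∧ 100 * ((E : ℤ) + 1) ≤ |x| + |y|

variable {lam : ℝ} {x : ℤ → ℤ} {E : ℕ}

/-- Five consecutive terms of the recursion. -/
theorem IsOrbit.next (hx : IsOrbit lam x) (t : ℤ) :
    x (t + 1) = fl lam (x t) - x (t - 1) ∧ x (t + 2) = fl lam (x (t + 1)) - x t ∧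
    x (t + 3) = fl lam (x (t + 2)) - x (t + 1) ∧ x (t + 4) = fl lam (x (t + 3)) - x (t + 2) ∧
    x (t + 5) = fl lam (x (t + 4)) - x (t + 3) := by
  refine ⟨hx t, ?_, ?_, ?_, ?_⟩
  · have := hx (t + 1); rw [add_sub_cancel_right] at this; rw [← this]; ring_nf
  · have := hx (t + 2); rw [show t + 2 - 1 = t + 1 by ring] at this; rw [← this]; ring_nf
  · have := hx (t + 3); rw [show t + 3 - 1 = t + 2 by ring] at this; rw [← this]; ring_nf
  · have := hx (t + 4); rw [show t + 4 - 1 = t + 3 by ring] at this; rw [← this]; ring_nf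

theorem abs_mul_add_le {lam : ℝ} (hlam : 0 < lam) {c y : ℤ} {N E : ℕ}
    (hc : |c| ≤ N) (hN : lam * N ≤ 1) (hy : |lam * y| ≤ E) : |lam * (c + y : ℤ)| ≤ (E : ℝ) + 1 := by
  push_cast
  rw [mul_add]
  have h1 : |lam * (c : ℝ)| ≤ lam * N := by
    rw [abs_mul, abs_of_pos hlam]
    refine mul_le_mul_of_nonneg_left ?_ hlam.le
    exact_mod_cast hc
  have := abs_add_le (lam * (c : ℝ)) (lam * y)
  linarith

/-- Bounds for the integer parts along four steps of the recursion. -/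
theorem IsOrbit.bounds (hx : IsOrbit lam x) (hlam : 0 < lam)
    (hE : lam * (4 * E + 8 : ℕ) ≤ 1) {t : ℤ} (hr : Rough E lam (x t) (x (t - 1))) :
    |fl lam (x t)| ≤ E ∧ |fl lam (x (t + 1))| ≤ E + 1 ∧ |fl lam (x (t + 2))| ≤ E + 1 ∧
    |fl lam (x (t + 3))| ≤ E + 1 ∧ |fl lam (x (t + 4))| ≤ E + 1 := by
  obtain ⟨e1, e2, e3, e4, -⟩ := hx.next t
  obtain ⟨r1, r2, -⟩ := hr
  have neg : ∀ y : ℤ, |lam * (y : ℝ)| ≤ E → |lam * ((-y : ℤ) : ℝ)| ≤ E := by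
    intro y hy
    push_cast
    rwa [mul_neg, abs_neg]
  have f0 : |fl lam (x t)| ≤ E := abs_fl_le (by exact_mod_cast r1)
  have f1 : |fl lam (x (t + 1))| ≤ E + 1 := by
    refine abs_fl_le ?_
    push_cast
    rw [e1, sub_eq_add_neg]
    exact abs_mul_add_le hlam (N := 4 * E + 8) (by push_cast; omega) hE (neg _ r2)
  have f2 : |fl lam (x (t + 2))| ≤ E + 1 := by
    refine abs_fl_le ?_
    push_cast
    rw [e2, sub_eq_add_neg]
    exact abs_mul_add_le hlam (N := 4 * E + 8) (by push_cast; omega) hE (neg _ r1)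
  rw [abs_le] at f0 f1 f2
  have f3 : |fl lam (x (t + 3))| ≤ E + 1 := by
    refine abs_fl_le ?_
    push_cast
    rw [e3, e1, show ∀ a b c : ℤ, a - (b - c) = a - b + c by intros; ring]
    refine abs_mul_add_le hlam (N := 4 * E + 8) ?_ hE r2
    rw [abs_le]
    push_cast
    omega
  rw [abs_le] at f3
  have f4 : |fl lam (x (t + 4))| ≤ E + 1 := by
    refine abs_fl_le ?_
    push_cast
    rw [e4, e2, show ∀ a b c : ℤ, a - (b - c) = a - b + c by intros; ring]
    refine abs_mul_add_le hlam (N := 4 * E + 8) ?_ hE r1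
    rw [abs_le]
    push_cast
    omega
  rw [abs_le] at f4
  refine ⟨abs_le.2 f0, abs_le.2 f1, abs_le.2 f2, abs_le.2 f3, abs_le.2 f4⟩

/-! ### The return map

Write `A_i = x_{4i}`, `B_i = x_{4i-1}`, so that `(A_i, B_i)` is the orbit of a point of `X` under
`F⁴`, and let `d_i = x_{4i} - x_{4i+1}`.  The points `(x_{4i+1}, x_{4i})` approach the first
quadrant from the second one, and `d_i` decreases; the return takes place at the first minimum of
`|d_i|`. -/

/-- The orbit has not yet returned before the index `4 n + 1`. -/
structure Outgoing (E : ℕ) (lam : ℝ) (x : ℤ → ℤ) (n : ℕ) : Prop where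
  orbit : IsOrbit lam x
  pos : 0 < lam
  small : lam * (4 * E + 8 : ℕ) ≤ 1
  start : InX x 0
  rough : ∀ i : ℕ, i ≤ n → Rough E lam (x (4 * i)) (x (4 * i - 1))
  sum_pos : ∀ i : ℕ, i < n →
    0 < (x (4 * i) - x (4 * i + 1)) + (x (4 * i + 4) - x (4 * i + 5))

theorem Outgoing.mono {n n' : ℕ} (h : Outgoing E lam x n) (hn : n' ≤ n) : Outgoing E lam x n' :=
  ⟨h.orbit, h.pos, h.small, h.start, fun i hi => h.rough i (hi.trans hn),
    fun i hi => h.sum_pos i (hi.trans_le hn)⟩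

/-- A point of the first quadrant far above the diagonal moves towards the diagonal. -/
theorem IsOrbit.neg_le_diff (hx : IsOrbit lam x) (hlam : 0 < lam)
    (hE : lam * (4 * E + 8 : ℕ) ≤ 1) (hr : Rough E lam (x 0) (x (-1))) (s1 : 0 ≤ x 0)
    (s3 : |x 0 - x (-1)| ≤ |x 4 - x 3|) :
    -(8 * ((E : ℤ) + 1)) ≤ x 0 - x (-1) := by
  obtain ⟨f0, f1, f2, f3, f4⟩ := hx.bounds (t := 0) hlam hE hr
  obtain ⟨e1, e2, e3, e4, e5⟩ := hx.next 0
  simp only [zero_add, zero_sub] at *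
  rw [abs_le] at f0 f1 f2 f3 f4
  by_contra hcon
  have g0 := fl_nonneg hlam s1
  have g1 := fl_neg hlam (show x 1 < 0 by omega)
  have g2 := fl_neg hlam (show x 2 < 0 by omega)
  have g3 := fl_nonneg hlam (show 0 ≤ x 3 by omega)
  rw [abs_of_neg (show x 0 - x (-1) < 0 by omega),
    abs_of_neg (show x 4 - x 3 < 0 by omega)] at s3
  omega

/-- The points `(A_i, B_i)` stay in the cone `A ≥ |B| - const` and far from the origin. -/
theorem Outgoing.cone {n : ℕ} (h : Outgoing E lam x n) (i : ℕ) (hi : i ≤ n) :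
    20 * ((E : ℤ) + 1) ≤ x (4 * i) ∧
      (0 ≤ x (4 * i - 1) → -(8 * ((E : ℤ) + 1)) ≤ x (4 * i) - x (4 * i - 1)) := by
  have hlam := h.pos
  induction i with
  | zero =>
    obtain ⟨s1, s2, s3, -⟩ := h.start
    have hr := h.rough 0 (Nat.zero_le _)
    have hr3 := hr.2.2
    simp only [Nat.cast_zero, mul_zero, zero_sub] at *
    have hv := h.orbit.neg_le_diff hlam h.small hr s1 s3
    rw [abs_of_nonneg s1, abs_of_nonneg s2] at hr3
    exact ⟨by omega, fun _ => hv⟩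
  | succ i ih =>
    obtain ⟨ih1, ih2⟩ := ih (by omega)
    obtain ⟨f0, f1, f2, f3, f4⟩ := h.orbit.bounds hlam h.small (h.rough i (by omega))
    obtain ⟨e1, e2, e3, e4, e5⟩ := h.orbit.next (4 * i)
    have hr3 := (h.rough (i + 1) hi).2.2
    have hs := h.sum_pos i (by omega)
    have c1 : (4 : ℤ) * ((i + 1 : ℕ) : ℤ) = 4 * i + 4 := by push_cast; ring
    rw [c1] at hr3 ⊢
    rw [show (4 : ℤ) * i + 4 - 1 = 4 * i + 3 by ring] at hr3 ⊢
    rw [abs_le] at f0 f1 f2 f3 f4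
    have g0 := fl_nonneg hlam (show 0 ≤ x (4 * i) by omega)
    have g2 := fl_neg hlam (show x (4 * i + 2) < 0 by omega)
    by_cases hB : 0 ≤ x (4 * i + 3)
    · have g1 := fl_neg hlam (show x (4 * i + 1) < 0 by omega)
      have g3 := fl_nonneg hlam hB
      have := ih2 (by omega)
      rw [abs_of_nonneg hB] at hr3
      rcases abs_cases (x (4 * i + 4)) with ⟨ha, hb⟩ | ⟨ha, hb⟩
      · exact ⟨by omega, fun _ => by omega⟩
      · exact ⟨by omega, fun _ => by omega⟩
    · refine ⟨?_, fun h => absurd h hB⟩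
      rw [abs_of_neg (show x (4 * i + 3) < 0 by omega)] at hr3
      rcases abs_cases (x (4 * i + 4)) with ⟨ha, hb⟩ | ⟨ha, hb⟩
      · omega
      · omega

/-- The signs along four steps. -/
theorem Outgoing.signs {n : ℕ} (h : Outgoing E lam x n) (i : ℕ) (hi : i ≤ n) :
    0 ≤ fl lam (x (4 * i)) ∧ x (4 * i + 2) < 0 ∧ fl lam (x (4 * i + 2)) ≤ -1 ∧
      x (4 * i + 3) < x (4 * i - 1) ∧ 0 < x (4 * i + 4) := by
  obtain ⟨h1, h2⟩ := h.cone i hi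
  obtain ⟨f0, f1, f2, f3, f4⟩ := h.orbit.bounds h.pos h.small (h.rough i hi)
  obtain ⟨e1, e2, e3, e4, e5⟩ := h.orbit.next (4 * i)
  rw [abs_le] at f0 f1 f2 f3 f4
  have g0 := fl_nonneg h.pos (show 0 ≤ x (4 * i) by omega)
  have g2 := fl_neg h.pos (show x (4 * i + 2) < 0 by omega)
  exact ⟨g0, by omega, g2, by omega, by omega⟩

/-- While `B ≥ 0`, the differences `A_i - B_i` increase. -/
theorem Outgoing.diff_lt {n : ℕ} (h : Outgoing E lam x n) (i : ℕ) (hi : i ≤ n)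
    (hB : 0 ≤ x (4 * i + 3)) :
    x (4 * i) - x (4 * i - 1) + 2 ≤ x (4 * i + 4) - x (4 * i + 3) ∧ x (4 * i) < x (4 * i + 4) := by
  obtain ⟨g0, h2, g2, h3, h4⟩ := h.signs i hi
  obtain ⟨e1, e2, e3, e4, e5⟩ := h.orbit.next (4 * i)
  have g1 := fl_neg h.pos (show x (4 * i + 1) < 0 by omega)
  have g3 := fl_nonneg h.pos hB
  omega

/-- Once `B < 0`, the coordinate `A` decreases. -/
theorem Outgoing.lt_of_neg {n : ℕ} (h : Outgoing E lam x n) (i : ℕ) (hi : i ≤ n)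
    (hB : x (4 * i - 1) < 0) : x (4 * i + 4) < x (4 * i) := by
  obtain ⟨g0, h2, g2, h3, h4⟩ := h.signs i hi
  obtain ⟨e1, e2, e3, e4, e5⟩ := h.orbit.next (4 * i)
  have g1 := fl_nonneg h.pos (show 0 ≤ x (4 * i + 1) by omega)
  have g3 := fl_neg h.pos (show x (4 * i + 3) < 0 by omega)
  omega

/-- While `x_{4i+1} ≥ 0`, the differences `d_i` decrease. -/
theorem Outgoing.dist_lt {n : ℕ} (h : Outgoing E lam x n) (i : ℕ) (hi : i ≤ n)
    (h1 : 0 ≤ x (4 * i + 1)) :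
    x (4 * i + 4) - x (4 * i + 5) < x (4 * i) - x (4 * i + 1) := by
  obtain ⟨g0, h2, g2, h3, h4⟩ := h.signs i hi
  obtain ⟨e1, e2, e3, e4, e5⟩ := h.orbit.next (4 * i)
  have g1 := fl_nonneg h.pos h1
  have g3 := fl_neg h.pos (show x (4 * i + 3) < 0 by omega)
  have g4 := fl_nonneg h.pos h4.le
  omega

/-- The steps of `F⁴`, and the increments of the differences `d_i`, are bounded. -/
theorem Outgoing.abs_diff_le {n : ℕ} (h : Outgoing E lam x n) (i : ℕ) (hi : i ≤ n) :
    |x (4 * i + 4) - x (4 * i)| ≤ 2 * E + 2 ∧ |x (4 * i + 3) - x (4 * i - 1)| ≤ 2 * E + 2 ∧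
    |(x (4 * i + 4) - x (4 * i + 5)) - (x (4 * i) - x (4 * i + 1))| ≤ 4 * E + 4 := by
  obtain ⟨f0, f1, f2, f3, f4⟩ := h.orbit.bounds h.pos h.small (h.rough i hi)
  obtain ⟨e1, e2, e3, e4, e5⟩ := h.orbit.next (4 * i)
  rw [abs_le] at f0 f1 f2 f3 f4
  refine ⟨abs_le.2 ⟨by omega, by omega⟩, abs_le.2 ⟨by omega, by omega⟩,
    abs_le.2 ⟨by omega, by omega⟩⟩

/-- `A_i - B_i` exceeds `|A_{i-1} - B_{i-1}|` while `B ≥ 0`. -/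
theorem Outgoing.abs_lt {n : ℕ} (h : Outgoing E lam x n) (i : ℕ) (hi : i ≤ n)
    (hB : 0 ≤ x (4 * i + 3)) :
    |x (4 * i) - x (4 * i - 1)| ≤ x (4 * i + 4) - x (4 * i + 3) := by
  induction i with
  | zero =>
    have h1 := (h.diff_lt 0 hi hB).1
    have h2 := h.start.2.2.1
    simp only [Nat.cast_zero, mul_zero, zero_add, zero_sub] at *
    rcases abs_cases (x 0 - x (-1)) with ⟨a, b⟩ | ⟨a, b⟩ <;>
    rcases abs_cases (x 4 - x 3) with ⟨c, d⟩ | ⟨c, d⟩ <;> omega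
  | succ i ih =>
    have h1 := (h.diff_lt (i + 1) hi hB).1
    have h3 := (h.signs (i + 1) hi).2.2.2.1
    have c2 : (4 : ℤ) * ((i + 1 : ℕ) : ℤ) = 4 * i + 4 := by push_cast; ring
    have c3 : (4 : ℤ) * i + 4 - 1 = 4 * i + 3 := by ring
    simp only [c2, c3] at h1 h3 hB ⊢
    have h2 := ih (by omega) (by omega)
    rcases abs_cases (x (4 * i + 4) - x (4 * i + 3)) with ⟨c, d⟩ | ⟨c, d⟩ <;>
    rcases abs_cases (x (4 * i) - x (4 * i - 1)) with ⟨a, b⟩ | ⟨a, b⟩ <;> omega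

/-- No return takes place before the first minimum of `|d_i|`. -/
theorem Outgoing.not_inX_add {n : ℕ} (h : Outgoing E lam x n) {i r : ℕ} (hi : i ≤ n) (hr : r < 4)
    (hk : 0 < 4 * i + r) (hsum : r = 1 → 0 < (x (4 * i) - x (4 * i + 1)) +
      (x (4 * i + 4) - x (4 * i + 5))) : ¬ InX x ((4 * i + r : ℕ) : ℤ) := by
  obtain ⟨g0, h2, g2, h3, h4⟩ := h.signs i hi
  rintro ⟨x1, x2, x3, x4⟩
  push_cast at x1 x2 x3 x4
  interval_cases r
  · simp only [Nat.cast_zero, add_zero] at x1 x2 x3 x4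
    obtain ⟨j, rfl⟩ : ∃ j, i = j + 1 := ⟨i - 1, by omega⟩
    have c2 : (4 : ℤ) * ((j + 1 : ℕ) : ℤ) = 4 * j + 4 := by push_cast; ring
    rw [c2] at x1 x2 x4
    rw [show (4 : ℤ) * j + 4 - 1 = 4 * j + 3 by ring] at x2 x4
    rw [show (4 : ℤ) * j + 4 - 4 = 4 * j by ring,
      show (4 : ℤ) * j + 4 - 5 = 4 * j - 1 by ring] at x4
    have h5 := h.abs_lt j (by omega) x2
    exact absurd x4 (not_lt.2 (h5.trans (le_abs_self _)))
  · simp only [Nat.cast_one] at x1 x2 x3 x4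
    have h5 := h.dist_lt i hi x1
    have h6 := hsum rfl
    rw [show (4 : ℤ) * i + 1 - 1 = 4 * i by ring, show (4 : ℤ) * i + 1 + 4 = 4 * i + 5 by ring,
      show (4 : ℤ) * i + 1 + 3 = 4 * i + 4 by ring] at x3
    rcases abs_cases (x (4 * i + 1) - x (4 * i)) with ⟨a, b⟩ | ⟨a, b⟩ <;>
    rcases abs_cases (x (4 * i + 5) - x (4 * i + 4)) with ⟨c, d⟩ | ⟨c, d⟩ <;> omega
  · simp only [Nat.cast_ofNat] at x1
    omega
  · simp only [Nat.cast_ofNat] at x2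
    rw [show (4 : ℤ) * i + 3 - 1 = 4 * i + 2 by ring] at x2
    omega

theorem Outgoing.not_inX {n : ℕ} (h : Outgoing E lam x n) {k : ℕ} (hk : 0 < k) (hkn : k ≤ 4 * n) :
    ¬ InX x k := by
  obtain ⟨i, r, hr, rfl⟩ : ∃ i r, r < 4 ∧ k = 4 * i + r := ⟨k / 4, k % 4, by omega, by omega⟩
  exact h.not_inX_add (by omega) hr hk fun h1 => h.sum_pos i (by omega)

theorem Outgoing.start_sum_pos (h : Outgoing E lam x 0) :
    0 < (x 0 - x 1) + (x 4 - x 5) := by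
  obtain ⟨h1, -⟩ := h.cone 0 le_rfl
  obtain ⟨-, -, h3⟩ := h.abs_diff_le 0 le_rfl
  obtain ⟨f0, f1, f2, f3, f4⟩ := h.orbit.bounds h.pos h.small (h.rough 0 le_rfl)
  obtain ⟨e1, e2, e3, e4, e5⟩ := h.orbit.next 0
  have s2 := h.start.2.1
  simp only [Nat.cast_zero, mul_zero, zero_add, zero_sub] at *
  rw [abs_le] at f0 h3
  omega

/-- The return takes place at the first minimum of `|d_i|`. -/
theorem Outgoing.inX {n : ℕ} (h : Outgoing E lam x n)
    (hn : (x (4 * n) - x (4 * n + 1)) + (x (4 * n + 4) - x (4 * n + 5)) ≤ 0) :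
    InX x (4 * n + 1) ∧ |x (4 * n) - x (4 * n + 1)| ≤ 4 * E + 4 ∧ 0 < n ∧ x (4 * n - 1) < 0 := by
  obtain ⟨j, rfl⟩ : ∃ j, n = j + 1 := by
    cases n with
    | zero =>
      have := h.start_sum_pos
      simp only [Nat.cast_zero, mul_zero, zero_add] at hn
      omega
    | succ j => exact ⟨j, rfl⟩
  have c2 : (4 : ℤ) * ((j + 1 : ℕ) : ℤ) = 4 * j + 4 := by push_cast; ring
  obtain ⟨h1, -⟩ := h.cone j (by omega)
  obtain ⟨h1', -⟩ := h.cone (j + 1) le_rfl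
  have h2 := (h.abs_diff_le j (by omega)).2.2
  have h2' := (h.abs_diff_le (j + 1) le_rfl).2.2
  have h3 := h.sum_pos j (by omega)
  have h5 := h.dist_lt j (by omega)
  have h5' := h.dist_lt (j + 1) le_rfl
  have h6 := (h.abs_diff_le j (by omega)).1
  obtain ⟨f0, -⟩ := h.orbit.bounds h.pos h.small (h.rough (j + 1) le_rfl)
  obtain ⟨e1, -⟩ := h.orbit.next (4 * ((j + 1 : ℕ) : ℤ))
  have c3 : (4 : ℤ) * j + 4 + 1 = 4 * j + 5 := by ring
  have c4 : (4 : ℤ) * j + 4 + 4 = 4 * j + 8 := by ring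
  have c5 : (4 : ℤ) * j + 4 + 5 = 4 * j + 9 := by ring
  simp only [c2, c3, c4, c5] at h1' h2' h5' f0 e1 hn ⊢
  rw [abs_le] at h2 h2' h6 f0
  have g := h5' (by omega)
  have g' := h5 (by omega)
  refine ⟨⟨by omega, ?_, ?_, ?_⟩, ?_, by omega, by omega⟩
  · rw [show (4 : ℤ) * j + 5 - 1 = 4 * j + 4 by ring]; omega
  · rw [show (4 : ℤ) * j + 5 - 1 = 4 * j + 4 by ring, show (4 : ℤ) * j + 5 + 4 = 4 * j + 9 by ring,
      show (4 : ℤ) * j + 5 + 3 = 4 * j + 8 by ring]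
    rcases abs_cases (x (4 * j + 5) - x (4 * j + 4)) with ⟨a, b⟩ | ⟨a, b⟩ <;>
    rcases abs_cases (x (4 * j + 9) - x (4 * j + 8)) with ⟨c, d⟩ | ⟨c, d⟩ <;> omega
  · rw [show (4 : ℤ) * j + 5 - 1 = 4 * j + 4 by ring, show (4 : ℤ) * j + 5 - 4 = 4 * j + 1 by ring,
      show (4 : ℤ) * j + 5 - 5 = 4 * j by ring]
    rcases abs_cases (x (4 * j + 5) - x (4 * j + 4)) with ⟨a, b⟩ | ⟨a, b⟩ <;>
    rcases abs_cases (x (4 * j + 1) - x (4 * j)) with ⟨c, d⟩ | ⟨c, d⟩ <;> omega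
  · rw [abs_le]; omega

/-- The transit time is `4 n + 1`, where `n` is the first minimum of `|d_i|`. -/
theorem Outgoing.tau_eq {n : ℕ} {p : ℤ × ℤ} (h : Outgoing E lam (seq lam p) n)
    (hn : (seq lam p (4 * n) - seq lam p (4 * n + 1)) +
      (seq lam p (4 * n + 4) - seq lam p (4 * n + 5)) ≤ 0) :
    τ lam p = 4 * n + 1 ∧ Returns lam p := by
  have hmem : 0 < 4 * n + 1 ∧ (F lam ^ (4 * n + 1)) p ∈ X lam := by
    refine ⟨by omega, ?_⟩
    rw [← zpow_natCast, mem_X_iff h.pos]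
    push_cast
    exact (h.inX hn).1
  refine ⟨le_antisymm (Nat.sInf_le hmem) ?_, ⟨_, hmem⟩⟩
  by_contra hcon
  obtain ⟨h1, h2⟩ := Nat.sInf_mem (s := {k : ℕ | 0 < k ∧ (F lam ^ k) p ∈ X lam}) ⟨_, hmem⟩
  rw [← zpow_natCast, mem_X_iff h.pos] at h2
  exact h.not_inX h1 (by unfold τ at hcon; omega) h2

end

noncomputable section

/-! ### Near conservation of the Hamiltonian -/

variable {lam : ℝ} {x : ℤ → ℤ} {E : ℕ}

/-- The smallness of `λ` required for the bound `E`. -/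
def Small (E : ℕ) (lam : ℝ) : Prop := 0 < lam ∧ lam * (32 * ((E : ℝ) + 1)) ≤ 1

theorem Small.le (h : Small E lam) : lam * (4 * E + 8 : ℕ) ≤ 1 := by
  obtain ⟨h1, h2⟩ := h
  refine le_trans ?_ h2
  push_cast
  refine mul_le_mul_of_nonneg_left ?_ h1.le
  have : (0 : ℝ) ≤ E := by positivity
  linarith

/-- The value of the Hamiltonian at `λ (x_t, x_{t-1})`. -/
def energy (lam : ℝ) (x : ℤ → ℤ) (t : ℤ) : ℝ := P (lam * x t) + P (lam * x (t - 1))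

theorem ham_F_zpow (lam : ℝ) (p : ℤ × ℤ) (t : ℤ) :
    ham (scaled lam ((F lam ^ t) p)) = energy lam (seq lam p) t := by
  rw [F_zpow_eq]
  rfl

theorem P_zero : P 0 = 0 := by simpa using P_natCast 0

/-- A point whose value of the Hamiltonian is neither too large nor too small is in general
position. -/
theorem rough_of_energy (hlam : 0 < lam) {t : ℤ} (h1 : energy lam x t ≤ E)
    (h2 : lam * (100 * ((E : ℝ) + 1) * (2 * E + 1)) ≤ energy lam x t) :
    Rough E lam (x t) (x (t - 1)) := by
  unfold energy at h1 h2
  have a1 := abs_le_P (lam * x t)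
  have a2 := abs_le_P (lam * x (t - 1))
  have a3 := P_nonneg (lam * x t)
  have a4 := P_nonneg (lam * x (t - 1))
  have b1 : |lam * x t| ≤ E := by linarith
  have b2 : |lam * x (t - 1)| ≤ E := by linarith
  refine ⟨b1, b2, ?_⟩
  have c1 := abs_P_sub_le (N := E) (y := 0) b1 (by simp)
  have c2 := abs_P_sub_le (N := E) (y := 0) b2 (by simp)
  rw [P_zero, sub_zero, sub_zero, abs_of_nonneg a3, abs_mul, abs_of_pos hlam] at c1
  rw [P_zero, sub_zero, sub_zero, abs_of_nonneg a4, abs_mul, abs_of_pos hlam] at c2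
  have hE : (0 : ℝ) < 2 * E + 1 := by positivity
  have h3 : lam * (2 * E + 1) * (100 * ((E : ℝ) + 1)) ≤
      lam * (2 * E + 1) * (|(x t : ℝ)| + |(x (t - 1) : ℝ)|) := by linarith
  have h4 := le_of_mul_le_mul_left h3 (by positivity)
  exact_mod_cast h4

/-- The bound, in units of `λ`, of the change of the Hamiltonian in at most four steps. -/
def stepConst (E : ℕ) : ℝ := 2 * ((2 * E + 3) * (2 * E + 2))

theorem stepConst_nonneg (E : ℕ) : 0 ≤ stepConst E := by unfold stepConst; positivity

/-- The profile changes by `O(λ)` when its argument moves by a bounded number of lattice steps. -/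
theorem abs_P_shift_le (hs : Small E lam) {y c : ℤ} (hy : |lam * y| ≤ E) (hc : |c| ≤ 2 * E + 2) :
    |P (lam * (c + y : ℤ)) - P (lam * y)| ≤ lam * ((2 * E + 3) * (2 * E + 2)) := by
  have hN := hs.le
  obtain ⟨hlam, -⟩ := hs
  have h1 := abs_mul_add_le hlam (c := c) (N := 4 * E + 8) (by push_cast; omega) hN hy
  have h2 := abs_P_sub_le (N := E + 1) (x := lam * (c + y : ℤ)) (y := lam * y)
    (by push_cast at h1 ⊢; exact h1) (by push_cast; linarith)
  refine h2.trans ?_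
  have h3 : lam * ((c + y : ℤ) : ℝ) - lam * y = lam * c := by push_cast; ring
  rw [h3, abs_mul, abs_of_pos hlam]
  have h4 : |(c : ℝ)| ≤ 2 * E + 2 := by exact_mod_cast hc
  push_cast
  have h5 : lam * |(c : ℝ)| ≤ lam * (2 * E + 2) := mul_le_mul_of_nonneg_left h4 hlam.le
  have h6 : (0 : ℝ) ≤ 2 * (E + 1) + 1 := by positivity
  calc (2 * ((E : ℝ) + 1) + 1) * (lam * |(c : ℝ)|)
      ≤ (2 * ((E : ℝ) + 1) + 1) * (lam * (2 * E + 2)) :=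
        mul_le_mul_of_nonneg_left h5 h6
    _ = lam * ((2 * E + 3) * (2 * E + 2)) := by ring

/-- In at most four steps the Hamiltonian changes by `O(λ)`. -/
theorem IsOrbit.energy_sub_le (hx : IsOrbit lam x) (hs : Small E lam) {t : ℤ}
    (hr : Rough E lam (x t) (x (t - 1))) {r : ℕ} (hr4 : r ≤ 4) :
    |energy lam x (t + r) - energy lam x t| ≤ lam * stepConst E := by
  obtain ⟨f0, f1, f2, f3, f4⟩ := hx.bounds hs.1 hs.le hr
  obtain ⟨e1, e2, e3, e4, -⟩ := hx.next t
  obtain ⟨r1, r2, -⟩ := hr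
  rw [abs_le] at f0 f1 f2 f3 f4
  have neg : ∀ y : ℤ, P (lam * (-y : ℤ)) = P (lam * y) := by
    intro y
    push_cast
    rw [mul_neg, P_neg]
  have key1 : |P (lam * x (t + 1)) - P (lam * x (t - 1))| ≤ lam * ((2 * E + 3) * (2 * E + 2)) := by
    rw [← neg, show -x (t + 1) = -fl lam (x t) + x (t - 1) by omega]
    exact abs_P_shift_le hs r2 (abs_le.2 ⟨by omega, by omega⟩)
  have key2 : |P (lam * x (t + 2)) - P (lam * x t)| ≤ lam * ((2 * E + 3) * (2 * E + 2)) := by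
    rw [← neg, show -x (t + 2) = -fl lam (x (t + 1)) + x t by omega]
    exact abs_P_shift_le hs r1 (abs_le.2 ⟨by omega, by omega⟩)
  have key3 : |P (lam * x (t + 3)) - P (lam * x (t - 1))| ≤ lam * ((2 * E + 3) * (2 * E + 2)) := by
    rw [show x (t + 3) = fl lam (x (t + 2)) - fl lam (x t) + x (t - 1) by omega]
    exact abs_P_shift_le hs r2 (abs_le.2 ⟨by omega, by omega⟩)
  have key4 : |P (lam * x (t + 4)) - P (lam * x t)| ≤ lam * ((2 * E + 3) * (2 * E + 2)) := by
    rw [show x (t + 4) = fl lam (x (t + 3)) - fl lam (x (t + 1)) + x t by omega]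
    exact abs_P_shift_le hs r1 (abs_le.2 ⟨by omega, by omega⟩)
  rw [abs_le] at *
  unfold energy stepConst
  interval_cases r
  · simp only [Nat.cast_zero, add_zero]
    constructor <;> linarith
  · simp only [Nat.cast_one, add_sub_cancel_right]
    constructor <;> linarith
  · simp only [Nat.cast_ofNat]
    rw [show t + 2 - 1 = t + 1 by ring]
    constructor <;> linarith
  · simp only [Nat.cast_ofNat]
    rw [show t + 3 - 1 = t + 2 by ring]
    constructor <;> linarith
  · simp only [Nat.cast_ofNat]
    rw [show t + 4 - 1 = t + 3 by ring]
    constructor <;> linarith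

/-- The scaled coordinate `λ y` is within `λ K` of an integer. -/
def Near (K : ℕ) (lam : ℝ) (y : ℤ) : Prop := ∃ k : ℤ, |lam * y - k| ≤ lam * K

theorem not_near {K : ℕ} {y : ℤ} (h : ¬ Near K lam y) :
    (fl lam y : ℝ) + lam * K < lam * y ∧ lam * y < fl lam y + 1 - lam * K := by
  have h1 := Int.floor_le (lam * (y : ℝ))
  have h2 := Int.lt_floor_add_one (lam * (y : ℝ))
  unfold Near at h
  push Not at h
  have h3 := h (fl lam y)
  have h4 := h (fl lam y + 1)
  push_cast at h4
  rw [abs_of_nonneg (by linarith)] at h3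
  rw [abs_of_nonpos (by linarith)] at h4
  constructor <;> linarith

/-- Away from the grid a bounded displacement does not change the integer part. -/
theorem fl_add_of_not_near {K : ℕ} {y c : ℤ} (hlam : 0 < lam) (h : ¬ Near K lam y)
    (hc : |c| ≤ K) : fl lam (c + y) = fl lam y := by
  obtain ⟨h1, h2⟩ := not_near h
  have h3 : |(c : ℝ)| ≤ K := by exact_mod_cast hc
  obtain ⟨h4, h5⟩ := abs_le.1 h3
  have h6 := mul_le_mul_of_nonneg_left h4 hlam.le
  have h7 := mul_le_mul_of_nonneg_left h5 hlam.le
  refine Int.floor_eq_iff.2 ⟨?_, ?_⟩ <;> push_cast <;> linarith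

/-- Away from the grid `⌊-y⌋ = -⌊y⌋ - 1`, also after a bounded displacement. -/
theorem fl_neg_add_of_not_near {K : ℕ} {y c : ℤ} (hlam : 0 < lam) (h : ¬ Near K lam y)
    (hc : |c| ≤ K) : fl lam (c - y) = -fl lam y - 1 := by
  obtain ⟨h1, h2⟩ := not_near h
  have h3 : |(c : ℝ)| ≤ K := by exact_mod_cast hc
  obtain ⟨h4, h5⟩ := abs_le.1 h3
  have h6 := mul_le_mul_of_nonneg_left h4 hlam.le
  have h7 := mul_le_mul_of_nonneg_left h5 hlam.le
  refine Int.floor_eq_iff.2 ⟨?_, ?_⟩ <;> push_cast <;> linarith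

/-- Away from the lines of the grid, `F⁴` preserves the Hamiltonian. -/
theorem IsOrbit.energy_eq (hx : IsOrbit lam x) (hs : Small E lam) {t : ℤ}
    (hr : Rough E lam (x t) (x (t - 1))) (hA : ¬ Near (2 * E + 3) lam (x t))
    (hB : ¬ Near (2 * E + 3) lam (x (t - 1))) : energy lam x (t + 4) = energy lam x t := by
  obtain ⟨f0, f1, f2, f3, f4⟩ := hx.bounds hs.1 hs.le hr
  obtain ⟨e1, e2, e3, e4, -⟩ := hx.next t
  rw [abs_le] at f0 f1 f2 f3 f4
  have g1 : fl lam (x (t + 1)) = -fl lam (x (t - 1)) - 1 := by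
    rw [e1]
    exact fl_neg_add_of_not_near hs.1 hB (abs_le.2 ⟨by push_cast; omega, by push_cast; omega⟩)
  have g2 : fl lam (x (t + 2)) = -fl lam (x t) - 1 := by
    rw [e2]
    exact fl_neg_add_of_not_near hs.1 hA (abs_le.2 ⟨by push_cast; omega, by push_cast; omega⟩)
  have e3' : x (t + 3) = (fl lam (x (t + 2)) - fl lam (x t)) + x (t - 1) := by omega
  have g3 : fl lam (x (t + 3)) = fl lam (x (t - 1)) := by
    rw [e3']
    exact fl_add_of_not_near hs.1 hB (abs_le.2 ⟨by push_cast; omega, by push_cast; omega⟩)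
  have e4' : x (t + 4) = (fl lam (x (t + 3)) - fl lam (x (t + 1))) + x t := by omega
  have g4 : fl lam (x (t + 4)) = fl lam (x t) := by
    rw [e4']
    exact fl_add_of_not_near hs.1 hA (abs_le.2 ⟨by push_cast; omega, by push_cast; omega⟩)
  have c1 : (x (t + 4) : ℝ) = 2 * fl lam (x (t - 1)) + 1 + x t := by
    rw [e4', g3, g1]; push_cast; ring
  have c2 : (x (t + 3) : ℝ) = -(2 * fl lam (x t) + 1) + x (t - 1) := by
    rw [e3', g2]; push_cast; ring
  unfold energy
  rw [show t + 4 - 1 = t + 3 by ring, P_eq_line (lam * x (t + 4)), P_eq_line (lam * x (t + 3)),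
    P_eq_line (lam * x t), P_eq_line (lam * x (t - 1))]
  unfold fl at *
  rw [g4, g3, c1, c2]
  ring

/-- The number of lattice coordinates close to a line of the grid. -/
def nearCount (E : ℕ) : ℕ := (2 * E + 5) * (2 * (2 * E + 3) + 1)

/-- An injective family of coordinates contains at most `nearCount E` ones close to a line. -/
theorem card_near_le (hs : Small E lam) {s : Finset ℕ} {a : ℕ → ℤ} (ha : Set.InjOn a s)
    (hb : ∀ i ∈ s, |lam * a i| ≤ E) (hn : ∀ i ∈ s, Near (2 * E + 3) lam (a i)) :
    s.card ≤ nearCount E := by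
  obtain ⟨hlam, hsmall⟩ := hs
  set K : ℝ := 2 * E + 3 with hK
  set U : Finset ℤ := (Finset.Icc (-(E + 2) : ℤ) (E + 2)).biUnion
    (fun k => Finset.Icc ⌈(k : ℝ) / lam - K⌉ ⌊(k : ℝ) / lam + K⌋) with hU
  have hcard : U.card ≤ nearCount E := by
    refine Finset.card_biUnion_le.trans ?_
    have h1 : ∀ k ∈ Finset.Icc (-(E + 2) : ℤ) (E + 2),
        (Finset.Icc ⌈(k : ℝ) / lam - K⌉ ⌊(k : ℝ) / lam + K⌋).card ≤ 2 * (2 * E + 3) + 1 := by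
      intro k _
      rw [Int.card_Icc]
      have h2 := Int.floor_le ((k : ℝ) / lam + K)
      have h3 := Int.le_ceil ((k : ℝ) / lam - K)
      have h4 : ((⌊(k : ℝ) / lam + K⌋ : ℤ) : ℝ) ≤
          ((⌈(k : ℝ) / lam - K⌉ + 2 * (2 * E + 3) : ℤ) : ℝ) := by
        push_cast
        rw [hK] at *
        linarith
      have h5 : ⌊(k : ℝ) / lam + K⌋ ≤ ⌈(k : ℝ) / lam - K⌉ + 2 * (2 * E + 3) := by exact_mod_cast h4
      omega
    refine (Finset.sum_le_sum h1).trans ?_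
    rw [Finset.sum_const, Int.card_Icc, smul_eq_mul]
    unfold nearCount
    refine Nat.mul_le_mul_right _ ?_
    omega
  refine (Finset.card_le_card_of_injOn a (fun i hi => ?_) ha).trans hcard
  obtain ⟨k, hk⟩ := hn i hi
  have hbi := hb i hi
  push_cast at hk
  rw [abs_le] at hk hbi
  have hE0 : (0 : ℝ) ≤ E := by positivity
  have hlK : lam * (2 * E + 3) ≤ 1 := by nlinarith
  simp only [hU, Finset.mem_coe, Finset.mem_biUnion, Finset.mem_Icc]
  refine ⟨k, ⟨?_, ?_⟩, ?_, ?_⟩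
  · have : ((-(E + 2) : ℤ) : ℝ) ≤ k := by push_cast; linarith
    exact_mod_cast this
  · have : (k : ℝ) ≤ ((E + 2 : ℤ) : ℝ) := by push_cast; linarith
    exact_mod_cast this
  · rw [Int.ceil_le, sub_le_iff_le_add, div_le_iff₀ hlam]
    rw [hK]
    linarith
  · rw [Int.le_floor, ← sub_le_iff_le_add, le_div_iff₀ hlam]
    rw [hK]
    linarith

/-- The bound, in units of `λ`, of the total change of the Hamiltonian along the return orbit. -/
def driftConst (E : ℕ) : ℝ := 3 * nearCount E * stepConst E

theorem Outgoing.anti {n : ℕ} (h : Outgoing E lam x n) {i j : ℕ} (hij : i < j) (hj : j ≤ n) :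
    x (4 * j - 1) < x (4 * i - 1) := by
  induction j, hij using Nat.le_induction with
  | base =>
    have := (h.signs i (by omega)).2.2.2.1
    rw [show (4 : ℤ) * ((i + 1 : ℕ) : ℤ) - 1 = 4 * i + 3 by push_cast; ring]
    exact this
  | succ j hij ih =>
    have := (h.signs j (by omega)).2.2.2.1
    rw [show (4 : ℤ) * ((j + 1 : ℕ) : ℤ) - 1 = 4 * j + 3 by push_cast; ring]
    exact this.trans (ih (by omega))

theorem Outgoing.lt_of_nonneg {n : ℕ} (h : Outgoing E lam x n) {i j : ℕ} (hij : i < j) (hj : j ≤ n)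
    (hB : 0 ≤ x (4 * j - 1)) : x (4 * i) < x (4 * j) := by
  induction j, hij using Nat.le_induction with
  | base =>
    rw [show (4 : ℤ) * ((i + 1 : ℕ) : ℤ) - 1 = 4 * i + 3 by push_cast; ring] at hB
    have := (h.diff_lt i (by omega) hB).2
    rw [show (4 : ℤ) * ((i + 1 : ℕ) : ℤ) = 4 * i + 4 by push_cast; ring]
    exact this
  | succ j hij ih =>
    rw [show (4 : ℤ) * ((j + 1 : ℕ) : ℤ) - 1 = 4 * j + 3 by push_cast; ring] at hB
    have := (h.diff_lt j (by omega) hB).2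
    have h3 := (h.signs j (by omega)).2.2.2.1
    rw [show (4 : ℤ) * ((j + 1 : ℕ) : ℤ) = 4 * j + 4 by push_cast; ring]
    exact (ih (by omega) (by omega)).trans this

theorem Outgoing.gt_of_neg {n : ℕ} (h : Outgoing E lam x n) {i j : ℕ} (hij : i < j) (hj : j ≤ n)
    (hB : x (4 * i - 1) < 0) : x (4 * j) < x (4 * i) := by
  induction j, hij using Nat.le_induction with
  | base =>
    rw [show (4 : ℤ) * ((i + 1 : ℕ) : ℤ) = 4 * i + 4 by push_cast; ring]
    exact h.lt_of_neg i (by omega) hB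
  | succ j hij ih =>
    rw [show (4 : ℤ) * ((j + 1 : ℕ) : ℤ) = 4 * j + 4 by push_cast; ring]
    exact (h.lt_of_neg j (by omega) ((h.anti hij (by omega)).trans hB)).trans (ih (by omega))

/-- The Hamiltonian changes by `O(λ)` until the return: it changes by `O(λ)` at the points close to
a line of the grid only, and the number of these points is bounded, as `B` is monotone and `A` is
monotone for each sign of `B`. -/
theorem Outgoing.energy_sub_le {n : ℕ} (h : Outgoing E lam x n) (hs : Small E lam) {i : ℕ}
    (hi : i ≤ n) : |energy lam x (4 * i) - energy lam x 0| ≤ lam * driftConst E := by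
  classical
  -- The times at which the ordinate is near the grid, and those at which the abscissa is, with the
  -- orbit above or below the `x`-axis.
  set sB := (Finset.range i).filter (fun k : ℕ => Near (2 * E + 3) lam (x (4 * k - 1))) with hsB
  set sA := (Finset.range i).filter
    (fun k : ℕ => Near (2 * E + 3) lam (x (4 * k)) ∧ 0 ≤ x (4 * k - 1)) with hsA
  set sC := (Finset.range i).filter
    (fun k : ℕ => Near (2 * E + 3) lam (x (4 * k)) ∧ x (4 * k - 1) < 0) with hsC
  have mB : ∀ k ∈ sB, k < i ∧ Near (2 * E + 3) lam (x (4 * k - 1)) := by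
    intro k hk
    rw [hsB, Finset.mem_filter, Finset.mem_range] at hk
    exact hk
  have mA : ∀ k ∈ sA, k < i ∧ Near (2 * E + 3) lam (x (4 * k)) ∧ 0 ≤ x (4 * k - 1) := by
    intro k hk
    rw [hsA, Finset.mem_filter, Finset.mem_range] at hk
    exact hk
  have mC : ∀ k ∈ sC, k < i ∧ Near (2 * E + 3) lam (x (4 * k)) ∧ x (4 * k - 1) < 0 := by
    intro k hk
    rw [hsC, Finset.mem_filter, Finset.mem_range] at hk
    exact hk
  have cB : sB.card ≤ nearCount E := by
    refine card_near_le hs (a := fun k : ℕ => x (4 * k - 1)) ?_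
      (fun k hk => (h.rough k (by have := (mB k hk).1; omega)).2.1) (fun k hk => (mB k hk).2)
    intro k hk l hl hkl
    have := (mB k hk).1
    have := (mB l hl).1
    rcases lt_trichotomy k l with h1 | h1 | h1
    · exact absurd hkl (h.anti h1 (by omega)).ne'
    · exact h1
    · exact absurd hkl (h.anti h1 (by omega)).ne
  have cA : sA.card ≤ nearCount E := by
    refine card_near_le hs (a := fun k : ℕ => x (4 * k)) ?_
      (fun k hk => (h.rough k (by have := (mA k hk).1; omega)).1) (fun k hk => (mA k hk).2.1)
    intro k hk l hl hkl
    obtain ⟨k1, -, k2⟩ := mA k hk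
    obtain ⟨l1, -, l2⟩ := mA l hl
    rcases lt_trichotomy k l with h1 | h1 | h1
    · exact absurd hkl (h.lt_of_nonneg h1 (by omega) l2).ne
    · exact h1
    · exact absurd hkl (h.lt_of_nonneg h1 (by omega) k2).ne'
  have cC : sC.card ≤ nearCount E := by
    refine card_near_le hs (a := fun k : ℕ => x (4 * k)) ?_
      (fun k hk => (h.rough k (by have := (mC k hk).1; omega)).1) (fun k hk => (mC k hk).2.1)
    intro k hk l hl hkl
    obtain ⟨k1, -, k2⟩ := mC k hk
    obtain ⟨l1, -, l2⟩ := mC l hl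
    rcases lt_trichotomy k l with h1 | h1 | h1
    · exact absurd hkl (h.gt_of_neg h1 (by omega) k2).ne'
    · exact h1
    · exact absurd hkl (h.gt_of_neg h1 (by omega) l2).ne
  have hstep : ∀ k ∈ Finset.range i, |energy lam x (4 * (k + 1 : ℕ)) - energy lam x (4 * k)| ≤
      if k ∈ sB ∪ (sA ∪ sC) then lam * stepConst E else 0 := by
    intro k hk
    have hki := Finset.mem_range.1 hk
    have hr := h.rough k (by omega)
    rw [show (4 : ℤ) * ((k + 1 : ℕ) : ℤ) = 4 * k + 4 by push_cast; ring]
    split_ifs with hbad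
    · exact h.orbit.energy_sub_le hs hr (r := 4) le_rfl
    · have hB : ¬ Near (2 * E + 3) lam (x (4 * k - 1)) := fun hh => hbad
        (Finset.mem_union_left _ (by rw [hsB, Finset.mem_filter]; exact ⟨hk, hh⟩))
      have hA : ¬ Near (2 * E + 3) lam (x (4 * k)) := fun hh => hbad
        (Finset.mem_union_right _ (by
          rcases le_or_gt 0 (x (4 * k - 1)) with h0 | h0
          · exact Finset.mem_union_left _ (by rw [hsA, Finset.mem_filter]; exact ⟨hk, hh, h0⟩)
          · exact Finset.mem_union_right _ (by rw [hsC, Finset.mem_filter]; exact ⟨hk, hh, h0⟩)))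
      rw [h.orbit.energy_eq hs hr hA hB, sub_self, abs_zero]
  -- Only the steps at these times contribute to the telescoping sum.
  have htel := Finset.sum_range_sub (fun k : ℕ => energy lam x (4 * k)) i
  simp only [Nat.cast_zero, mul_zero] at htel
  rw [← htel]
  refine (Finset.abs_sum_le_sum_abs _ _).trans ((Finset.sum_le_sum hstep).trans ?_)
  rw [← Finset.sum_filter, Finset.sum_const, nsmul_eq_mul]
  have hc : ((Finset.range i).filter (fun k => k ∈ sB ∪ (sA ∪ sC))).card ≤ 3 * nearCount E := by
    refine (Finset.card_le_card (t := sB ∪ (sA ∪ sC))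
      fun k hk => (Finset.mem_filter.1 hk).2).trans ?_
    have h1 := Finset.card_union_le sB (sA ∪ sC)
    have h2 := Finset.card_union_le sA sC
    omega
  have hc' : (((Finset.range i).filter (fun k => k ∈ sB ∪ (sA ∪ sC))).card : ℝ) ≤
      3 * nearCount E := by exact_mod_cast hc
  have hpos : 0 ≤ lam * stepConst E := mul_nonneg hs.1.le (stepConst_nonneg E)
  refine (mul_le_mul_of_nonneg_right hc' hpos).trans (le_of_eq ?_)
  unfold driftConst
  ring

end

noncomputable section

/-! ### Regularity away from the ends of the critical interval -/

variable {lam : ℝ} {E e : ℕ}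

/-- The bound, in units of `λ`, for the lower margin that `rough_of_energy` needs. -/
def roughConst (E : ℕ) : ℝ := 100 * ((E : ℝ) + 1) * (2 * E + 1)

/-- The bound, in units of `λ`, for the distance of the Hamiltonian from a critical number at the
points of `Σ`. -/
def cornerConst (E : ℕ) : ℝ := 2 * ((4 * E + 9) * (4 * E + 11))

/-- The bound, in units of `λ`, for the margin in which points near the diagonal are far from the
lines of the grid. -/
def diagConst (E : ℕ) : ℝ := 2 * ((2 * E + 3) * (16 * (E + 1))) + 1

/-- The width, in units of `λ`, of the parts at the ends of a critical interval outside which all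
points of `X` are regular. -/
def marginConst (E : ℕ) : ℝ :=
  driftConst E + 2 * stepConst E + cornerConst E + diagConst E + roughConst E + 1

theorem driftConst_nonneg (E : ℕ) : 0 ≤ driftConst E := by
  unfold driftConst
  have := stepConst_nonneg E
  positivity

theorem cornerConst_nonneg (E : ℕ) : 0 ≤ cornerConst E := by unfold cornerConst; positivity
theorem diagConst_nonneg (E : ℕ) : 0 ≤ diagConst E := by unfold diagConst; positivity
theorem roughConst_nonneg (E : ℕ) : 0 ≤ roughConst E := by unfold roughConst; positivity

theorem marginConst_pos (E : ℕ) : 0 < marginConst E := by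
  unfold marginConst
  have := driftConst_nonneg E
  have := stepConst_nonneg E
  have := cornerConst_nonneg E
  have := diagConst_nonneg E
  have := roughConst_nonneg E
  linarith

/-- The part of `X` where the Hamiltonian is in the critical interval of `e`, away from its ends. -/
def mid (e : ℕ) (lam : ℝ) : Set (ℤ × ℤ) :=
  {p | p ∈ X lam ∧ e + lam * marginConst (nextCritical e) ≤ ham (scaled lam p) ∧
    ham (scaled lam p) ≤ nextCritical e - lam * marginConst (nextCritical e)}

theorem energy_zero (lam : ℝ) (p : ℤ × ℤ) : energy lam (seq lam p) 0 = ham (scaled lam p) := by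
  rw [← ham_F_zpow, zpow_zero, Equiv.Perm.one_apply]

/-- An orbit that starts in `mid e lam` is outgoing as long as `|d_i|` has not reached its minimum:
the Hamiltonian hardly changes, which keeps the orbit bounded and away from the origin. -/
theorem outgoing_of_mid (hs : Small (nextCritical e) lam) {p : ℤ × ℤ} (hp : p ∈ mid e lam) (n : ℕ)
    (hn : ∀ i : ℕ, i < n → 0 < (seq lam p (4 * i) - seq lam p (4 * i + 1)) +
      (seq lam p (4 * i + 4) - seq lam p (4 * i + 5))) :
    Outgoing (nextCritical e) lam (seq lam p) n := by
  obtain ⟨hX, h1, h2⟩ := hp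
  rw [← energy_zero] at h1 h2
  set E := nextCritical e with hE
  have hlam := hs.1
  have k1 := mul_nonneg hlam.le (driftConst_nonneg E)
  have k2 := mul_nonneg hlam.le (stepConst_nonneg E)
  have k3 := mul_nonneg hlam.le (cornerConst_nonneg E)
  have k4 := mul_nonneg hlam.le (diagConst_nonneg E)
  have k5 := mul_nonneg hlam.le (roughConst_nonneg E)
  have he : (0 : ℝ) ≤ e := by positivity
  have k6 : lam * marginConst E = lam * driftConst E + 2 * (lam * stepConst E) +
    lam * cornerConst E + lam * diagConst E + lam * roughConst E + lam := by
    unfold marginConst; ring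
  have rough : ∀ t, |energy lam (seq lam p) t - energy lam (seq lam p) 0| ≤
      lam * driftConst E + lam * stepConst E →
      Rough E lam (seq lam p t) (seq lam p (t - 1)) := by
    intro t ht
    rw [abs_le] at ht
    refine rough_of_energy hlam (by linarith) ?_
    change lam * roughConst E ≤ _
    linarith
  induction n with
  | zero =>
    refine ⟨isOrbit_seq lam p, hlam, hs.le, (mem_X_iff_zero hlam p).1 hX, fun i hi => ?_,
      fun i hi => absurd hi (by omega)⟩
    obtain rfl : i = 0 := by omega
    refine rough _ ?_
    simp only [Nat.cast_zero, mul_zero, sub_self, abs_zero]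
    linarith
  | succ n ih =>
    have ho := ih fun i hi => hn i (by omega)
    refine ⟨isOrbit_seq lam p, hlam, hs.le, ho.start, fun i hi => ?_, hn⟩
    rcases Nat.lt_or_ge n i with h | h
    · obtain rfl : i = n + 1 := by omega
      refine rough _ ?_
      have a1 := ho.energy_sub_le hs (le_refl n)
      have a2 := ho.orbit.energy_sub_le hs (ho.rough n le_rfl) (r := 4) le_rfl
      rw [show (4 : ℤ) * ((n + 1 : ℕ) : ℤ) = 4 * n + (4 : ℕ) by push_cast; ring]
      rw [abs_le] at *
      constructor <;> linarith
    · exact ho.rough i h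

/-- An orbit that starts in `mid e lam` returns: the ordinates of the iterates of `F⁴` decrease
strictly, while they remain bounded. -/
theorem exists_return (hs : Small (nextCritical e) lam) {p : ℤ × ℤ} (hp : p ∈ mid e lam) :
    ∃ j : ℕ, Outgoing (nextCritical e) lam (seq lam p) j ∧
      (seq lam p (4 * j) - seq lam p (4 * j + 1)) +
        (seq lam p (4 * j + 4) - seq lam p (4 * j + 5)) ≤ 0 := by
  classical
  by_cases hex : ∃ j : ℕ, (seq lam p (4 * j) - seq lam p (4 * j + 1)) +
        (seq lam p (4 * j + 4) - seq lam p (4 * j + 5)) ≤ 0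
  · exact ⟨Nat.find hex, outgoing_of_mid hs hp _ fun i hi => not_le.1 (Nat.find_min hex hi),
      Nat.find_spec hex⟩
  · exfalso
    push Not at hex
    have ho : ∀ n, Outgoing (nextCritical e) lam (seq lam p) n := fun n =>
      outgoing_of_mid hs hp n fun i _ => hex i
    have hlt : ∀ n : ℕ, seq lam p (4 * n - 1) ≤ seq lam p (-1) - n := by
      intro n
      induction n with
      | zero => simp
      | succ n ih =>
        have := (ho (n + 1)).anti (Nat.lt_succ_self n) le_rfl
        push_cast at this ⊢
        omega
    obtain ⟨n, hn⟩ := exists_nat_gt ((2 * nextCritical e : ℝ) / lam)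
    rw [div_lt_iff₀ hs.1] at hn
    have h1 := ((ho n).rough n le_rfl).2.1
    have h2 := ((ho n).rough 0 (Nat.zero_le _)).2.1
    simp only [Nat.cast_zero, mul_zero, zero_sub] at h2
    rw [abs_le] at h1 h2
    have h3 : (seq lam p (4 * n - 1) : ℝ) ≤ seq lam p (-1) - n := by exact_mod_cast hlt n
    have h4 := mul_le_mul_of_nonneg_left h3 hs.1.le
    rw [mul_sub] at h4
    linarith

/-- The drift of the Hamiltonian at all times up to the return, not only at the multiples of four.
-/
theorem Outgoing.energy_sub_le' {n : ℕ} {x : ℤ → ℤ} (h : Outgoing E lam x n) (hs : Small E lam)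
    {k : ℕ} (hk : k ≤ 4 * n + 1) :
    |energy lam x k - energy lam x 0| ≤ lam * (driftConst E + stepConst E) := by
  obtain ⟨i, r, hr, rfl⟩ : ∃ i r, r < 4 ∧ k = 4 * i + r := ⟨k / 4, k % 4, by omega, by omega⟩
  have h1 := h.energy_sub_le hs (show i ≤ n by omega)
  have h2 := h.orbit.energy_sub_le hs (h.rough i (by omega)) (r := r) (by omega)
  push_cast
  rw [abs_le] at *
  constructor <;> linarith

/-- At a point of `Σ`, the Hamiltonian is close to a critical number. -/
theorem ham_near_of_mem_cornerSet (hs : Small E lam) {p : ℤ × ℤ} (h : p ∈ cornerSet lam)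
    (h1 : |lam * p.1| ≤ E) (h2 : |lam * p.2| ≤ E) :
    ∃ m n : ℤ, |ham (scaled lam p) - ((m : ℝ) ^ 2 + (n : ℝ) ^ 2)| ≤ lam * cornerConst E := by
  obtain ⟨-, m, n, hmn⟩ := h
  refine ⟨m, n, ?_⟩
  obtain ⟨hlam, hsm⟩ := hs
  have hE0 : (0 : ℝ) ≤ E := by positivity
  have hl : lam ≤ 1 / 32 := by nlinarith
  set μ : ℝ := max |(m : ℝ)| |(n : ℝ)| with hμ
  have hm : |(m : ℝ)| ≤ μ := le_max_left _ _
  have hn : |(n : ℝ)| ≤ μ := le_max_right _ _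
  have hw : (((max |(w m n).1| |(w m n).2| : ℤ) : ℝ)) ≤ 2 * μ + 1 := by
    unfold w
    push_cast
    rw [abs_neg]
    refine max_le ?_ ?_
    · refine (abs_add_le _ _).trans ?_
      rw [abs_mul]; norm_num; linarith
    · refine (abs_add_le _ _).trans ?_
      rw [abs_mul]; norm_num; linarith
  set D := lam * (((max |(w m n).1| |(w m n).2| : ℤ) : ℝ) + 2) with hD
  have hD1 : D ≤ lam * (2 * μ + 3) := mul_le_mul_of_nonneg_left (by linarith) hlam.le
  have d1 : |lam * p.1 - m| ≤ D := (le_max_left _ _).trans hmn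
  have d2 : |lam * p.2 - n| ≤ D := (le_max_right _ _).trans hmn
  have hμ0 : 0 ≤ μ := (abs_nonneg _).trans hm
  have e1 : μ ≤ E + D := by
    refine max_le ?_ ?_
    · have := abs_sub_abs_le_abs_sub (m : ℝ) (lam * p.1)
      rw [abs_sub_comm] at this
      linarith
    · have := abs_sub_abs_le_abs_sub (n : ℝ) (lam * p.2)
      rw [abs_sub_comm] at this
      linarith
  have e2 : lam * (2 * μ + 3) ≤ 1 / 32 * (2 * μ + 3) :=
    mul_le_mul_of_nonneg_right hl (by linarith)
  have e3 : μ ≤ 2 * E + 4 := by linarith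
  have e4 : D ≤ lam * (4 * E + 11) := hD1.trans (mul_le_mul_of_nonneg_left (by linarith) hlam.le)
  have c1 := abs_P_sub_le (N := 2 * E + 4) (x := lam * p.1) (y := m) (by push_cast; linarith)
    (by push_cast; linarith)
  have c2 := abs_P_sub_le (N := 2 * E + 4) (x := lam * p.2) (y := n) (by push_cast; linarith)
    (by push_cast; linarith)
  rw [P_intCast] at c1 c2
  have hN : (0 : ℝ) ≤ 2 * (2 * E + 4 : ℕ) + 1 := by positivity
  have c3 := c1.trans (mul_le_mul_of_nonneg_left (d1.trans e4) hN)
  have c4 := c2.trans (mul_le_mul_of_nonneg_left (d2.trans e4) hN)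
  push_cast at c3 c4
  have e5 : lam * cornerConst E = (2 * (2 * E + 4) + 1) * (lam * (4 * E + 11)) +
    (2 * (2 * E + 4) + 1) * (lam * (4 * E + 11)) := by unfold cornerConst; ring
  rw [e5]
  unfold ham scaled
  simp only
  rw [abs_le] at *
  constructor <;> linarith

theorem diagIndex_lt_nextCritical (e : ℕ) : diagIndex e ≤ nextCritical e := by
  have h1 := diagIndex_le e
  have h2 := lt_nextCritical e
  nlinarith

/-- Away from the ends of the critical interval, the points near the diagonal are far from the
boundary of the box on the diagonal. -/
theorem fl_eq_diagIndex (hs : Small (nextCritical e) lam) {a b : ℤ} (ha : 0 ≤ a) (hb : 0 ≤ b)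
    (hab : |a - b| ≤ 8 * ((nextCritical e : ℤ) + 1))
    (h1 : e + lam * diagConst (nextCritical e) ≤ P (lam * a) + P (lam * b))
    (h2 : P (lam * a) + P (lam * b) ≤ nextCritical e - lam * diagConst (nextCritical e))
    {c : ℤ} (hc : |c| ≤ 8 * ((nextCritical e : ℤ) + 1)) : fl lam (c + a) = diagIndex e := by
  set E := nextCritical e with hE
  set M := diagIndex e with hM
  obtain ⟨hlam, hsm⟩ := hs
  have hM1 : (M : ℝ) ^ 2 + (M : ℝ) ^ 2 ≤ e := by exact_mod_cast diagIndex_le e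
  have hM2 : (E : ℝ) ≤ ((M : ℝ) + 1) ^ 2 + ((M : ℝ) + 1) ^ 2 := by
    have := nextCritical_le_of_lt (lt_diagIndex e)
    push_cast at this
    exact this
  have hME : (M : ℝ) ≤ E := by exact_mod_cast diagIndex_lt_nextCritical e
  have hM0 : (0 : ℝ) ≤ M := by positivity
  have hab' : |(a : ℝ) - b| ≤ 8 * ((E : ℝ) + 1) := by exact_mod_cast hab
  have hc' : |(c : ℝ)| ≤ 8 * ((E : ℝ) + 1) := by exact_mod_cast hc
  rw [abs_le] at hab' hc'
  set s := lam * (8 * ((E : ℝ) + 1)) with hs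
  have s0 : 0 ≤ s := by positivity
  have s1 : 2 * s ≤ 1 / 2 := by rw [hs]; linarith
  have p1 := mul_le_mul_of_nonneg_left hab'.1 hlam.le
  have p2 := mul_le_mul_of_nonneg_left hab'.2 hlam.le
  have p3 := mul_le_mul_of_nonneg_left hc'.1 hlam.le
  have p4 := mul_le_mul_of_nonneg_left hc'.2 hlam.le
  rw [mul_neg, ← hs, mul_sub] at p1
  rw [← hs, mul_sub] at p2
  rw [mul_neg, ← hs] at p3
  rw [← hs] at p4
  have ha' : 0 ≤ lam * (a : ℝ) := mul_nonneg hlam.le (by exact_mod_cast ha)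
  have hb' : 0 ≤ lam * (b : ℝ) := mul_nonneg hlam.le (by exact_mod_cast hb)
  have hd : lam * diagConst E = 2 * ((2 * E + 3) * (2 * s)) + lam := by
    unfold diagConst; rw [hs]; ring
  refine Int.floor_eq_iff.2 ⟨?_, ?_⟩
  · by_contra hcon
    push_cast at hcon
    rw [mul_add] at hcon
    have q1 := P_le_P ha' (show lam * (a : ℝ) ≤ M + 2 * s by linarith)
    have q2 := P_le_P hb' (show lam * (b : ℝ) ≤ M + 2 * s by linarith)
    have q3 := abs_P_sub_le (N := E + 1) (x := (M : ℝ) + 2 * s) (y := M)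
      (by rw [abs_of_nonneg (by linarith)]; push_cast; linarith)
      (by rw [abs_of_nonneg (by linarith)]; push_cast; linarith)
    rw [add_sub_cancel_left, abs_of_nonneg (show 0 ≤ 2 * s by linarith), P_natCast] at q3
    push_cast at q3
    have q4 := (abs_le.1 q3).2
    have q5 : (2 * ((E : ℝ) + 1) + 1) * (2 * s) = (2 * E + 3) * (2 * s) := by ring
    linarith
  · by_contra hcon
    push_cast at hcon
    rw [mul_add] at hcon
    have q0 : (0 : ℝ) ≤ M + 1 - 2 * s := by linarith
    have q1 := P_le_P q0 (show (M : ℝ) + 1 - 2 * s ≤ lam * a by linarith)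
    have q2 := P_le_P q0 (show (M : ℝ) + 1 - 2 * s ≤ lam * b by linarith)
    have q3 := abs_P_sub_le (N := E + 1) (x := (M : ℝ) + 1 - 2 * s) (y := (M + 1 : ℕ))
      (by rw [abs_of_nonneg (by linarith)]; push_cast; linarith)
      (by rw [abs_of_nonneg (by positivity)]; push_cast; linarith)
    rw [P_natCast] at q3
    push_cast at q3
    rw [show (M : ℝ) + 1 - 2 * s - (M + 1) = -(2 * s) by ring, abs_neg,
      abs_of_nonneg (show 0 ≤ 2 * s by linarith)] at q3
    have q4 := (abs_le.1 q3).1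
    have q5 : (2 * ((E : ℝ) + 1) + 1) * (2 * s) = (2 * E + 3) * (2 * s) := by ring
    linarith

theorem mem_Λ_iff (p : ℤ × ℤ) (t : ℤ) : (F lam ^ t) p ∈ Λ lam ↔
    ¬ (fl lam (seq lam p (t + 4)) = fl lam (seq lam p t) ∧
      fl lam (seq lam p (t + 3)) = fl lam (seq lam p (t - 1))) := by
  unfold Λ
  rw [Set.mem_ofPred_eq, ← Equiv.Perm.mul_apply, ← zpow_add, F_zpow_eq, F_zpow_eq,
    show (4 : ℤ) + t = t + 4 by ring, show t + 4 - 1 = t + 3 by ring]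
  unfold box scaled
  rw [ne_eq, Prod.mk.injEq]

/-- The reversed sequence is an orbit, as `F` is reversible. -/
theorem IsOrbit.reverse {x : ℤ → ℤ} (hx : IsOrbit lam x) (c : ℤ) :
    IsOrbit lam (fun t => x (c - t)) := by
  intro t
  have := hx (c - t)
  simp only
  rw [show c - (t + 1) = c - t - 1 by ring, show c - (t - 1) = c - t + 1 by ring, this]
  ring

theorem Rough.symm {a b : ℤ} (h : Rough E lam a b) : Rough E lam b a := by
  obtain ⟨h1, h2, h3⟩ := h
  exact ⟨h2, h1, by omega⟩

/-- The points of `X` are close to the diagonal. -/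
theorem abs_diff_le_of_inX {x : ℤ → ℤ} (hx : IsOrbit lam x) (hs : Small E lam)
    (hr : Rough E lam (x 0) (x (-1))) (hX : InX x 0) : |x 0 - x (-1)| ≤ 8 * ((E : ℤ) + 1) := by
  obtain ⟨s1, s2, s3, s4⟩ := hX
  have h1 := hx.neg_le_diff hs.1 hs.le hr s1 s3
  have h2 := (hx.reverse (-1)).neg_le_diff hs.1 hs.le (by simpa using hr.symm) (by simpa using s2)
    (by
      simp only [sub_zero, sub_neg_eq_add, neg_add_cancel, zero_sub] at s4 ⊢
      norm_num
      rw [abs_sub_comm, abs_sub_comm (x (-5))]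
      exact s4.le)
  simp only [sub_zero, sub_neg_eq_add, neg_add_cancel] at h2
  rw [abs_le]
  omega

/-- Four steps near the diagonal stay in the box on the diagonal. -/
theorem not_mem_Λ_of_diag (hs : Small (nextCritical e) lam) {p : ℤ × ℤ}
    (hr : Rough (nextCritical e) lam p.1 p.2) (ha : 0 ≤ p.1) (hb : 0 ≤ p.2)
    (hab : |p.1 - p.2| ≤ 8 * ((nextCritical e : ℤ) + 1))
    (h1 : e + lam * diagConst (nextCritical e) ≤ ham (scaled lam p))
    (h2 : ham (scaled lam p) ≤ nextCritical e - lam * diagConst (nextCritical e)) :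
    p ∉ Λ lam := by
  have hx := isOrbit_seq lam p
  have hr' : Rough (nextCritical e) lam (seq lam p 0) (seq lam p (0 - 1)) := by
    rw [zero_sub, seq_zero, seq_neg_one]; exact hr
  obtain ⟨f0, f1, f2, f3, f4⟩ := hx.bounds hs.1 hs.le hr'
  obtain ⟨e1, e2, e3, e4, -⟩ := hx.next 0
  have hmem := mem_Λ_iff (lam := lam) p 0
  rw [zpow_zero, Equiv.Perm.one_apply] at hmem
  rw [hmem, not_not]
  simp only [zero_add, zero_sub, seq_zero, seq_neg_one] at *
  unfold ham scaled at h1 h2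
  simp only at h1 h2
  rw [abs_le] at f0 f1 f2 f3 f4
  have z1 := fl_eq_diagIndex hs ha hb hab h1 h2 (c := 0) (by simp; omega)
  have z2 := fl_eq_diagIndex hs hb ha (by rw [abs_sub_comm]; exact hab) (by linarith) (by linarith)
    (c := 0) (by simp; omega)
  have z3 := fl_eq_diagIndex hs ha hb hab h1 h2
    (c := fl lam (seq lam p 3) - fl lam (seq lam p 1)) (abs_le.2 ⟨by omega, by omega⟩)
  have z4 := fl_eq_diagIndex hs hb ha (by rw [abs_sub_comm]; exact hab) (by linarith) (by linarith)
    (c := fl lam (seq lam p 2) - fl lam p.1) (abs_le.2 ⟨by omega, by omega⟩)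
  rw [zero_add] at z1 z2
  constructor
  · rw [z1, ← z3]; congr 3; omega
  · rw [z2, ← z4]; congr 3; omega

theorem rough_of_mid (hs : Small (nextCritical e) lam) {p : ℤ × ℤ} (hp : p ∈ mid e lam) :
    Rough (nextCritical e) lam p.1 p.2 := by
  have := (outgoing_of_mid hs hp 0 (fun i hi => absurd hi (by omega))).rough 0 le_rfl
  simpa [seq_zero, seq_neg_one] using this

theorem abs_sub_le_of_mem_X (hs : Small E lam) {p : ℤ × ℤ} (hp : p ∈ X lam)
    (hr : Rough E lam p.1 p.2) : |p.1 - p.2| ≤ 8 * ((E : ℤ) + 1) := by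
  have h := abs_diff_le_of_inX (isOrbit_seq lam p) hs
    (by rw [seq_zero, seq_neg_one]; exact hr) ((mem_X_iff_zero hs.1 p).1 hp)
  rwa [seq_zero, seq_neg_one] at h

/-- The points of `X` away from the ends of the critical interval are regular. -/
theorem isRegular_of_mid (hs : Small (nextCritical e) lam) {p : ℤ × ℤ} (hp : p ∈ mid e lam) :
    IsRegular e lam p := by
  obtain ⟨j, ho, hj⟩ := exists_return hs hp
  obtain ⟨hτ, hret⟩ := ho.tau_eq hj
  have hr0 := rough_of_mid hs hp
  obtain ⟨hX, h1, h2⟩ := hp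
  set E := nextCritical e with hE
  have hlam := hs.1
  have k1 := mul_nonneg hlam.le (driftConst_nonneg E)
  have k2 := mul_nonneg hlam.le (stepConst_nonneg E)
  have k3 := mul_nonneg hlam.le (cornerConst_nonneg E)
  have k4 := mul_nonneg hlam.le (diagConst_nonneg E)
  have k5 := mul_nonneg hlam.le (roughConst_nonneg E)
  have he : (0 : ℝ) ≤ e := by positivity
  have k6 : lam * marginConst E = lam * driftConst E + 2 * (lam * stepConst E) +
    lam * cornerConst E + lam * diagConst E + lam * roughConst E + lam := by
    unfold marginConst; ring
  have hen : ∀ k : ℕ, k ≤ 4 * j + 1 → |ham (scaled lam ((F lam ^ k) p)) - ham (scaled lam p)| ≤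
      lam * driftConst E + lam * stepConst E := by
    intro k hk
    have := ho.energy_sub_le' hs hk
    rw [← ham_F_zpow, energy_zero, zpow_natCast, mul_add] at this
    exact this
  have hcrit : ∀ r ∈ returnOrbit lam p, ham (scaled lam r) ∈ criticalInterval e ∧
      e + lam * cornerConst E < ham (scaled lam r) ∧
      ham (scaled lam r) < E - lam * cornerConst E := by
    rintro r ⟨k, hk, rfl⟩
    have := abs_le.1 (hen k (by omega))
    exact ⟨⟨by linarith, by linarith⟩, by linarith, by linarith⟩
  refine ⟨hX, ⟨by linarith, by linarith⟩, hret, ⟨?_, ?_⟩, fun r hr => (hcrit r hr).1, ?_⟩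
  · exact not_mem_Λ_of_diag hs hr0 hX.1 hX.2.1 (abs_sub_le_of_mem_X hs hX hr0) (by linarith)
      (by linarith)
  · have hΦ : Φ lam p ∈ X lam := by
      obtain ⟨k, hk⟩ := hret
      exact (Nat.sInf_mem (s := {k : ℕ | 0 < k ∧ (F lam ^ k) p ∈ X lam}) ⟨k, hk⟩).2
    have h3 := abs_le.1 (hen (4 * j + 1) le_rfl)
    rw [← hτ] at h3
    change _ ≤ ham (scaled lam (Φ lam p)) - _ ∧ ham (scaled lam (Φ lam p)) - _ ≤ _ at h3
    have hr : Rough E lam (Φ lam p).1 (Φ lam p).2 := by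
      have := rough_of_energy (x := seq lam (Φ lam p)) (E := E) (t := 0) hlam
        (by rw [energy_zero]; linarith)
        (by rw [energy_zero]; change lam * roughConst E ≤ _; linarith)
      simpa [seq_zero, seq_neg_one] using this
    exact not_mem_Λ_of_diag hs hr hΦ.1 hΦ.2.1 (abs_sub_le_of_mem_X hs hΦ hr) (by linarith)
      (by linarith)
  · intro r hr hcor
    obtain ⟨-, a1, a2⟩ := hcrit r hr
    have b1 := abs_le_P (lam * r.1)
    have b2 := abs_le_P (lam * r.2)
    have b3 := P_nonneg (lam * r.1)
    have b4 := P_nonneg (lam * r.2)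
    have b5 : ham (scaled lam r) = P (lam * r.1) + P (lam * r.2) := rfl
    obtain ⟨m, n, hmn⟩ := ham_near_of_mem_cornerSet (E := E) hs hcor (by linarith) (by linarith)
    rw [abs_le] at hmn
    rcases sq_add_sq_le_or e m n with h | h <;> linarith

end

noncomputable section

/-! ### The label along an orbit -/

variable {lam : ℝ} {E e : ℕ} {x : ℤ → ℤ}

theorem sq_floor_le_P {y : ℝ} {k : ℕ} (h : (k : ℝ) ≤ y) : (k : ℝ) ^ 2 ≤ P y := by
  rw [← P_natCast]
  exact P_le_P (by positivity) h

/-- Four steps of the orbit from the index `t` on either stay in a box or do not start within the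
distance `λ (‖w_{i,j}‖ + 2)` of a grid point `(i, j)`. -/
def AvoidsCorners (lam : ℝ) (x : ℤ → ℤ) (t : ℤ) : Prop :=
  (fl lam (x (t + 4)) = fl lam (x t) ∧ fl lam (x (t + 3)) = fl lam (x (t - 1))) ∨
  ∀ i j : ℕ, j ≤ i → |lam * x (t - 1) - j| ≤ lam * (2 * i + 3) → lam * (2 * i + 3) < |lam * x t - i|

/-- Points outside `Σ` avoid the corners of the first quadrant. -/
theorem avoidsCorners_of_not_mem {p : ℤ × ℤ} {t : ℤ} (h : (F lam ^ t) p ∉ cornerSet lam) :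
    AvoidsCorners lam (seq lam p) t := by
  by_cases hL : (F lam ^ t) p ∈ Λ lam
  · right
    intro i j hij h1
    by_contra hcon
    refine h ⟨hL, i, j, ?_⟩
    have hmax : max |(w i j).1| |(w i j).2| = 2 * (i : ℤ) + 1 := by
      unfold w
      simp only
      rw [abs_neg, abs_of_nonneg (by positivity), abs_of_nonneg (by positivity),
        max_eq_right (by omega)]
    rw [hmax, F_zpow_eq]
    push_cast
    rw [show lam * (2 * (i : ℝ) + 1 + 2) = lam * (2 * i + 3) by ring]
    exact max_le (not_lt.1 hcon) h1
  · left
    rw [mem_Λ_iff, not_not] at hL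
    exact hL

/-- The values of the integer parts along four steps from the first quadrant. -/
theorem IsOrbit.floor_cases (hx : IsOrbit lam x) (hs : Small E lam) {t : ℤ} {m n : ℕ}
    (hm : fl lam (x t) = m) (hn : fl lam (x (t - 1)) = n) (hmE : m ≤ E) (hnE : n ≤ E) :
    (fl lam (x (t + 1)) = -(n + 1) ∨ fl lam (x (t + 1)) = -n ∧ x (t - 1) * lam ≤ n + lam * m) ∧
    -((m : ℤ) + 2) ≤ fl lam (x (t + 2)) ∧ fl lam (x (t + 2)) ≤ -m ∧
    (0 ≤ fl lam (x (t + 2)) → x t = 0) := by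
  obtain ⟨e1, e2, e3, e4, -⟩ := hx.next t
  obtain ⟨hlam, hsm⟩ := hs
  obtain ⟨a1, a2⟩ := Int.floor_eq_iff.1 hm
  obtain ⟨b1, b2⟩ := Int.floor_eq_iff.1 hn
  have hmE' : (m : ℝ) ≤ E := by exact_mod_cast hmE
  have hnE' : (n : ℝ) ≤ E := by exact_mod_cast hnE
  have hm0 : (0 : ℝ) ≤ m := by positivity
  have hn0 : (0 : ℝ) ≤ n := by positivity
  have l1 : lam * m ≤ 1 / 4 := by nlinarith
  have l2 : lam * (n + 1) ≤ 1 / 4 := by nlinarith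
  have l0 : 0 ≤ lam * m := by positivity
  have hf1 : (fl lam (x (t + 1)) = -(n + 1) ∨
      fl lam (x (t + 1)) = -n ∧ x (t - 1) * lam ≤ n + lam * m) := by
    rw [e1, hm]
    by_cases h : x (t - 1) * lam ≤ n + lam * m
    · right
      refine ⟨Int.floor_eq_iff.2 ?_, h⟩
      push_cast at *
      constructor <;> nlinarith
    · left
      refine Int.floor_eq_iff.2 ?_
      push_cast at *
      constructor <;> nlinarith
  refine ⟨hf1, ?_⟩
  have hb1 : -((n : ℤ) + 1) ≤ fl lam (x (t + 1)) ∧ fl lam (x (t + 1)) ≤ 0 := by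
    rcases hf1 with h | ⟨h, -⟩ <;> omega
  have hb1' : -((n : ℝ) + 1) ≤ fl lam (x (t + 1)) ∧ ((fl lam (x (t + 1)) : ℤ) : ℝ) ≤ 0 := by
    exact_mod_cast hb1
  have c1 : lam * -((n : ℝ) + 1) ≤ lam * (fl lam (x (t + 1)) : ℤ) :=
    mul_le_mul_of_nonneg_left hb1'.1 hlam.le
  have c2 : lam * (fl lam (x (t + 1)) : ℤ) ≤ lam * 0 :=
    mul_le_mul_of_nonneg_left hb1'.2 hlam.le
  rw [e2]
  refine ⟨Int.le_floor.2 ?_, ?_, ?_⟩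
  · push_cast at *
    linarith
  · have : fl lam (fl lam (x (t + 1)) - x t) < -(m : ℤ) + 1 := by
      refine Int.floor_lt.2 ?_
      push_cast at *
      linarith
    omega
  · intro h
    have h' := Int.floor_nonneg.1 h
    have h2 : (0 : ℝ) ≤ (fl lam (x (t + 1)) - x t : ℤ) := nonneg_of_mul_nonneg_right h' hlam
    have h3 : 0 ≤ fl lam (x (t + 1)) - x t := by exact_mod_cast h2
    have h4 : 0 ≤ x t := by
      have : (0 : ℝ) ≤ x t := nonneg_of_mul_nonneg_right (le_trans (by positivity) a1) hlam
      exact_mod_cast this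
    omega

/-- Close to a horizontal side of the boxes, away from the corners, the orbit moves downwards by
`2 m + 1`; the side of the box `(m, n)` on the right is not crossed at this level of the
Hamiltonian. -/
theorem IsOrbit.down_of_far (hx : IsOrbit lam x) (hs : Small E lam) {t : ℤ} {m n : ℕ}
    (hm : fl lam (x t) = m) (hn : fl lam (x (t - 1)) = n) (hnm : n ≤ m) (hmE : m ≤ E)
    (hen : e < energy lam x t) (hb : lam * x (t + 3) < n)
    (hfar : ∀ i j : ℕ, j ≤ i → |lam * x (t - 1) - j| ≤ lam * (2 * i + 3) →
      lam * (2 * i + 3) < |lam * x t - i|) :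
    fl lam (x (t + 2)) = -(m + 1) ∧ ¬ (m + 1) ^ 2 + n ^ 2 ≤ e ∧
      fl lam (x t + 2 * m) = m := by
  obtain ⟨e1, e2, e3, e4, -⟩ := hx.next t
  obtain ⟨g1, g2, g3, -⟩ := hx.floor_cases hs hm hn hmE (hnm.trans hmE)
  obtain ⟨hlam, hsm⟩ := hs
  obtain ⟨a1, a2⟩ := Int.floor_eq_iff.1 hm
  obtain ⟨b1, b2⟩ := Int.floor_eq_iff.1 hn
  push_cast at a1 a2 b1 b2
  have hmE' : (m : ℝ) ≤ E := by exact_mod_cast hmE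
  have hnm' : (n : ℝ) ≤ m := by exact_mod_cast hnm
  have hm0 : (0 : ℝ) ≤ m := by positivity
  have hn0 : (0 : ℝ) ≤ n := by positivity
  have l1 : lam * (2 * m + 3) ≤ 1 / 4 := by nlinarith
  have hB : x (t - 1) - x (t + 3) ≤ 2 * m + 2 := by omega
  have hB' : (x (t - 1) : ℝ) - x (t + 3) ≤ 2 * m + 2 := by exact_mod_cast hB
  have hB2 := mul_le_mul_of_nonneg_left hB' hlam.le
  rw [mul_sub] at hB2
  have d1 : |lam * x (t - 1) - n| ≤ lam * (2 * m + 2) := by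
    rw [abs_of_nonneg (by linarith)]; linarith
  have f1 := hfar m n hnm (d1.trans (by nlinarith))
  have f2 := hfar (m + 1) n (by omega) (d1.trans (by push_cast; nlinarith))
  push_cast at f2
  rw [abs_of_nonneg (by linarith)] at f1
  rw [abs_of_nonpos (by linarith)] at f2
  have hf2 : fl lam (x (t + 2)) = -(m + 1) := by
    have hb1 : -((n : ℤ) + 1) ≤ fl lam (x (t + 1)) ∧ fl lam (x (t + 1)) ≤ 0 := by
      rcases g1 with h | ⟨h, -⟩ <;> omega
    have hb1' : -((n : ℝ) + 1) ≤ fl lam (x (t + 1)) ∧ ((fl lam (x (t + 1)) : ℤ) : ℝ) ≤ 0 := by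
      exact_mod_cast hb1
    have c1 : lam * -((n : ℝ) + 1) ≤ lam * (fl lam (x (t + 1)) : ℤ) :=
      mul_le_mul_of_nonneg_left hb1'.1 hlam.le
    have c2 : lam * (fl lam (x (t + 1)) : ℤ) ≤ lam * 0 :=
      mul_le_mul_of_nonneg_left hb1'.2 hlam.le
    rw [e2]
    refine Int.floor_eq_iff.2 ?_
    push_cast at *
    constructor <;> nlinarith
  refine ⟨hf2, ?_, ?_⟩
  · intro hcon
    have hcon' : ((m : ℝ) + 1) ^ 2 + (n : ℝ) ^ 2 ≤ e := by exact_mod_cast hcon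
    have hB3 : x (t - 1) - x (t + 3) = 2 * m + 1 := by omega
    have hB4 : (x (t - 1) : ℝ) - x (t + 3) = 2 * m + 1 := by exact_mod_cast hB3
    have hB5 : lam * x (t - 1) - lam * x (t + 3) = lam * (2 * m + 1) := by
      rw [← mul_sub, hB4]
    have pA : P (lam * x t) = (2 * m + 1) * (lam * x t) - m * (m + 1) := by
      rw [P_eq_line, show ⌊lam * (x t : ℝ)⌋ = m from hm]; push_cast; ring
    have pB : P (lam * x (t - 1)) = (2 * n + 1) * (lam * x (t - 1)) - n * (n + 1) := by
      rw [P_eq_line, show ⌊lam * (x (t - 1) : ℝ)⌋ = n from hn]; push_cast; ring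
    unfold energy at hen
    have q1 : (2 * (m : ℝ) + 1) * (lam * x t) ≤ (2 * m + 1) * (m + 1 - lam * (2 * (m + 1) + 3)) :=
      mul_le_mul_of_nonneg_left (by linarith) (by positivity)
    have q2 : (2 * (n : ℝ) + 1) * (lam * x (t - 1)) ≤ (2 * n + 1) * (n + lam * (2 * m + 1)) :=
      mul_le_mul_of_nonneg_left (by linarith) (by positivity)
    have q3 : (2 * (n : ℝ) + 1) * (lam * (2 * m + 1)) ≤
        (2 * m + 1) * (lam * (2 * (m + 1) + 3)) := by
      have : 0 ≤ lam * (2 * m + 1) := by positivity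
      nlinarith
    nlinarith
  · refine Int.floor_eq_iff.2 ?_
    push_cast
    constructor <;> nlinarith

theorem fl_eq_of_le {a b : ℤ} {k : ℤ} (hlam : 0 < lam) (h1 : fl lam a = k) {c : ℤ}
    (h2 : fl lam b = k) (hac : a ≤ c) (hcb : c ≤ b) : fl lam c = k := by
  have m1 : fl lam a ≤ fl lam c := Int.floor_le_floor
    (mul_le_mul_of_nonneg_left (by exact_mod_cast hac) hlam.le)
  have m2 : fl lam c ≤ fl lam b := Int.floor_le_floor
    (mul_le_mul_of_nonneg_left (by exact_mod_cast hcb) hlam.le)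
  omega

/-- The label is invariant under `F⁴`, as long as the orbit stays in the first quadrant. -/
theorem IsOrbit.label_step (hx : IsOrbit lam x) (hs : Small E lam) (hE : E = nextCritical e)
    {t : ℤ} {m n : ℕ} (hm : fl lam (x t) = m) (hn : fl lam (x (t - 1)) = n)
    (hnm : n ≤ m) (hmE : m ≤ E) (h1 : e < energy lam x t)
    (h2 : energy lam x (t + 4) < E) (hB : 0 ≤ x (t + 3)) (hc : AvoidsCorners lam x t) :
    ∃ m' n' : ℕ, fl lam (x (t + 4)) = m' ∧ fl lam (x (t + 3)) = n' ∧ n' ≤ m' ∧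
      label e lam m n (x t, x (t - 1)) = label e lam m' n' (x (t + 4), x (t + 3)) := by
  obtain ⟨e1, e2, e3, e4, -⟩ := hx.next t
  obtain ⟨g1, g2, g3, g4⟩ := hx.floor_cases hs hm hn hmE (hnm.trans hmE)
  have hs' := hs
  obtain ⟨hlam, hsm⟩ := hs
  obtain ⟨a1, a2⟩ := Int.floor_eq_iff.1 hm
  obtain ⟨b1, b2⟩ := Int.floor_eq_iff.1 hn
  push_cast at a1 a2 b1 b2
  have hmE' : (m : ℝ) ≤ E := by exact_mod_cast hmE
  have hnm' : (n : ℝ) ≤ m := by exact_mod_cast hnm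
  have hm0 : (0 : ℝ) ≤ m := by positivity
  have hn0 : (0 : ℝ) ≤ n := by positivity
  have l1 : lam * (2 * m + 3) ≤ 1 / 4 := by nlinarith
  have hB'le : x (t + 3) ≤ x (t - 1) := by omega
  obtain ⟨n', hn'⟩ := Int.eq_ofNat_of_zero_le (fl_nonneg hlam hB)
  obtain ⟨b3, b4⟩ := Int.floor_eq_iff.1 hn'
  push_cast at b3 b4
  have hn'le : n' ≤ n := by
    have : fl lam (x (t + 3)) ≤ fl lam (x (t - 1)) := Int.floor_le_floor
      (mul_le_mul_of_nonneg_left (by exact_mod_cast hB'le) hlam.le)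
    omega
  rcases hn'le.eq_or_lt with heq | hlt
  · -- The orbit stays in the row `n`.
    subst heq
    have hf1 : fl lam (x (t + 1)) = -(n' + 1) := by
      rcases g1 with h | ⟨h, h'⟩
      · exact h
      · exfalso
        have h3 : (x (t - 1) : ℝ) - m ≤ x (t + 3) := by
          refine le_of_mul_le_mul_left ?_ hlam
          rw [mul_sub]
          linarith
        have h4 : x (t - 1) - m ≤ x (t + 3) := by exact_mod_cast h3
        have h5 := g4 (by omega)
        have h6 : m = 0 := by
          rw [h5, fl] at hm
          simp at hm
          exact_mod_cast hm.symm
        subst h6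
        have h7 : n' = 0 := by omega
        subst h7
        have h8 : x (t - 1) = 0 := by
          have hz : (0 : ℝ) ≤ x (t - 1) := by exact_mod_cast hB.trans hB'le
          have : (x (t - 1) : ℝ) * lam = 0 := by
            apply le_antisymm
            · simpa using h'
            · positivity
          have h9 := (mul_eq_zero.1 this).resolve_right hlam.ne'
          exact_mod_cast h9
        unfold energy at h1
        rw [h5, h8] at h1
        simp [P_zero] at h1
        have : (0 : ℝ) ≤ e := by positivity
        linarith
    have hA' : x (t + 4) = x t + (2 * n' + 1) := by omega
    have hA'R : (x (t + 4) : ℝ) = x t + (2 * n' + 1) := by exact_mod_cast hA'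
    have hA'm : lam * x (t + 4) = lam * x t + lam * (2 * n' + 1) := by rw [hA'R]; ring
    have s1 : 0 ≤ lam * (2 * n' + 1) := by positivity
    have s2 : lam * (2 * n' + 1) ≤ 1 / 4 := by nlinarith
    by_cases hcr : lam * x (t + 4) < m + 1
    · have hf2 : fl lam (x (t + 2)) = -(m + 1) := by
        rw [e2, hf1]
        refine Int.floor_eq_iff.2 ?_
        push_cast
        constructor <;> nlinarith
      refine ⟨m, n', Int.floor_eq_iff.2 ⟨by push_cast; linarith, by push_cast; linarith⟩, hn', hnm,
        ?_⟩
      rw [← label_translate (x t) (x (t - 1)) 1]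
      congr 2
      · omega
      · omega
    · rw [not_lt] at hcr
      have hP1 := sq_floor_le_P (k := m + 1) (y := lam * x (t + 4)) (by push_cast; linarith)
      have hP2 := sq_floor_le_P (k := n') (y := lam * x (t + 3)) (by linarith)
      have hright : (m + 1) ^ 2 + n' ^ 2 ≤ e := by
        refine sq_add_sq_le_of_lt ?_
        unfold energy at h2
        rw [show t + 4 - 1 = t + 3 by ring, hE] at h2
        exact lt_of_le_of_lt (add_le_add hP1 hP2) h2
      refine ⟨m + 1, n', Int.floor_eq_iff.2 ⟨by push_cast; linarith, by push_cast; linarith⟩, hn',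
        by omega, ?_⟩
      rw [label_right hright, crossRight_of_mem]
      · unfold rowStep
        congr 2
        · omega
        · rw [show -(x t + n' + 1) = x (t + 2) by omega]
          change x (t - 1) - (fl lam (x t) - fl lam (x (t + 2))) = _
          omega
      · rw [sub_le_iff_le_add, Int.ceil_le, div_le_iff₀ hlam]
        push_cast
        rw [hA'R] at hcr
        linarith
      · rw [Int.lt_ceil, lt_div_iff₀ hlam]
        linarith
  · -- The orbit passes to the row below.
    have hfar := hc.resolve_left fun h => by omega
    have hb : lam * x (t + 3) < n := by
      have : (n' : ℝ) + 1 ≤ n := by exact_mod_cast hlt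
      linarith
    obtain ⟨hf2, hright, hfl⟩ := hx.down_of_far hs' hm hn hnm hmE h1 hb hfar
    have hB' : x (t + 3) = x (t - 1) - (2 * m + 1) := by omega
    have hB'R : (x (t + 3) : ℝ) = x (t - 1) - (2 * m + 1) := by exact_mod_cast hB'
    have hB'm : lam * x (t + 3) = lam * x (t - 1) - lam * (2 * m + 1) := by rw [hB'R]; ring
    have hn1 : n = n' + 1 := by
      have : (n : ℝ) < n' + 2 := by linarith
      have : n < n' + 2 := by exact_mod_cast this
      omega
    have hcast : fl lam (x t + 2 * m : ℤ) = m := by exact_mod_cast hfl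
    have hfl4 : fl lam (x (t + 4)) = m := by
      refine fl_eq_of_le hlam hm hcast ?_ ?_
      · rcases g1 with h | ⟨h, -⟩ <;> omega
      · rcases g1 with h | ⟨h, -⟩ <;> omega
    refine ⟨m, n', hfl4, hn', by omega, ?_⟩
    subst hn1
    rw [label_down hright, crossDown_of_mem]
    · unfold colStep
      congr 2
      · rw [show x (t - 1) - (2 * (m : ℤ) + 1) = x (t + 3) by omega,
          show (m : ℤ) - x (t - 1) = x (t + 1) by omega]
        change x t + (fl lam (x (t + 3)) - fl lam (x (t + 1))) = _
        omega
      · omega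
    · rw [Int.ceil_le, div_le_iff₀ hlam]
      linarith
    · rw [← sub_lt_iff_lt_add, ← hB', Int.lt_ceil, lt_div_iff₀ hlam]
      push_cast at hb ⊢
      linarith

/-- When the orbit crosses the positive `x`-axis, it does so in the last column, and the label is
the ordinate before the crossing. -/
theorem IsOrbit.label_axis (hx : IsOrbit lam x) (hs : Small E lam) (hE : E = nextCritical e)
    {t : ℤ} {m n : ℕ} (hm : fl lam (x t) = m) (hn : fl lam (x (t - 1)) = n)
    (hnm : n ≤ m) (hmE : m ≤ E) (h1 : e < energy lam x t)
    (h2 : energy lam x t < E) (hB0 : 0 ≤ x (t - 1)) (hB : x (t + 3) < 0)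
    (hc : AvoidsCorners lam x t) :
    m = Nat.sqrt e ∧ fl lam (x (t + 2)) = -(m + 1) ∧ x (t - 1) < 2 * m + 1 ∧
      label e lam m n (x t, x (t - 1)) = x (t - 1) := by
  obtain ⟨e1, e2, e3, e4, -⟩ := hx.next t
  obtain ⟨g1, g2, g3, g4⟩ := hx.floor_cases hs hm hn hmE (hnm.trans hmE)
  have hneg := fl_neg hs.1 hB
  have hfar := hc.resolve_left fun h => by omega
  have hlam := hs.1
  have hb : lam * x (t + 3) < n := by
    have : (x (t + 3) : ℝ) < 0 := by exact_mod_cast hB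
    have := mul_neg_of_pos_of_neg hlam this
    have : (0 : ℝ) ≤ n := by positivity
    linarith
  obtain ⟨hf2, hright, hfl⟩ := hx.down_of_far hs hm hn hnm hmE h1 hb hfar
  have hBlt : x (t - 1) < 2 * m + 1 := by omega
  have hn0 : n = 0 := by
    have h3 : fl lam (x (t - 1)) < 1 := by
      refine Int.floor_lt.2 ?_
      have h4 : (x (t - 1) : ℝ) ≤ 2 * m + 1 := by exact_mod_cast hBlt.le
      have h5 : (m : ℝ) ≤ E := by exact_mod_cast hmE
      have h6 := mul_le_mul_of_nonneg_left h4 hlam.le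
      have h7 := hs.2
      push_cast
      nlinarith
    omega
  subst hn0
  have hmf : m = Nat.sqrt e := by
    refine sqrt_unique ?_ ?_
    · have hP1 := sq_floor_le_P (k := m) (y := lam * x t)
        (by have := (Int.floor_eq_iff.1 hm).1; exact_mod_cast this)
      have := sq_add_sq_le_of_lt (e := e) (a := m) (b := 0) (by
        unfold energy at h2
        have := P_nonneg (lam * x (t - 1))
        push_cast
        rw [← hE]
        linarith)
      simpa using this
    · simpa using hright
  refine ⟨hmf, hf2, hBlt, ?_⟩
  rw [label_zero hright]
  exact Int.emod_eq_of_lt hB0 hBlt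

end

noncomputable section

/-! ### Return arcs, symmetries of orbits, and the central label -/

variable {lam : ℝ} {e j : ℕ} {x : ℤ → ℤ} {p : ℤ × ℤ}

/-- The orbit `x` returns to `X` at the index `4 j + 1`, and until then it stays in the critical
interval of `e` and avoids the corners of the boxes. -/
structure ReturnArc (e : ℕ) (lam : ℝ) (x : ℤ → ℤ) (j : ℕ) : Prop where
  outgoing : Outgoing (nextCritical e) lam x j
  ret : (x (4 * j) - x (4 * j + 1)) + (x (4 * j + 4) - x (4 * j + 5)) ≤ 0
  energy_mem : ∀ k : ℕ, k ≤ 4 * j + 1 → energy lam x k ∈ criticalInterval e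
  avoids : ∀ i : ℕ, i ≤ j → AvoidsCorners lam x (4 * i)

/-- For a regular point, an outgoing stretch of the orbit that ends with a return is a return arc.
-/
theorem IsRegular.returnArc (h : IsRegular e lam p)
    (ho : Outgoing (nextCritical e) lam (seq lam p) j)
    (hj : (seq lam p (4 * j) - seq lam p (4 * j + 1)) +
      (seq lam p (4 * j + 4) - seq lam p (4 * j + 5)) ≤ 0) : ReturnArc e lam (seq lam p) j := by
  obtain ⟨hτ, -⟩ := ho.tau_eq hj
  obtain ⟨-, -, -, -, h5, h6⟩ := h
  refine ⟨ho, hj, fun k hk => ?_, fun i hi => ?_⟩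
  · rw [← ham_F_zpow, zpow_natCast]
    exact h5 _ ⟨k, by omega, rfl⟩
  · have := h6 _ ⟨4 * i, by omega, rfl⟩
    rw [← zpow_natCast] at this
    push_cast at this
    exact avoidsCorners_of_not_mem this

/-- Every regular point whose orbit stays away from the origin has a return arc.  If `|d_i|` never
reached a minimum, the orbit would be outgoing forever and could not return to `X`. -/
theorem IsRegular.exists_returnArc (hs : Small (nextCritical e) lam)
    (hr : lam * roughConst (nextCritical e) ≤ e) (h : IsRegular e lam p) :
    ∃ j, ReturnArc e lam (seq lam p) j := by
  by_contra hcon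
  have hsum : ∀ n, Outgoing (nextCritical e) lam (seq lam p) n →
      0 < (seq lam p (4 * n) - seq lam p (4 * n + 1)) +
        (seq lam p (4 * n + 4) - seq lam p (4 * n + 5)) := fun n ho => by
    by_contra hn
    exact hcon ⟨n, h.returnArc ho (not_lt.1 hn)⟩
  obtain ⟨hX, -, hret, -, h5, -⟩ := h
  have rough : ∀ i : ℕ, 4 * i ≤ τ lam p →
      Rough (nextCritical e) lam (seq lam p (4 * i)) (seq lam p (4 * i - 1)) := by
    intro i hi
    have := h5 _ ⟨4 * i, hi, rfl⟩
    rw [← zpow_natCast, ham_F_zpow] at this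
    push_cast at this
    exact rough_of_energy hs.1 this.2.le (hr.trans this.1.le)
  have ho : ∀ n : ℕ, 4 * n ≤ τ lam p → Outgoing (nextCritical e) lam (seq lam p) n := by
    intro n
    induction n with
    | zero =>
      exact fun hn => ⟨isOrbit_seq lam p, hs.1, hs.le, (mem_X_iff_zero hs.1 p).1 hX,
        fun i hi => rough i (by omega), fun i hi => absurd hi (by omega)⟩
    | succ n ih =>
      intro hn
      have ho := ih (by omega)
      refine ⟨ho.orbit, ho.pos, ho.small, ho.start, fun i hi => rough i (by omega), fun i hi => ?_⟩
      rcases Nat.lt_or_ge i n with hin | hin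
      · exact ho.sum_pos i hin
      · obtain rfl : i = n := by omega
        exact hsum i ho
  obtain ⟨k, hk⟩ := hret
  obtain ⟨h1, h2⟩ := Nat.sInf_mem (s := {k : ℕ | 0 < k ∧ (F lam ^ k) p ∈ X lam}) ⟨k, hk⟩
  change 0 < τ lam p at h1
  change (F lam ^ (τ lam p)) p ∈ X lam at h2
  rw [← zpow_natCast, mem_X_iff hs.1] at h2
  have ho' := ho (τ lam p / 4) (by omega)
  have hτ : 4 * (τ lam p / 4) + τ lam p % 4 = τ lam p := by omega
  refine ho'.not_inX_add (i := τ lam p / 4) (r := τ lam p % 4) le_rfl (by omega) (by omega)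
    (fun _ => hsum _ ho') ?_
  rw [hτ]
  exact h2

theorem ReturnArc.natAbs_le (h : ReturnArc e lam x j) {i : ℕ} (hi : i ≤ j) {m : ℕ}
    (hm : fl lam (x (4 * i)) = m) : m ≤ nextCritical e := by
  have h1 := (h.outgoing.rough i hi).1
  have h2 := (Int.floor_eq_iff.1 hm).1
  push_cast at h2
  have h3 : (m : ℝ) ≤ nextCritical e := h2.trans ((le_abs_self _).trans h1)
  exact_mod_cast h3

/-- The label is constant along the orbit of `F⁴`, until it leaves the first quadrant. -/
theorem ReturnArc.label_eq (h : ReturnArc e lam x j) (hs : Small (nextCritical e) lam)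
    (h0 : fl lam (x 0) = diagIndex e) (h0' : fl lam (x (-1)) = diagIndex e) {i : ℕ} (hi : i ≤ j)
    (hB : 0 ≤ x (4 * i - 1)) : ∃ m n : ℕ, fl lam (x (4 * i)) = m ∧ fl lam (x (4 * i - 1)) = n ∧
      n ≤ m ∧ label e lam (diagIndex e) (diagIndex e) (x 0, x (-1)) =
        label e lam m n (x (4 * i), x (4 * i - 1)) := by
  induction i with
  | zero => exact ⟨_, _, by simpa using h0, by simpa using h0', le_rfl, by simp⟩
  | succ i ih =>
    have c1 : (4 : ℤ) * ((i + 1 : ℕ) : ℤ) = 4 * i + 4 := by push_cast; ring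
    rw [c1, show (4 : ℤ) * i + 4 - 1 = 4 * i + 3 by ring] at hB ⊢
    have hlt := (h.outgoing.signs i (by omega)).2.2.2.1
    obtain ⟨m, n, hm, hn, hnm, hl⟩ := ih (by omega) (by omega)
    have en1 := (h.energy_mem (4 * i) (by omega)).1
    have en2 := (h.energy_mem (4 * (i + 1)) (by omega)).2
    push_cast at en1 en2
    rw [show (4 : ℤ) * (i + 1) = 4 * i + 4 by ring] at en2
    obtain ⟨m', n', hm', hn', hnm', hl'⟩ := h.outgoing.orbit.label_step hs rfl hm hn hnm
      (h.natAbs_le (by omega) hm) en1 en2 hB (h.avoids i (by omega))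
    exact ⟨m', n', hm', hn', hnm', hl.trans hl'⟩

/-- The label of a point of `X` is the ordinate at which its orbit arrives at the positive
`x`-axis. -/
theorem ReturnArc.label_axis (h : ReturnArc e lam x j) (hs : Small (nextCritical e) lam)
    (h0 : fl lam (x 0) = diagIndex e) (h0' : fl lam (x (-1)) = diagIndex e) {i : ℕ} (hi : i ≤ j)
    (hB : 0 ≤ x (4 * i - 1)) (hB' : x (4 * i + 3) < 0) :
    fl lam (x (4 * i)) = Nat.sqrt e ∧ fl lam (x (4 * i + 2)) = -(Nat.sqrt e + 1) ∧
      label e lam (diagIndex e) (diagIndex e) (x 0, x (-1)) = x (4 * i - 1) := by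
  obtain ⟨m, n, hm, hn, hnm, hl⟩ := h.label_eq hs h0 h0' hi hB
  have en := h.energy_mem (4 * i) (by omega)
  push_cast at en
  obtain ⟨h1, h2, h3, h4⟩ := h.outgoing.orbit.label_axis hs rfl hm hn hnm (h.natAbs_le hi hm)
    en.1 en.2 hB hB' (h.avoids i hi)
  rw [← h1]
  exact ⟨hm, h2, hl.trans h4⟩

/-- The label of the symmetric fixed points: an orbit that arrives at the positive `x`-axis with
this ordinate is symmetric with respect to this axis.  Let `v = ⌊√e⌋`, and let `B` be the last
nonnegative ordinate.  An orbit symmetric about the last point above the axis has `2 B = v`.  If it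
is symmetric about the point two steps later, then the abscissa `v - B` in between satisfies
`2 (v - B) = -(v + 1)`.  Either equation is solvable for one parity of `v`. -/
def centralLabel (e : ℕ) : ℤ :=
  if Even (Nat.sqrt e) then (Nat.sqrt e : ℤ) / 2 else (3 * (Nat.sqrt e : ℤ) + 1) / 2

theorem two_mul_centralLabel (e : ℕ) :
    (Even (Nat.sqrt e) → 2 * centralLabel e = Nat.sqrt e) ∧
    (¬ Even (Nat.sqrt e) → 2 * centralLabel e = 3 * Nat.sqrt e + 1) := by
  unfold centralLabel
  constructor
  · intro h
    rw [if_pos h]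
    obtain ⟨k, hk⟩ := h
    omega
  · intro h
    rw [if_neg h]
    obtain ⟨k, hk⟩ := Nat.not_even_iff_odd.1 h
    omega

theorem centralLabel_nonneg (e : ℕ) : 0 ≤ centralLabel e := by
  unfold centralLabel
  split_ifs <;> positivity

theorem centralLabel_lt (e : ℕ) : centralLabel e < 2 * Nat.sqrt e + 1 := by
  unfold centralLabel
  split_ifs <;> omega

/-- An orbit that is symmetric about an even index `2 l` has the label `centralLabel e`: if the
index is `4 i`, the symmetry gives `2 x_{4i-1} = ⌊λ x_{4i}⌋`, and if it is `4 i + 2`, the symmetry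
gives `2 x_{4i+1} = ⌊λ x_{4i+2}⌋`. -/
theorem ReturnArc.label_eq_centralLabel (h : ReturnArc e lam x j) (hs : Small (nextCritical e) lam)
    (h0 : fl lam (x 0) = diagIndex e) (h0' : fl lam (x (-1)) = diagIndex e) {l : ℕ}
    (hl : l ≤ 2 * j + 1) (hsym : ∀ k, x (4 * l - k) = x k) :
    label e lam (diagIndex e) (diagIndex e) (x 0, x (-1)) = centralLabel e := by
  obtain ⟨c1, c2⟩ := two_mul_centralLabel e
  rcases Nat.even_or_odd' l with ⟨i, rfl | rfl⟩
  · obtain ⟨e1, e2, e3, e4, -⟩ := h.outgoing.orbit.next (4 * i)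
    obtain ⟨g0, g1, g2, g3, g4⟩ := h.outgoing.signs i (by omega)
    have s1 := hsym (4 * i - 1)
    rw [show (4 : ℤ) * ((2 * i : ℕ) : ℤ) - (4 * i - 1) = 4 * i + 1 by push_cast; ring] at s1
    obtain ⟨h1, h2, h3⟩ := h.label_axis hs h0 h0' (i := i) (by omega) (by omega) (by omega)
    have hev : Even (Nat.sqrt e) := by
      rw [← Int.even_coe_nat]
      exact ⟨x (4 * i - 1), by omega⟩
    have := c1 hev
    omega
  · obtain ⟨e1, e2, e3, e4, -⟩ := h.outgoing.orbit.next (4 * i)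
    obtain ⟨g0, g1, g2, g3, g4⟩ := h.outgoing.signs i (by omega)
    have s1 := hsym (4 * i + 1)
    rw [show (4 : ℤ) * ((2 * i + 1 : ℕ) : ℤ) - (4 * i + 1) = 4 * i + 3 by push_cast; ring] at s1
    obtain ⟨h1, h2, h3⟩ := h.label_axis hs h0 h0' (i := i) (by omega) (by omega) (by omega)
    have hev : ¬ Even (Nat.sqrt e) := by
      rw [← Int.even_coe_nat]
      rintro ⟨k, hk⟩
      omega
    have := c2 hev
    omega

/-- Two orbits with two consecutive values in common coincide. -/
theorem IsOrbit.ext {y : ℤ → ℤ} (hx : IsOrbit lam x) (hy : IsOrbit lam y) {a : ℤ}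
    (h1 : x a = y a) (h2 : x (a - 1) = y (a - 1)) (t : ℤ) : x t = y t := by
  have key : ∀ n : ℕ, (x (a + n) = y (a + n) ∧ x (a + n - 1) = y (a + n - 1)) ∧
      (x (a - n) = y (a - n) ∧ x (a - n - 1) = y (a - n - 1)) := by
    intro n
    induction n with
    | zero => simp [h1, h2]
    | succ n ih =>
      obtain ⟨⟨u1, u2⟩, ⟨v1, v2⟩⟩ := ih
      have a1 := hx (a + n)
      have a2 := hy (a + n)
      have b1 := hx (a - n - 1)
      have b2 := hy (a - n - 1)
      rw [sub_add_cancel] at b1 b2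
      rw [u1, u2] at a1
      rw [v1, v2] at b1
      push_cast
      rw [show a + ((n : ℤ) + 1) = a + n + 1 by ring, add_sub_cancel_right,
        show a - ((n : ℤ) + 1) = a - n - 1 by ring]
      exact ⟨⟨by omega, u1⟩, ⟨v2, by omega⟩⟩
  rcases le_total a t with h | h
  · obtain ⟨n, rfl⟩ := Int.le.dest h
    exact (key n).1.1
  · obtain ⟨n, hn⟩ := Int.le.dest h
    have := (key n).2.1
    rwa [show a - (n : ℤ) = t by omega] at this

/-- Time-reversal: a symmetry at two consecutive indices extends to the whole orbit. -/
theorem IsOrbit.symm_of (hx : IsOrbit lam x) {c a : ℤ} (h1 : x (c - a) = x a)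
    (h2 : x (c - a + 1) = x (a - 1)) (k : ℤ) : x (c - k) = x k :=
  (hx.reverse c).ext hx (a := a) h1 (by rw [show c - (a - 1) = c - a + 1 by ring]; exact h2) k

theorem HasSymmetricOrbit.exists_zpow (h : HasSymmetricOrbit lam p) :
    ∃ s : ℤ, ∀ k, seq lam p (s - 1 - k) = seq lam p k := by
  have h1 : G p ∈ G '' orbit lam p := ⟨p, ⟨0, by simp⟩, rfl⟩
  rw [h] at h1
  obtain ⟨s, hs⟩ := h1
  refine ⟨s, (isOrbit_seq lam p).symm_of (a := 0) ?_ ?_⟩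
  · rw [F_zpow_eq] at hs
    have := (Prod.ext_iff.1 hs).2
    rw [sub_zero, seq_zero]
    exact this.symm
  · rw [F_zpow_eq] at hs
    have := (Prod.ext_iff.1 hs).1
    rw [sub_zero, sub_add_cancel, zero_sub, seq_neg_one]
    exact this.symm

theorem hasSymmetricOrbit_of {c : ℤ} (h : ∀ k, seq lam p (c - k) = seq lam p k) :
    HasSymmetricOrbit lam p := by
  have key : ∀ t : ℤ, G ((F lam ^ t) p) = (F lam ^ (c + 1 - t)) p := by
    intro t
    rw [F_zpow_eq, F_zpow_eq]
    unfold G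
    refine Prod.ext ?_ ?_
    · change seq lam p (t - 1) = _
      rw [← h (t - 1)]; congr 1; ring
    · change seq lam p t = _
      rw [← h t]; congr 1; ring
  refine Set.Subset.antisymm ?_ ?_
  · rintro _ ⟨_, ⟨t, rfl⟩, rfl⟩
    exact ⟨_, key t⟩
  · rintro _ ⟨t, rfl⟩
    exact ⟨_, ⟨c + 1 - t, rfl⟩, by rw [key]; congr 2; ring⟩

theorem seq_add_of_zpow_eq {T : ℤ} (h : (F lam ^ T) p = p) (t : ℤ) :
    seq lam p (t + T) = seq lam p t := by
  rw [← seq_zpow, h]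

/-- Four steps within a box are a translation by the vector of this box. -/
theorem IsOrbit.add_of_not_mem (hx : IsOrbit lam x) (hs : Small E lam) {t : ℤ} {m n : ℕ}
    (hm : fl lam (x t) = m) (hn : fl lam (x (t - 1)) = n) (hmE : m ≤ E) (hnE : n ≤ E)
    (hm' : fl lam (x (t + 4)) = m) (hn' : fl lam (x (t + 3)) = n) (hx0 : 0 < x t) :
    x (t + 4) = x t + (2 * n + 1) ∧ x (t + 3) = x (t - 1) - (2 * m + 1) := by
  obtain ⟨e1, e2, e3, e4, -⟩ := hx.next t
  obtain ⟨g1, g2, g3, g4⟩ := hx.floor_cases hs hm hn hmE hnE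
  have hlam := hs.1
  obtain ⟨a1, a2⟩ := Int.floor_eq_iff.1 hm'
  obtain ⟨a3, a4⟩ := Int.floor_eq_iff.1 hm
  obtain ⟨b1, b2⟩ := Int.floor_eq_iff.1 hn'
  push_cast at a1 a2 a3 a4 b1 b2
  have hf2 : fl lam (x (t + 2)) ≤ -1 := by
    by_contra hcon
    have := g4 (by omega)
    omega
  have hf1 : fl lam (x (t + 1)) = -(n + 1) := by
    rcases g1 with h | ⟨h, h'⟩
    · exact h
    · exfalso
      have h3 : (x (t - 1) : ℝ) - m ≤ x (t + 3) := by
        refine le_of_mul_le_mul_left ?_ hlam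
        rw [mul_sub]
        linarith
      have h4 : x (t - 1) - m ≤ x (t + 3) := by exact_mod_cast h3
      omega
  have hA : x (t + 4) = x t + (2 * n + 1) := by omega
  have hAR : (x (t + 4) : ℝ) = x t + (2 * n + 1) := by exact_mod_cast hA
  rw [hAR, mul_add] at a1 a2
  have hn0 : 0 ≤ lam * n := by positivity
  have hf2 : fl lam (x (t + 2)) = -(m + 1) := by
    rw [e2, hf1]
    refine Int.floor_eq_iff.2 ?_
    push_cast
    constructor <;> nlinarith
  omega

end

noncomputable section

/-! ### Symmetric fixed points are the points with the central label -/

variable {lam : ℝ} {e j : ℕ} {x : ℤ → ℤ} {p : ℤ × ℤ}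

/-- The only box on the diagonal that meets the polygons of the class of `e` is the one with index
`⌊√(e/2)⌋`. -/
theorem eq_diagIndex_of_energy {t : ℤ} {m : ℕ} (hlam : 0 < lam)
    (hen : energy lam x t ∈ criticalInterval e) (h0 : 0 ≤ x t) (h1 : 0 ≤ x (t - 1))
    (hm : fl lam (x t) = m) (hm' : fl lam (x (t - 1)) = m) : m = diagIndex e := by
  obtain ⟨a1, a2⟩ := Int.floor_eq_iff.1 hm
  obtain ⟨b1, b2⟩ := Int.floor_eq_iff.1 hm'
  push_cast at a1 a2 b1 b2
  obtain ⟨en1, en2⟩ := hen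
  unfold energy at en1 en2
  have p1 := sq_floor_le_P a1
  have p2 := sq_floor_le_P b1
  have k0 : 0 ≤ lam * (x t : ℝ) := mul_nonneg hlam.le (by exact_mod_cast h0)
  have k1 : 0 ≤ lam * (x (t - 1) : ℝ) := mul_nonneg hlam.le (by exact_mod_cast h1)
  have p3 := P_lt_P k0 a2
  have p4 := P_lt_P k1 b2
  have p5 := P_natCast (m + 1)
  push_cast at p5
  refine diagIndex_unique (sq_add_sq_le_of_lt (by linarith)) ?_
  have : (e : ℝ) < ((m : ℝ) + 1) ^ 2 + ((m : ℝ) + 1) ^ 2 := by linarith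
  exact_mod_cast this

/-- A symmetric fixed point of the return map lies on the diagonal, or its image under `F⁴` is its
mirror image.  If it is not at the end of the set `X` where the two distances that define `X`
coincide, its mirror image is a point of `X`, on the same orbit; otherwise the same holds for the
image under `F⁴`. -/
theorem ReturnArc.symm_cases (h : ReturnArc e lam (seq lam p) j) (hs : Small (nextCritical e) lam)
    (hL : p ∉ Λ lam) (hsym : HasSymmetricOrbit lam p) (hfix : Φ lam p = p) :
    fl lam (seq lam p 0) = diagIndex e ∧ fl lam (seq lam p (-1)) = diagIndex e ∧
      (seq lam p (-1) = seq lam p 0 ∨ seq lam p (-1) = seq lam p 0 + (2 * diagIndex e + 1)) ∧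
      ∃ l : ℕ, l ≤ 2 * j + 1 ∧ ∀ k, seq lam p (4 * l - k) = seq lam p k := by
  obtain ⟨hτ, -⟩ := h.outgoing.tau_eq h.ret
  have hx := isOrbit_seq lam p
  have hper : (F lam ^ ((4 * j + 1 : ℕ) : ℤ)) p = p := by
    rw [zpow_natCast, ← hτ]
    exact hfix
  have hper' := seq_add_of_zpow_eq hper
  -- The orbit has the period `4 j + 1` and meets `X` in the point `p` only.
  have hret : ∀ n : ℤ, InX (seq lam p) n → (F lam ^ n) p = p := by
    intro n hn
    rw [← mem_X_iff hs.1] at hn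
    have hdiv := Int.emod_add_mul_ediv n ((4 * j + 1 : ℕ) : ℤ)
    have hnn := Int.emod_nonneg n (b := ((4 * j + 1 : ℕ) : ℤ)) (by omega)
    have hlt := Int.emod_lt_of_pos n (b := ((4 * j + 1 : ℕ) : ℤ)) (by omega)
    obtain ⟨r, hr⟩ := Int.eq_ofNat_of_zero_le hnn
    have hpow : (F lam ^ n) p = (F lam ^ (r : ℤ)) p := by
      have hq : (F lam ^ (((4 * j + 1 : ℕ) : ℤ) * (n / ((4 * j + 1 : ℕ) : ℤ)))) p = p := by
        rw [zpow_mul]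
        exact Equiv.Perm.zpow_apply_eq_self_of_apply_eq_self hper _
      rw [← hr]
      conv_lhs => rw [← hdiv]
      rw [zpow_add, Equiv.Perm.mul_apply, hq]
    rcases Nat.eq_zero_or_pos r with h0 | h0
    · rw [hpow, h0]; simp
    · rw [hpow, mem_X_iff hs.1] at hn
      exact absurd hn (h.outgoing.not_inX h0 (by omega))
  obtain ⟨s, hsy⟩ := hsym.exists_zpow
  have hX := h.outgoing.start
  obtain ⟨x0, x1, x2, x3⟩ := hX
  simp only [zero_sub, zero_add] at x1 x2 x3
  obtain ⟨ic1, ic2⟩ := h.outgoing.cone 0 (Nat.zero_le _)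
  simp only [Nat.cast_zero, mul_zero, zero_sub] at ic1 ic2
  obtain ⟨-, -, hj0, -⟩ := h.outgoing.inX h.ret
  have hen := h.energy_mem 0 (by omega)
  rw [Nat.cast_zero] at hen
  obtain ⟨m, hm⟩ := Int.eq_ofNat_of_zero_le (fl_nonneg hs.1 x0)
  obtain ⟨n, hn⟩ := Int.eq_ofNat_of_zero_le (fl_nonneg hs.1 x1)
  have hb := (h.outgoing.orbit.bounds hs.1 hs.le (h.outgoing.rough 0 (Nat.zero_le _)))
  have hrough := h.outgoing.rough 0 (Nat.zero_le _)
  simp only [Nat.cast_zero, mul_zero, zero_sub, zero_add] at hb hrough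
  have hmE : m ≤ nextCritical e := by
    have := abs_le.1 hb.1
    omega
  have hnE : n ≤ nextCritical e := by
    have h1 := hrough.2.1
    have := abs_le.1 (abs_fl_le (x := seq lam p (-1)) (N := nextCritical e) (by exact_mod_cast h1))
    omega
  have hL' := (mem_Λ_iff (lam := lam) p 0).not.1 (by rwa [zpow_zero, Equiv.Perm.one_apply])
  rw [not_not] at hL'
  simp only [zero_sub, zero_add] at hL'
  obtain ⟨w1, w2⟩ := hx.add_of_not_mem hs (t := 0) hm (by simpa using hn) hmE hnE
    (hL'.1.trans hm) (hL'.2.trans hn) (by omega)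
  simp only [zero_sub, zero_add] at w1 w2
  have sy : ∀ a b : ℤ, a + b = s - 1 → seq lam p a = seq lam p b := by
    intro a b hab
    rw [← hsy b]
    congr 1
    omega
  by_cases hlt : |seq lam p 0 - seq lam p (-1)| < |seq lam p 4 - seq lam p 3|
  · -- The mirror image of `p`, the point of index `s`, is in `X`, hence it is `p`.
    have hXs : InX (seq lam p) s := by
      refine ⟨?_, ?_, ?_, ?_⟩
      · rw [sy s (-1) (by ring)]; exact x1
      · rw [sy (s - 1) 0 (by ring)]; exact x0
      · rw [sy s (-1) (by ring), sy (s - 1) 0 (by ring), sy (s + 4) (-5) (by ring),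
          sy (s + 3) (-4) (by ring), abs_sub_comm, abs_sub_comm (seq lam p (-5))]
        exact x3.le
      · rw [sy s (-1) (by ring), sy (s - 1) 0 (by ring), sy (s - 4) 3 (by ring),
          sy (s - 5) 4 (by ring), abs_sub_comm, abs_sub_comm (seq lam p 3)]
        exact hlt
    have hfx := hret s hXs
    have heq : seq lam p (-1) = seq lam p 0 := by
      rw [← sy s (-1) (by ring), ← seq_add_of_zpow_eq hfx 0, zero_add]
    have hnm : n = m := by
      rw [heq] at hn
      have := hm.symm.trans hn
      exact_mod_cast this.symm
    subst hnm
    have hM := eq_diagIndex_of_energy hs.1 hen x0 (by simpa using x1) hm (by simpa using hn)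
    subst hM
    refine ⟨hm, hn, Or.inl heq, j, by omega, fun k => ?_⟩
    have := hx.symm_of (c := -1) (a := 0) (by simpa using heq) (by simp [heq]) k
    rw [← this, ← hper' (-1 - k)]
    congr 1
    push_cast
    ring
  · -- The mirror image of `F⁴ p`, the point of index `s - 4`, is in `X`, hence it is `p`.
    have hle := not_lt.1 hlt
    have habs := le_antisymm x2 hle
    have hd : seq lam p 0 - seq lam p (-1) = -(m + n + 1) := by
      rcases abs_cases (seq lam p 0 - seq lam p (-1)) with ⟨a, b⟩ | ⟨a, b⟩ <;>
      rcases abs_cases (seq lam p 4 - seq lam p 3) with ⟨c, d⟩ | ⟨c, d⟩ <;> omega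
    have hab1 := (h.outgoing.abs_diff_le 1 (by omega)).2.1
    have hdf := (h.outgoing.diff_lt 1 (by omega))
    rw [abs_le] at hab1
    norm_num at hab1 hdf
    have hd8 := (hdf (by omega)).1
    have hXs : InX (seq lam p) (s - 4) := by
      refine ⟨?_, ?_, ?_, ?_⟩
      · rw [sy (s - 4) 3 (by ring)]; omega
      · rw [sy (s - 4 - 1) 4 (by ring)]; omega
      · rw [sy (s - 4) 3 (by ring), sy (s - 4 - 1) 4 (by ring), sy (s - 4 + 4) (-1) (by ring),
          sy (s - 4 + 3) 0 (by ring), abs_sub_comm, abs_sub_comm (seq lam p (-1))]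
        exact hle
      · rw [sy (s - 4) 3 (by ring), sy (s - 4 - 1) 4 (by ring), sy (s - 4 - 4) 7 (by ring),
          sy (s - 4 - 5) 8 (by ring)]
        rw [abs_of_nonpos (by omega), abs_of_nonpos (by omega)]
        omega
    have hfx := hret (s - 4) hXs
    have heq1 : seq lam p 3 = seq lam p 0 := by
      rw [← sy (s - 4) 3 (by ring), ← seq_add_of_zpow_eq hfx 0, zero_add]
    have heq2 : seq lam p 4 = seq lam p (-1) := by
      rw [← sy (s - 5) 4 (by ring), ← seq_add_of_zpow_eq hfx (-1)]
      congr 1; ring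
    have hnm : n = m := by omega
    subst hnm
    have hM := eq_diagIndex_of_energy hs.1 hen x0 (by simpa using x1) hm (by simpa using hn)
    subst hM
    refine ⟨hm, hn, Or.inr (by omega), j + 1, by omega, fun k => ?_⟩
    have := hx.symm_of (c := 3) (a := 0) (by simpa using heq1) (by simpa using heq2) k
    rw [← this, ← hper' (3 - k)]
    congr 1
    push_cast
    ring

/-- A symmetric fixed point lies on one of two lines, the diagonal or its translate, and has the
label `centralLabel e`. -/
theorem ReturnArc.label_eq_of_symm (h : ReturnArc e lam (seq lam p) j)
    (hs : Small (nextCritical e) lam) (hL : p ∉ Λ lam) (hsym : HasSymmetricOrbit lam p)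
    (hfix : Φ lam p = p) : label e lam (diagIndex e) (diagIndex e) p = centralLabel e ∧
      (p.2 = p.1 ∨ p.2 = p.1 + (2 * diagIndex e + 1)) := by
  obtain ⟨h1, h2, h3, l, hl, hk⟩ := h.symm_cases hs hL hsym hfix
  have := h.label_eq_centralLabel hs h1 h2 hl hk
  rw [seq_zero, seq_neg_one] at this h3
  exact ⟨this, h3⟩

/-- The converse: if the label is `centralLabel e`, then a point on the diagonal, or at the mirror
image of its image under `F⁴`, is a fixed point of the return map.  With the reflection at the
diagonal, the symmetry of the orbit with respect to the `x`-axis yields a period of the required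
length. -/
theorem ReturnArc.symm_fixed_of_label (h : ReturnArc e lam (seq lam p) j)
    (hs : Small (nextCritical e) lam)
    (h0 : fl lam (seq lam p 0) = diagIndex e) (h0' : fl lam (seq lam p (-1)) = diagIndex e)
    (hlab : label e lam (diagIndex e) (diagIndex e) p = centralLabel e) {ε : ℤ}
    (hε : ε = 0 ∧ seq lam p 0 = seq lam p (-1) ∨ ε = 1 ∧ seq lam p 4 - seq lam p 3 > 0)
    (hdiag : ∀ k, seq lam p (4 * ε - 1 - k) = seq lam p k) :
    HasSymmetricOrbit lam p ∧ Φ lam p = p := by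
  refine ⟨hasSymmetricOrbit_of hdiag, ?_⟩
  have hx := isOrbit_seq lam p
  obtain ⟨hτ, -⟩ := h.outgoing.tau_eq h.ret
  obtain ⟨-, -, hj0, hBj⟩ := h.outgoing.inX h.ret
  have hX := h.outgoing.start
  -- The last index at which the orbit of `F⁴` is above the `x`-axis.
  obtain ⟨i, hij, hBi, hBi'⟩ : ∃ i : ℕ, i < j ∧ 0 ≤ seq lam p (4 * i - 1) ∧
      seq lam p (4 * i + 3) < 0 := by
    classical
    have hex : ∃ i : ℕ, seq lam p (4 * i - 1) < 0 := ⟨j, hBj⟩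
    have hf := Nat.find_spec hex
    have hfj := Nat.find_min' hex hBj
    have hf0 : Nat.find hex ≠ 0 := by
      intro h0
      rw [h0] at hf
      have := hX.2.1
      simp only [Nat.cast_zero, mul_zero] at hf
      omega
    obtain ⟨i, hi⟩ := Nat.exists_eq_succ_of_ne_zero hf0
    refine ⟨i, by omega, not_lt.1 (Nat.find_min hex (by omega)), ?_⟩
    rw [hi] at hf
    rw [show (4 : ℤ) * i + 3 = 4 * ((i.succ : ℕ) : ℤ) - 1 by push_cast; ring]
    exact hf
  obtain ⟨a1, a2, a3⟩ := h.label_axis hs h0 h0' hij.le hBi hBi'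
  rw [seq_zero, seq_neg_one, show (p.1, p.2) = p from rfl, hlab] at a3
  obtain ⟨c1, c2⟩ := two_mul_centralLabel e
  obtain ⟨e1, e2, e3, e4, -⟩ := hx.next (4 * i)
  -- As the label is the central one, the orbit is symmetric about the index `4 i` or `4 i + 2`.
  obtain ⟨l, hl1, hl2, hl⟩ : ∃ l : ℤ, 2 * i ≤ l ∧ l ≤ 2 * i + 1 ∧
      ∀ k, seq lam p (4 * l - k) = seq lam p k := by
    by_cases hev : Even (Nat.sqrt e)
    · have := c1 hev
      refine ⟨2 * i, by omega, by omega, hx.symm_of (a := 4 * i) (by congr 1; ring) ?_⟩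
      rw [show (4 : ℤ) * (2 * i) - 4 * i + 1 = 4 * i + 1 by ring]
      omega
    · have := c2 hev
      refine ⟨2 * i + 1, by omega, by omega, hx.symm_of (a := 4 * i + 2) (by congr 1; ring) ?_⟩
      rw [show (4 : ℤ) * (2 * i + 1) - (4 * i + 2) + 1 = 4 * i + 3 by ring,
        show (4 : ℤ) * i + 2 - 1 = 4 * i + 1 by ring]
      omega
  have hε01 : ε = 0 ∨ ε = 1 := by
    rcases hε with h | h
    · exact Or.inl h.1
    · exact Or.inr h.1
  have hlε : 0 ≤ l - ε := by
    by_contra hcon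
    have hi : i = 0 := by omega
    have hε1 : ε = 1 := by omega
    subst hi hε1
    have := hdiag 0
    have := hX.1
    norm_num at *
    omega
  obtain ⟨J, hJ⟩ := Int.eq_ofNat_of_zero_le hlε
  have hJ' : (J : ℤ) = l - ε := hJ.symm
  -- The differences `x_{4i} - x_{4i-1}` are positive.
  have hvpos : ∀ a : ℕ, 1 ≤ a → a ≤ j → 0 < seq lam p (4 * a) - seq lam p (4 * a - 1) := by
    intro a
    induction a with
    | zero => intro h1; omega
    | succ a ih =>
      intro _ haj
      obtain ⟨g1, -⟩ := h.outgoing.cone (a + 1) haj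
      by_cases hB : 0 ≤ seq lam p (4 * ((a + 1 : ℕ) : ℤ) - 1)
      · rw [show (4 : ℤ) * ((a + 1 : ℕ) : ℤ) - 1 = 4 * a + 3 by push_cast; ring] at hB ⊢
        have hd := (h.outgoing.diff_lt a (by omega) hB).1
        rw [show (4 : ℤ) * ((a + 1 : ℕ) : ℤ) = 4 * a + 4 by push_cast; ring]
        rcases Nat.eq_zero_or_pos a with ha | ha
        · subst ha
          simp only [Nat.cast_zero, mul_zero, zero_add, zero_sub] at hd ⊢
          rcases hε with ⟨-, h⟩ | ⟨-, h⟩ <;> omega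
        · have := ih ha (by omega)
          omega
      · omega
  have hd : ∀ a b : ℤ, a + b = J + ε → seq lam p (4 * a) - seq lam p (4 * a + 1) =
      seq lam p (4 * b) - seq lam p (4 * b - 1) := by
    intro a b hab
    rw [← hl (4 * a), ← hl (4 * a + 1)]
    congr 2 <;> omega
  have hsum : ∀ a b : ℤ, a + b = J + ε → seq lam p (4 * a + 4) - seq lam p (4 * a + 5) =
      seq lam p (4 * b - 4) - seq lam p (4 * b - 5) := by
    intro a b hab
    rw [← hl (4 * a + 4), ← hl (4 * a + 5)]
    congr 2 <;> omega
  have hJj : J = j := by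
    apply le_antisymm
    · by_contra hcon
      rw [not_le] at hcon
      obtain ⟨b, hb⟩ : ∃ b : ℕ, (j : ℤ) + b = J + ε := ⟨(J + ε - j).toNat, by omega⟩
      have h1 := hd j b hb
      have h2 := hsum j b hb
      have h3 := h.ret
      have h4 := hvpos b (by omega) (by omega)
      have h5 : 0 ≤ seq lam p (4 * b - 4) - seq lam p (4 * b - 5) := by
        rcases Nat.lt_or_ge b 2 with hb2 | hb2
        · obtain rfl : b = 1 := by omega
          rcases hε with ⟨-, h⟩ | ⟨h, -⟩
          · norm_num
            omega
          · omega
        · have := hvpos (b - 1) (by omega) (by omega)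
          rw [show (4 : ℤ) * ((b - 1 : ℕ) : ℤ) = 4 * b - 4 by omega,
            show (4 : ℤ) * b - 4 - 1 = 4 * b - 5 by ring] at this
          exact this.le
      omega
    · by_contra hcon
      rw [not_le] at hcon
      have h1 := h.outgoing.sum_pos J hcon
      have h2 := hd J ε rfl
      have h3 := hsum J ε rfl
      have h4 := hvpos 1 le_rfl (by omega)
      have d1 := hdiag 0
      have d2 := hdiag (-1)
      rcases hε with ⟨rfl, h⟩ | ⟨rfl, h⟩
      · have d3 := hdiag 3
        have d4 := hdiag 4
        norm_num at *
        omega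
      · norm_num at *
        omega
  have hT : (F lam ^ ((4 * j + 1 : ℕ) : ℤ)) p = p := by
    have hper : ∀ t, seq lam p (t + (4 * j + 1 : ℕ)) = seq lam p t := by
      intro t
      rw [← hl, ← hdiag]
      congr 1
      push_cast
      omega
    rw [F_zpow_eq]
    have u1 := hper 0
    have u2 := hper (-1)
    rw [zero_add, seq_zero] at u1
    rw [neg_add_eq_sub, seq_neg_one] at u2
    rw [u1, u2]
  unfold Φ
  rw [hτ, ← zpow_natCast]
  exact hT

end

noncomputable section

/-! ### The points of `X` away from the ends of the critical interval -/

variable {lam : ℝ} {E e : ℕ} {p : ℤ × ℤ}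

theorem seq_G (lam : ℝ) (p : ℤ × ℤ) (t : ℤ) : seq lam (G p) t = seq lam p (-1 - t) :=
  (isOrbit_seq lam (G p)).ext ((isOrbit_seq lam p).reverse (-1)) (a := 0)
    (by rw [seq_zero, sub_zero, seq_neg_one]; rfl)
    (by rw [zero_sub, seq_neg_one, sub_neg_eq_add, neg_add_cancel, seq_zero]; rfl) t

theorem ham_G (lam : ℝ) (p : ℤ × ℤ) : ham (scaled lam (G p)) = ham (scaled lam p) :=
  add_comm _ _

/-- Away from the ends of the critical interval, four steps near the diagonal are a translation. -/
theorem step_of_diag (hs : Small (nextCritical e) lam) (hr : Rough (nextCritical e) lam p.1 p.2)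
    (ha : 0 ≤ p.1) (hb : 0 ≤ p.2) (hab : |p.1 - p.2| ≤ 8 * ((nextCritical e : ℤ) + 1))
    (h1 : e + lam * diagConst (nextCritical e) ≤ ham (scaled lam p))
    (h2 : ham (scaled lam p) ≤ nextCritical e - lam * diagConst (nextCritical e)) :
    fl lam p.1 = diagIndex e ∧ fl lam p.2 = diagIndex e ∧
      seq lam p 4 = p.1 + (2 * diagIndex e + 1) ∧ seq lam p 3 = p.2 - (2 * diagIndex e + 1) := by
  have hL := not_mem_Λ_of_diag hs hr ha hb hab h1 h2
  have hL' := (mem_Λ_iff (lam := lam) p 0).not.1 (by rwa [zpow_zero, Equiv.Perm.one_apply])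
  rw [not_not] at hL'
  simp only [zero_sub, zero_add, seq_zero, seq_neg_one] at hL'
  unfold ham scaled at h1 h2
  simp only at h1 h2
  have z1 := fl_eq_diagIndex hs ha hb hab h1 h2 (c := 0) (by simp; omega)
  have z2 := fl_eq_diagIndex hs hb ha (by rw [abs_sub_comm]; exact hab) (by linarith) (by linarith)
    (c := 0) (by simp; omega)
  rw [zero_add] at z1 z2
  have hpos : 0 < p.1 := by
    have h3 := hr.2.2
    rw [abs_of_nonneg ha, abs_of_nonneg hb] at h3
    rw [abs_le] at hab
    omega
  have := (isOrbit_seq lam p).add_of_not_mem hs (t := 0) (m := diagIndex e) (n := diagIndex e)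
    (by rw [seq_zero, z1]) (by rw [zero_sub, seq_neg_one, z2]) (diagIndex_lt_nextCritical e)
    (diagIndex_lt_nextCritical e) (by rw [zero_add, hL'.1, z1]) (by rw [zero_add, hL'.2, z2])
    (by rw [seq_zero]; exact hpos)
  rw [zero_add, zero_add, zero_sub, seq_zero, seq_neg_one] at this
  exact ⟨z1, z2, this⟩

theorem diagConst_le_marginConst (E : ℕ) : diagConst E ≤ marginConst E := by
  unfold marginConst
  have := driftConst_nonneg E
  have := stepConst_nonneg E
  have := cornerConst_nonneg E
  have := roughConst_nonneg E
  linarith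

theorem roughConst_le_marginConst (E : ℕ) : roughConst E ≤ marginConst E := by
  unfold marginConst
  have := driftConst_nonneg E
  have := stepConst_nonneg E
  have := cornerConst_nonneg E
  have := diagConst_nonneg E
  linarith

/-- A bound for the Hamiltonian confines the point and a lower bound keeps it away from the origin.
-/
theorem rough_of_ham (hlam : 0 < lam) (h1 : ham (scaled lam p) ≤ E)
    (h2 : lam * roughConst E ≤ ham (scaled lam p)) : Rough E lam p.1 p.2 := by
  have := rough_of_energy (x := seq lam p) (E := E) (t := 0) hlam
    (by rw [energy_zero]; exact h1) (by rw [energy_zero]; exact h2)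
  simpa [seq_zero, seq_neg_one] using this

/-- Away from the ends of the critical interval, `X` is a strip of width `2 (2 v₁ + 1)` about the
diagonal. -/
theorem mem_mid_iff (hs : Small (nextCritical e) lam) : p ∈ mid e lam ↔ 0 ≤ p.1 ∧ 0 ≤ p.2 ∧
    -(2 * (diagIndex e : ℤ) + 1) ≤ p.1 - p.2 ∧ p.1 - p.2 < 2 * diagIndex e + 1 ∧
    e + lam * marginConst (nextCritical e) ≤ ham (scaled lam p) ∧
    ham (scaled lam p) ≤ nextCritical e - lam * marginConst (nextCritical e) := by
  have key : 0 ≤ p.1 → 0 ≤ p.2 → |p.1 - p.2| ≤ 8 * ((nextCritical e : ℤ) + 1) →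
      e + lam * marginConst (nextCritical e) ≤ ham (scaled lam p) →
      ham (scaled lam p) ≤ nextCritical e - lam * marginConst (nextCritical e) →
      (p ∈ X lam ↔ -(2 * (diagIndex e : ℤ) + 1) ≤ p.1 - p.2 ∧ p.1 - p.2 < 2 * diagIndex e + 1) := by
    intro ha hb hab h1 h2
    have he : (0 : ℝ) ≤ e := by positivity
    have m0 := mul_pos hs.1 (marginConst_pos (nextCritical e))
    have m1 := mul_le_mul_of_nonneg_left (diagConst_le_marginConst (nextCritical e)) hs.1.le
    have m2 := mul_le_mul_of_nonneg_left (roughConst_le_marginConst (nextCritical e)) hs.1.le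
    have hr : Rough (nextCritical e) lam p.1 p.2 := rough_of_ham hs.1 (by linarith) (by linarith)
    obtain ⟨-, -, a3, a4⟩ := step_of_diag hs hr ha hb hab (by linarith) (by linarith)
    obtain ⟨-, -, b3, b4⟩ := step_of_diag (p := G p) hs hr.symm hb ha
      (by rw [abs_sub_comm]; exact hab) (by rw [ham_G]; linarith) (by rw [ham_G]; linarith)
    rw [seq_G] at b3 b4
    rw [mem_X_iff_zero hs.1]
    unfold InX
    norm_num [G] at a3 a4 b3 b4 ⊢
    rw [seq_zero, seq_neg_one, a3, a4, b3, b4]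
    constructor
    · rintro ⟨-, -, c1, c2⟩
      constructor
      · by_contra hcon
        rw [abs_of_nonpos (by omega : p.1 - p.2 ≤ 0)] at c1
        rcases abs_cases (p.1 + (2 * (diagIndex e : ℤ) + 1) - (p.2 - (2 * diagIndex e + 1))) with
          ⟨a, b⟩ | ⟨a, b⟩ <;> omega
      · by_contra hcon
        rw [abs_of_nonneg (by omega : 0 ≤ p.1 - p.2)] at c2
        rcases abs_cases (p.1 - (2 * (diagIndex e : ℤ) + 1) - (p.2 + (2 * diagIndex e + 1))) with
          ⟨a, b⟩ | ⟨a, b⟩ <;> omega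
    · rintro ⟨c1, c2⟩
      refine ⟨ha, hb, ?_, ?_⟩
      · rw [abs_of_nonneg (by omega : 0 ≤ p.1 + (2 * (diagIndex e : ℤ) + 1) -
          (p.2 - (2 * diagIndex e + 1))), abs_le]
        omega
      · rw [abs_of_nonpos (by omega : p.1 - (2 * (diagIndex e : ℤ) + 1) -
          (p.2 + (2 * diagIndex e + 1)) ≤ 0), abs_lt]
        omega
  constructor
  · intro hp
    have hab := abs_sub_le_of_mem_X hs hp.1 (rough_of_mid hs hp)
    obtain ⟨hX, h1, h2⟩ := hp
    obtain ⟨c1, c2⟩ := (key hX.1 hX.2.1 hab h1 h2).1 hX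
    exact ⟨hX.1, hX.2.1, c1, c2, h1, h2⟩
  · rintro ⟨ha, hb, c1, c2, h1, h2⟩
    have := diagIndex_lt_nextCritical e
    exact ⟨(key ha hb (abs_le.2 ⟨by omega, by omega⟩) h1 h2).2 ⟨c1, c2⟩, h1, h2⟩

/-- In the box on the diagonal, the Hamiltonian is a function of the sum of the coordinates. -/
theorem mem_mid_iff_add (hs : Small (nextCritical e) lam) : p ∈ mid e lam ↔
    -(2 * (diagIndex e : ℤ) + 1) ≤ p.1 - p.2 ∧ p.1 - p.2 < 2 * diagIndex e + 1 ∧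
    e + lam * marginConst (nextCritical e) ≤
      (2 * diagIndex e + 1) * (lam * (p.1 + p.2 : ℤ)) - 2 * (diagIndex e * (diagIndex e + 1)) ∧
    (2 * diagIndex e + 1) * (lam * (p.1 + p.2 : ℤ)) - 2 * (diagIndex e * (diagIndex e + 1)) ≤
      nextCritical e - lam * marginConst (nextCritical e) := by
  set M := diagIndex e with hM
  set E := nextCritical e with hE
  have hlam := hs.1
  have hham : (M : ℝ) ≤ lam * p.1 → lam * p.1 ≤ M + 1 → (M : ℝ) ≤ lam * p.2 → lam * p.2 ≤ M + 1 →
      ham (scaled lam p) =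
        (2 * M + 1) * (lam * (p.1 + p.2 : ℤ)) - 2 * (M * (M + 1)) := by
    intro a1 a2 b1 b2
    have q1 := P_eq_of_mem (n := (M : ℤ)) (by exact_mod_cast a1) (by exact_mod_cast a2)
    have q2 := P_eq_of_mem (n := (M : ℤ)) (by exact_mod_cast b1) (by exact_mod_cast b2)
    unfold ham scaled
    simp only
    rw [q1, q2]
    push_cast
    ring
  constructor
  · intro hp
    have hr := rough_of_mid hs hp
    have hab := abs_sub_le_of_mem_X hs hp.1 hr
    obtain ⟨ha, hb, c1, c2, h1, h2⟩ := (mem_mid_iff hs).1 hp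
    have m1 := mul_le_mul_of_nonneg_left (diagConst_le_marginConst (nextCritical e)) hs.1.le
    obtain ⟨z1, z2, -⟩ := step_of_diag hs hr ha hb hab (by linarith) (by linarith)
    obtain ⟨a1, a2⟩ := Int.floor_eq_iff.1 z1
    obtain ⟨b1, b2⟩ := Int.floor_eq_iff.1 z2
    push_cast at a1 a2 b1 b2
    rw [← hham a1 a2.le b1 b2.le]
    exact ⟨c1, c2, h1, h2⟩
  · rintro ⟨c1, c2, h1, h2⟩
    have hM1 : (M : ℝ) ^ 2 + (M : ℝ) ^ 2 ≤ e := by exact_mod_cast diagIndex_le e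
    have hM2 : (E : ℝ) ≤ ((M : ℝ) + 1) ^ 2 + ((M : ℝ) + 1) ^ 2 := by
      have := nextCritical_le_of_lt (lt_diagIndex e)
      push_cast at this
      exact this
    have hME : (M : ℝ) ≤ E := by exact_mod_cast diagIndex_lt_nextCritical e
    have hM0 : (0 : ℝ) ≤ M := by positivity
    have hc : (2 * (M : ℝ) + 1) ^ 2 ≤ marginConst E := by
      refine le_trans ?_ (diagConst_le_marginConst E)
      unfold diagConst
      nlinarith
    have hc' := mul_le_mul_of_nonneg_left hc hlam.le
    have d1 : -(2 * (M : ℝ) + 1) ≤ p.1 - p.2 := by exact_mod_cast c1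
    have d2 : (p.1 : ℝ) - p.2 ≤ 2 * M + 1 := by exact_mod_cast c2.le
    have d3 := mul_le_mul_of_nonneg_left d1 hlam.le
    have d4 := mul_le_mul_of_nonneg_left d2 hlam.le
    rw [mul_sub] at d3 d4
    have hR : (0 : ℝ) < 2 * M + 1 := by positivity
    -- The margin is wide enough for both coordinates to lie in `[M, M + 1]`.
    have s1 : 2 * M + lam * (2 * M + 1) ≤ lam * p.1 + lam * p.2 := by
      refine le_of_mul_le_mul_left ?_ hR
      push_cast at h1
      nlinarith
    have s2 : lam * p.1 + lam * p.2 ≤ 2 * (M + 1) - lam * (2 * M + 1) := by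
      refine le_of_mul_le_mul_left ?_ hR
      push_cast at h2
      nlinarith
    have e1 : (M : ℝ) ≤ lam * p.1 := by linarith
    have e2 : (M : ℝ) ≤ lam * p.2 := by linarith
    rw [mem_mid_iff hs, hham e1 (by linarith) e2 (by linarith)]
    have n1 : (0 : ℝ) ≤ p.1 := nonneg_of_mul_nonneg_right (hM0.trans e1) hlam
    have n2 : (0 : ℝ) ≤ p.2 := nonneg_of_mul_nonneg_right (hM0.trans e2) hlam
    exact ⟨by exact_mod_cast n1, by exact_mod_cast n2, c1, c2, h1, h2⟩

/-- The symmetric fixed points away from the ends of the critical interval. -/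
theorem symm_fixed_iff_of_mid (hs : Small (nextCritical e) lam) (hp : p ∈ mid e lam) :
    (HasSymmetricOrbit lam p ∧ Φ lam p = p) ↔
      label e lam (diagIndex e) (diagIndex e) p = centralLabel e ∧
      (p.2 = p.1 ∨ p.2 = p.1 + (2 * diagIndex e + 1)) := by
  have hreg := isRegular_of_mid hs hp
  obtain ⟨j, ho, hj⟩ := exists_return hs hp
  have harc := hreg.returnArc ho hj
  constructor
  · rintro ⟨h1, h2⟩
    exact harc.label_eq_of_symm hs hreg.2.2.2.1.1 h1 h2
  · rintro ⟨h1, h2⟩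
    have hr := rough_of_mid hs hp
    have hab := abs_sub_le_of_mem_X hs hp.1 hr
    obtain ⟨ha, hb, c1, c2, h3, h4⟩ := (mem_mid_iff hs).1 hp
    have m1 := mul_le_mul_of_nonneg_left (diagConst_le_marginConst (nextCritical e)) hs.1.le
    obtain ⟨z1, z2, z3, z4⟩ := step_of_diag hs hr ha hb hab (by linarith) (by linarith)
    have w0 := seq_zero lam p
    have w1 := seq_neg_one lam p
    rcases h2 with h2 | h2
    · refine harc.symm_fixed_of_label hs (by rw [w0, z1]) (by rw [w1, z2]) h1 (ε := 0)
        (Or.inl ⟨rfl, by rw [w0, w1, h2]⟩) fun k => ?_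
      refine (isOrbit_seq lam p).symm_of (a := 0) ?_ ?_ k
      · norm_num; rw [w0, w1, h2]
      · norm_num; rw [w0, w1, h2]
    · refine harc.symm_fixed_of_label hs (by rw [w0, z1]) (by rw [w1, z2]) h1 (ε := 1)
        (Or.inr ⟨rfl, by rw [z3, z4]; omega⟩) fun k => ?_
      refine (isOrbit_seq lam p).symm_of (a := 0) ?_ ?_ k
      · norm_num; rw [w0, z4]; omega
      · norm_num; rw [w1, z3]; omega

/-! ### Symmetric fixed points modulo the lattice -/

/-- The label of a symmetric point `(x, y)`, that is with `y = x` or `y = x + (2 v₁ + 1)`, as a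
function of `x + y`. -/
def sumLabel (e : ℕ) (lam : ℝ) (s : ℤ) : ℤ :=
  diagLabel e lam (if Even s then s / 2 else (s - diagPeriod e) / 2)

theorem sumLabel_two_mul (x : ℤ) : sumLabel e lam (2 * x) = diagLabel e lam x := by
  unfold sumLabel
  rw [if_pos (even_two_mul x), Int.mul_ediv_cancel_left _ two_ne_zero]

theorem sumLabel_periodic (s : ℤ) : sumLabel e lam (s + diagPeriod e) = sumLabel e lam s := by
  have hodd : Odd (diagPeriod e : ℤ) := by exact_mod_cast diagPeriod_odd e
  unfold sumLabel
  by_cases h : Even s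
  · rw [if_pos h, if_neg (by rw [Int.not_even_iff_odd]; exact h.add_odd hodd), add_sub_cancel_right]
  · have h' := Int.not_even_iff_odd.1 h
    rw [if_neg h, if_pos (h'.add_odd hodd), ← diagLabel_periodic ((s - diagPeriod e) / 2)]
    congr 1
    obtain ⟨a, ha⟩ := h'
    obtain ⟨b, hb⟩ := hodd
    omega

/-- A point `(x, x + 2 v₁ + 1)` is congruent to a point on the diagonal modulo the lattice, and has
the same label. -/
theorem label_add_eq (x : ℤ) : label e lam (diagIndex e) (diagIndex e)
    (x, x + (2 * diagIndex e + 1)) =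
      diagLabel e lam (x - (diagPeriod e - (2 * diagIndex e + 1)) / 2) := by
  obtain ⟨k, hk⟩ := dvd_diagPeriod e
  have hk' : (diagPeriod e : ℤ) = (2 * diagIndex e + 1) * k := by exact_mod_cast hk
  have hodd : Odd k := (diagPeriod_odd e).of_dvd_nat ⟨_, by rw [hk, mul_comm]⟩
  obtain ⟨i, hi⟩ := hodd
  set R : ℤ := 2 * diagIndex e + 1 with hR
  have hs : (diagPeriod e - R) / 2 = R * i := by
    rw [hk', hi]
    push_cast
    rw [show R * (2 * (i : ℤ) + 1) - R = 2 * (R * i) by ring]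
    exact Int.mul_ediv_cancel_left _ two_ne_zero
  have hℓ : (diagPeriod e : ℤ) = R * (2 * i + 1) := by rw [hk', hi]; push_cast; ring
  rw [hs]
  obtain ⟨h1, h2⟩ := label_period (e := e) (lam := lam) rfl
  unfold diagLabel
  by_cases hc : (diagIndex e + 1) ^ 2 + diagIndex e ^ 2 ≤ e
  · rw [← h1 hc (x - R * i), hℓ, ← label_translate x (x + R) (-i)]
    congr 2
    · rw [← hR]; ring
    · rw [← hR]; ring
  · rw [← h2 hc (x - R * i), hℓ, ← label_translate x (x + R) (i + 1)]
    congr 2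
    · rw [← hR]; ring
    · rw [← hR]; ring

/-- On the two lines that contain the symmetric fixed points, the label depends only on the sum of
the coordinates. -/
theorem label_eq_sumLabel (hp : p.2 = p.1 ∨ p.2 = p.1 + (2 * diagIndex e + 1)) :
    label e lam (diagIndex e) (diagIndex e) p = sumLabel e lam (p.1 + p.2) := by
  obtain ⟨a, b⟩ := p
  simp only at hp ⊢
  rcases hp with rfl | rfl
  · rw [← two_mul, sumLabel_two_mul]
    rfl
  · rw [label_add_eq]
    unfold sumLabel
    have hne : ¬ Even (a + (a + (2 * (diagIndex e : ℤ) + 1))) := by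
      rw [Int.not_even_iff_odd]
      exact ⟨a + diagIndex e, by ring⟩
    rw [if_neg hne]
    congr 1
    have hodd : Odd (diagPeriod e : ℤ) := by exact_mod_cast diagPeriod_odd e
    obtain ⟨b, hb⟩ := hodd
    omega

/-- An explicit basis of the lattice: the period `q / (2 v₁ + 1)` along the diagonal, and a vector
from the diagonal to its translate by `2 v₁ + 1`. -/
theorem mem_lattice_iff {z : ℤ × ℤ} :
    z ∈ lattice (types e (diagIndex e) (diagIndex e)) ↔ ∃ i k : ℤ,
      z.1 = i * diagPeriod e + k * ((diagPeriod e - (2 * diagIndex e + 1)) / 2) ∧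
      z.2 = i * diagPeriod e + k * ((diagPeriod e - (2 * diagIndex e + 1)) / 2) +
        k * (2 * diagIndex e + 1) := by
  have hodd : Odd (diagPeriod e : ℤ) := by exact_mod_cast diagPeriod_odd e
  obtain ⟨b, hb⟩ := hodd
  have hL : latticeVector (types e (diagIndex e) (diagIndex e)) =
      ((diagPeriod e : ℤ), (diagPeriod e : ℤ)) := by
    unfold latticeVector diagPeriod
    rw [types_headI]
    push_cast
    rfl
  unfold lattice
  rw [AddSubgroup.mem_closure_pair, hL, types_headI]
  have hsum : ((diagPeriod e : ℤ) - (-(2 * (diagIndex e : ℤ) + 1))) / 2 =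
      (diagPeriod e - (2 * diagIndex e + 1)) / 2 + (2 * diagIndex e + 1) := by omega
  unfold w
  simp only [Prod.mk_sub_mk]
  rw [hsum]
  refine exists₂_congr fun i k => ?_
  rw [Prod.ext_iff]
  simp only [Prod.smul_mk, smul_eq_mul, Prod.mk_add_mk]
  constructor
  · rintro ⟨h1, h2⟩
    exact ⟨h1.symm, by rw [← h2]; ring⟩
  · rintro ⟨h1, h2⟩
    exact ⟨h1.symm, by rw [h2]; ring⟩

theorem diag_mem_lattice_iff (a : ℤ) :
    (a, a) ∈ lattice (types e (diagIndex e) (diagIndex e)) ↔ (diagPeriod e : ℤ) ∣ a := by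
  rw [mem_lattice_iff]
  constructor
  · rintro ⟨i, k, h1, h2⟩
    simp only at h1 h2
    have h3 : k * (2 * (diagIndex e : ℤ) + 1) = 0 := by omega
    have h4 : k = 0 := by
      rcases mul_eq_zero.1 h3 with h | h
      · exact h
      · omega
    rw [h4, zero_mul, add_zero] at h1
    exact ⟨i, by rw [h1, mul_comm]⟩
  · rintro ⟨i, rfl⟩
    exact ⟨i, 0, by ring, by ring⟩

/-- Modulo the lattice, a point with the central label that satisfies one of the two symmetry
conditions is on the diagonal. -/
theorem exists_diag_congr (hp : p.2 = p.1 ∨ p.2 = p.1 + (2 * diagIndex e + 1)) :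
    ∃ a : ℤ, label e lam (diagIndex e) (diagIndex e) p = diagLabel e lam a ∧
      p - (a, a) ∈ lattice (types e (diagIndex e) (diagIndex e)) := by
  obtain ⟨x, y⟩ := p
  simp only at hp
  rcases hp with rfl | rfl
  · exact ⟨y, rfl, by simp⟩
  · refine ⟨_, label_add_eq x, mem_lattice_iff.2 ⟨0, 1, ?_, ?_⟩⟩
    · simp
    · simp; ring

/-- For `e = 0`, the lattice is `ℤ²`. -/
theorem lattice_zero : lattice (types 0 (diagIndex 0) (diagIndex 0)) = ⊤ := by
  rw [eq_top_iff]
  rintro ⟨a, b⟩ -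
  have hd : diagIndex 0 = 0 := rfl
  have ht : types 0 0 0 = [0] := types_zero (by norm_num)
  have hp : diagPeriod 0 = 1 := by
    unfold diagPeriod
    rw [hd, ht]
    simp [q]
  rw [mem_lattice_iff, hp, hd]
  exact ⟨a, b - a, by simp, by simp⟩

end

noncomputable section

/-! ### The largest regular interval -/

variable {lam : ℝ} {e : ℕ}

/-- The values of the Hamiltonian at the points of `X` that are not regular. -/
def irregularValues (e : ℕ) (lam : ℝ) : Set ℝ :=
  {h | h ∈ criticalInterval e ∧ ∃ p ∈ X lam, ham (scaled lam p) = h ∧ ¬ IsRegular e lam p}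

/-- The values of the Hamiltonian that are not separated by an irregular value from the middle of
the critical interval. -/
def regularComponent (e : ℕ) (lam : ℝ) : Set ℝ :=
  Set.ordConnectedComponent (criticalInterval e \ irregularValues e lam)
    (((e : ℝ) + nextCritical e) / 2)

/-- Regular intervals are the order-connected sets that avoid the irregular values. -/
theorem isRegularInterval_iff {J : Set ℝ} : IsRegularInterval e lam J ↔
    J.OrdConnected ∧ J ⊆ criticalInterval e \ irregularValues e lam := by
  unfold IsRegularInterval
  refine and_congr_right fun _ => ?_
  constructor
  · rintro ⟨h1, h2⟩ y hy
    refine ⟨h1 hy, ?_⟩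
    rintro ⟨-, p, hp, rfl, hp'⟩
    exact hp' (h2 p ⟨hp, hy⟩)
  · intro h
    refine ⟨fun y hy => (h hy).1, fun p hp => ?_⟩
    by_contra hcon
    exact (h hp.2).2 ⟨(h hp.2).1, p, hp.1, rfl, hcon⟩

theorem finite_ham_le (hlam : 0 < lam) (C : ℝ) : {p : ℤ × ℤ | ham (scaled lam p) ≤ C}.Finite := by
  refine (Set.finite_Icc ((-⌈C / lam⌉, -⌈C / lam⌉) : ℤ × ℤ) (⌈C / lam⌉, ⌈C / lam⌉)).subset ?_
  intro p hp
  rw [Set.mem_ofPred_eq] at hp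
  unfold ham scaled at hp
  simp only at hp
  have key : ∀ a b : ℤ, P (lam * a) + P (lam * b) ≤ C → |a| ≤ ⌈C / lam⌉ := by
    intro a b hab
    have h1 := abs_le_P (lam * a)
    have h2 := P_nonneg (lam * b)
    rw [abs_mul, abs_of_pos hlam] at h1
    have h3 : |(a : ℝ)| ≤ C / lam := by
      rw [le_div_iff₀ hlam]
      linarith
    have h4 := h3.trans (Int.le_ceil _)
    exact_mod_cast h4
  have h1 := abs_le.1 (key _ _ hp)
  have h2 := abs_le.1 (key _ _ (by rw [add_comm]; exact hp))
  exact ⟨⟨h1.1, h2.1⟩, ⟨h1.2, h2.2⟩⟩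

theorem irregularValues_finite (hlam : 0 < lam) (e : ℕ) : (irregularValues e lam).Finite := by
  refine ((finite_ham_le hlam (nextCritical e)).image fun p => ham (scaled lam p)).subset ?_
  rintro h ⟨h1, p, -, rfl, -⟩
  exact ⟨p, h1.2.le, rfl⟩

theorem add_one_le_nextCritical (e : ℕ) : (e : ℝ) + 1 ≤ nextCritical e := by
  exact_mod_cast lt_nextCritical e

theorem Icc_subset_regular (hs : Small (nextCritical e) lam) :
    Set.Icc ((e : ℝ) + lam * marginConst (nextCritical e))
      (nextCritical e - lam * marginConst (nextCritical e)) ⊆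
      criticalInterval e \ irregularValues e lam := by
  have hμ := mul_pos hs.1 (marginConst_pos (nextCritical e))
  rintro y ⟨h1, h2⟩
  refine ⟨⟨by linarith, by linarith⟩, ?_⟩
  rintro ⟨-, p, hp, rfl, hp'⟩
  exact hp' (isRegular_of_mid hs ⟨hp, h1, h2⟩)

theorem isRegularInterval_regularComponent (e : ℕ) (lam : ℝ) :
    IsRegularInterval e lam (regularComponent e lam) :=
  isRegularInterval_iff.2 ⟨inferInstanceAs (Set.OrdConnected (Set.ordConnectedComponent _ _)),
    Set.ordConnectedComponent_subset⟩

theorem Icc_subset_regularComponent (hs : Small (nextCritical e) lam)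
    (hw : lam * marginConst (nextCritical e) ≤ 1 / 5) :
    Set.Icc ((e : ℝ) + lam * marginConst (nextCritical e))
      (nextCritical e - lam * marginConst (nextCritical e)) ⊆ regularComponent e lam := by
  have := add_one_le_nextCritical e
  exact Set.subset_ordConnectedComponent (h := Set.ordConnected_Icc)
    ⟨by linarith, by linarith⟩ (Icc_subset_regular hs)

theorem isOpen_regularComponent (hlam : 0 < lam) : IsOpen (regularComponent e lam) := by
  have hS : IsOpen (criticalInterval e \ irregularValues e lam) :=
    isOpen_Ioo.sdiff (irregularValues_finite hlam e).isClosed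
  rw [isOpen_iff_mem_nhds]
  intro y hy
  have hy' : y ∈ criticalInterval e \ irregularValues e lam :=
    Set.ordConnectedComponent_subset hy
  unfold regularComponent at hy ⊢
  rw [Set.ordConnectedComponent_eq hy]
  exact Set.ordConnectedComponent_mem_nhds.2 (hS.mem_nhds hy')

/-- A regular interval is contained in the component of the middle of the critical interval, or is
short. -/
theorem subset_or_volume_le (hs : Small (nextCritical e) lam)
    (hw : lam * marginConst (nextCritical e) ≤ 1 / 5) {J : Set ℝ} (hJ : IsRegularInterval e lam J) :
    J ⊆ regularComponent e lam ∨ MeasureTheory.volume J ≤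
      ENNReal.ofReal (2 * (lam * marginConst (nextCritical e))) := by
  set μ := lam * marginConst (nextCritical e) with hμ
  have hlen := add_one_le_nextCritical e
  have hμ0 : 0 < μ := mul_pos hs.1 (marginConst_pos (nextCritical e))
  obtain ⟨hJ1, hJ2⟩ := isRegularInterval_iff.1 hJ
  by_cases hne : ∃ z ∈ J, z ∈ Set.Icc ((e : ℝ) + μ) (nextCritical e - μ)
  · left
    obtain ⟨z, hz, hz'⟩ := hne
    intro y hy
    have hzc := Icc_subset_regularComponent hs hw hz'
    unfold regularComponent at hzc ⊢
    rw [Set.ordConnectedComponent_eq hzc, Set.mem_ordConnectedComponent]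
    exact (hJ1.uIcc_subset hz hy).trans hJ2
  · right
    push Not at hne
    have hsub : J ⊆ Set.Ioo (e : ℝ) (e + μ) ∪ Set.Ioo (nextCritical e - μ) (nextCritical e) := by
      intro y hy
      have h1 := hne y hy
      have h2 := (hJ2 hy).1
      rw [Set.mem_Icc, not_and_or, not_le, not_le] at h1
      rcases h1 with h1 | h1
      · exact Or.inl ⟨h2.1, h1⟩
      · exact Or.inr ⟨h1, h2.2⟩
    refine (MeasureTheory.measure_mono hsub).trans ((MeasureTheory.measure_union_le _ _).trans ?_)
    rw [Real.volume_Ioo, Real.volume_Ioo, ← ENNReal.ofReal_add (by linarith) (by linarith)]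
    exact ENNReal.ofReal_le_ofReal (by linarith)

theorem lt_volume_regularComponent (hs : Small (nextCritical e) lam)
    (hw : lam * marginConst (nextCritical e) ≤ 1 / 5) :
    ENNReal.ofReal (2 * (lam * marginConst (nextCritical e))) <
      MeasureTheory.volume (regularComponent e lam) := by
  have hlen := add_one_le_nextCritical e
  refine lt_of_lt_of_le ?_ (MeasureTheory.measure_mono (Icc_subset_regularComponent hs hw))
  rw [Real.volume_Icc, ENNReal.ofReal_lt_ofReal_iff (by linarith)]
  linarith

theorem volume_regularComponent_ne_top (e : ℕ) (lam : ℝ) :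
    MeasureTheory.volume (regularComponent e lam) ≠ ⊤ := by
  refine ne_top_of_le_ne_top ?_ (MeasureTheory.measure_mono
    (isRegularInterval_regularComponent e lam).2.1)
  unfold criticalInterval
  rw [Real.volume_Ioo]
  exact ENNReal.ofReal_ne_top

/-- An interval of full measure in an open set of finite measure is all of it. -/
theorem eq_of_ordConnected_of_volume_le {J U : Set ℝ} (hJ : J.OrdConnected) (hU : IsOpen U)
    (hJU : J ⊆ U) (hfin : MeasureTheory.volume U ≠ ⊤)
    (hle : MeasureTheory.volume U ≤ MeasureTheory.volume J) : J = U := by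
  refine Set.Subset.antisymm hJU fun y hy => ?_
  by_contra hyJ
  obtain ⟨ε, hε, hball⟩ := Metric.isOpen_iff.1 hU y hy
  rw [Real.ball_eq_Ioo] at hball
  have key : ∀ I : Set ℝ, MeasurableSet I → I ⊆ U → Disjoint J I →
      MeasureTheory.volume I = ENNReal.ofReal ε → False := by
    intro I hI hIU hd hv
    have h1 : MeasureTheory.volume (J ∪ I) ≤ MeasureTheory.volume U :=
      MeasureTheory.measure_mono (Set.union_subset hJU hIU)
    rw [MeasureTheory.measure_union hd hI, hv] at h1
    have hJfin : MeasureTheory.volume J ≠ ⊤ :=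
      ne_top_of_le_ne_top hfin (MeasureTheory.measure_mono hJU)
    have h2 : MeasureTheory.volume J + ENNReal.ofReal ε ≤ MeasureTheory.volume J + 0 := by
      rw [add_zero]
      exact h1.trans hle
    have h3 := (ENNReal.add_le_add_iff_left hJfin).1 h2
    rw [nonpos_iff_eq_zero, ENNReal.ofReal_eq_zero] at h3
    linarith
  by_cases hlt : ∃ z ∈ J, z < y
  · obtain ⟨z, hz, hzy⟩ := hlt
    refine key (Set.Ioo y (y + ε)) measurableSet_Ioo
      (fun u hu => hball ⟨by linarith [hu.1], hu.2⟩) ?_ (by rw [Real.volume_Ioo]; ring_nf)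
    rw [Set.disjoint_left]
    intro u hu hu'
    exact hyJ (hJ.out hz hu ⟨hzy.le, hu'.1.le⟩)
  · push Not at hlt
    refine key (Set.Ioo (y - ε) y) measurableSet_Ioo
      (fun u hu => hball ⟨hu.1, by linarith [hu.2]⟩) ?_ (by rw [Real.volume_Ioo]; ring_nf)
    rw [Set.disjoint_left]
    intro u hu hu'
    exact absurd (hlt u hu) (not_le.2 hu'.2)

/-- For small `λ` there is a unique regular interval of the largest length, the component of the
middle of the critical interval: every other one is short or contained in it. -/
theorem isLargestRegularInterval_iff (hs : Small (nextCritical e) lam)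
    (hw : lam * marginConst (nextCritical e) ≤ 1 / 5) {J : Set ℝ} :
    IsLargestRegularInterval e lam J ↔ J = regularComponent e lam := by
  constructor
  · rintro ⟨h1, h2⟩
    have h3 := h2 _ (isRegularInterval_regularComponent e lam)
    refine eq_of_ordConnected_of_volume_le h1.1 (isOpen_regularComponent hs.1) ?_
      (volume_regularComponent_ne_top e lam) h3
    exact (subset_or_volume_le hs hw h1).resolve_right fun h =>
      absurd ((lt_volume_regularComponent hs hw).trans_le (h3.trans h)) (lt_irrefl _)
  · rintro rfl
    refine ⟨isRegularInterval_regularComponent e lam, fun J' hJ' => ?_⟩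
    rcases subset_or_volume_le hs hw hJ' with h | h
    · exact MeasureTheory.measure_mono h
    · exact h.trans (lt_volume_regularComponent hs hw).le

end

noncomputable section

/-! ### Counting points -/

variable {lam : ℝ} {E e : ℕ} {p : ℤ × ℤ}

/-- The least sum of coordinates in `mid e lam`. -/
def sumLow (e : ℕ) (lam : ℝ) : ℤ :=
  ⌈((e : ℝ) + lam * marginConst (nextCritical e) + 2 * (diagIndex e * (diagIndex e + 1))) /
    ((2 * diagIndex e + 1) * lam)⌉

/-- The number of values of the sum of coordinates in `mid e lam`. -/
def sumCount (e : ℕ) (lam : ℝ) : ℕ :=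
  (⌊((nextCritical e : ℝ) - lam * marginConst (nextCritical e) +
    2 * (diagIndex e * (diagIndex e + 1))) / ((2 * diagIndex e + 1) * lam)⌋ + 1 -
      sumLow e lam).toNat

/-- In the box on the diagonal the Hamiltonian is an affine function of the sum of the coordinates,
so that `mid e lam` consists of the lattice points of a rectangle with sides parallel to the two
diagonals. -/
theorem mem_mid_iff_sum (hs : Small (nextCritical e) lam) : p ∈ mid e lam ↔
    -(2 * (diagIndex e : ℤ) + 1) ≤ p.1 - p.2 ∧ p.1 - p.2 < 2 * diagIndex e + 1 ∧
    sumLow e lam ≤ p.1 + p.2 ∧ p.1 + p.2 < sumLow e lam + sumCount e lam := by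
  have hpos : (0 : ℝ) < (2 * diagIndex e + 1) * lam := mul_pos (by positivity) hs.1
  rw [mem_mid_iff_add hs]
  refine and_congr_right fun _ => and_congr_right fun _ => ?_
  have h1 : sumLow e lam ≤ p.1 + p.2 ↔ (e : ℝ) + lam * marginConst (nextCritical e) ≤
      (2 * diagIndex e + 1) * (lam * (p.1 + p.2 : ℤ)) -
        2 * (diagIndex e * (diagIndex e + 1)) := by
    unfold sumLow
    rw [Int.ceil_le, div_le_iff₀ hpos]
    constructor <;> intro h <;> linarith
  have h2 : p.1 + p.2 ≤ ⌊((nextCritical e : ℝ) - lam * marginConst (nextCritical e) +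
      2 * (diagIndex e * (diagIndex e + 1))) / ((2 * diagIndex e + 1) * lam)⌋ ↔
      (2 * diagIndex e + 1) * (lam * (p.1 + p.2 : ℤ)) - 2 * (diagIndex e * (diagIndex e + 1)) ≤
      nextCritical e - lam * marginConst (nextCritical e) := by
    rw [Int.le_floor, le_div_iff₀ hpos]
    constructor <;> intro h <;> linarith
  rw [← h1, ← h2]
  unfold sumCount
  refine and_congr_right fun _ => ?_
  omega

/-- Every value of the sum of coordinates is taken at `2 v₁ + 1` points. -/
theorem ncard_mid (hs : Small (nextCritical e) lam) :
    (mid e lam).ncard = (2 * diagIndex e + 1) * sumCount e lam := by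
  have hinj : Set.InjOn (fun p : ℤ × ℤ =>
      (p.1 + p.2, (p.1 - p.2 + (2 * (diagIndex e : ℤ) + 1)) / 2)) (mid e lam) := by
    rintro ⟨a, b⟩ - ⟨a', b'⟩ - h
    simp only [Prod.mk.injEq] at h ⊢
    omega
  have himg : (fun p : ℤ × ℤ =>
      (p.1 + p.2, (p.1 - p.2 + (2 * (diagIndex e : ℤ) + 1)) / 2)) '' (mid e lam) =
      ((Finset.Ico (sumLow e lam) (sumLow e lam + sumCount e lam) ×ˢ
        Finset.Ico (0 : ℤ) (2 * diagIndex e + 1) : Finset (ℤ × ℤ)) : Set (ℤ × ℤ)) := by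
    ext ⟨s, k⟩
    simp only [Set.mem_image, Finset.coe_product, Set.mem_prod, Finset.coe_Ico, Set.mem_Ico,
      Prod.mk.injEq]
    constructor
    · rintro ⟨p, hp, rfl, rfl⟩
      rw [mem_mid_iff_sum hs] at hp
      omega
    · rintro ⟨⟨h1, h2⟩, h3, h4⟩
      obtain ⟨d, hd1, hd2⟩ : ∃ d : ℤ, (d + (2 * (diagIndex e : ℤ) + 1)) / 2 = k ∧
          (s + d) % 2 = 0 :=
        ⟨2 * k - (2 * diagIndex e + 1) + (s + (2 * diagIndex e + 1)) % 2, by omega, by omega⟩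
      refine ⟨((s + d) / 2, (s - d) / 2), (mem_mid_iff_sum hs).2 ?_, ?_, ?_⟩
      · simp only
        omega
      · simp only
        omega
      · simp only
        omega
  rw [← hinj.ncard_image, himg, Set.ncard_coe_finset, Finset.card_product,
    Int.card_Ico, Int.card_Ico, mul_comm]
  congr 1
  omega

/-- The number of symmetric fixed points in `mid e lam`. -/
theorem ncard_symmetricFixedPoints_mid (hs : Small (nextCritical e) lam) :
    (symmetricFixedPoints lam (mid e lam)).ncard = ∑ i ∈ Finset.range (sumCount e lam),
      (if sumLabel e lam (sumLow e lam + i) = centralLabel e then 1 else 0) := by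
  rw [← Finset.card_filter, ← Set.ncard_coe_finset]
  have hmem : ∀ p, p ∈ symmetricFixedPoints lam (mid e lam) ↔ p ∈ mid e lam ∧
      sumLabel e lam (p.1 + p.2) = centralLabel e ∧
      (p.2 = p.1 ∨ p.2 = p.1 + (2 * diagIndex e + 1)) := by
    intro p
    unfold symmetricFixedPoints
    rw [Set.mem_ofPred_eq]
    refine and_congr_right fun hp => ?_
    rw [symm_fixed_iff_of_mid hs hp]
    refine and_congr_left fun h => ?_
    rw [label_eq_sumLabel h]
  refine Set.ncard_congr (fun p _ => (p.1 + p.2 - sumLow e lam).toNat) ?_ ?_ ?_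
  · intro p hp
    obtain ⟨h1, h2, -⟩ := (hmem p).1 hp
    rw [mem_mid_iff_sum hs] at h1
    simp only [Finset.coe_filter, Finset.mem_range, Set.mem_ofPred_eq]
    refine ⟨by omega, ?_⟩
    rw [← h2]
    congr 1
    omega
  · rintro ⟨a, b⟩ ⟨a', b'⟩ hp hp' h
    obtain ⟨h1, -, h3⟩ := (hmem _).1 hp
    obtain ⟨h1', -, h3'⟩ := (hmem _).1 hp'
    rw [mem_mid_iff_sum hs] at h1 h1'
    simp only [Prod.mk.injEq] at *
    omega
  · intro i hi
    simp only [Finset.coe_filter, Finset.mem_range, Set.mem_ofPred_eq] at hi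
    rcases Int.even_or_odd' (sumLow e lam + i) with ⟨a, ha | ha⟩
    · have hsum : a + a = sumLow e lam + i := by omega
      refine ⟨(a, a), (hmem _).2 ⟨(mem_mid_iff_sum hs).2 ?_, ?_, Or.inl rfl⟩, ?_⟩
      · simp only
        omega
      · rw [hsum]; exact hi.2
      · simp only
        omega
    · have hsum : a - diagIndex e + (a - diagIndex e + (2 * diagIndex e + 1)) =
          sumLow e lam + i := by omega
      refine ⟨(a - diagIndex e, a - diagIndex e + (2 * diagIndex e + 1)),
        (hmem _).2 ⟨(mem_mid_iff_sum hs).2 ?_, ?_, Or.inr rfl⟩, ?_⟩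
      · simp only
        omega
      · rw [hsum]; exact hi.2
      · simp only
        omega

/-- Over an interval, a periodic function has its mean value, up to a bounded error. -/
theorem abs_sum_sub_le {h : ℤ → ℕ} {t : ℕ} (ht0 : 0 < t) (ht : ∀ y, h (y + t) = h y)
    (h1 : ∀ y, h y ≤ 1) {Q : ℕ} (hQ : Q * ∑ j ∈ Finset.range t, h j = t) (a : ℤ) (n : ℕ) :
    |(Q : ℤ) * (∑ i ∈ Finset.range n, h (a + i) : ℕ) - n| ≤ Q * t + t := by
  have hn := Nat.div_add_mod n t
  have hr := Nat.mod_lt n ht0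
  have hshift : ∀ y, (fun z => h (a + z)) (y + t) = (fun z => h (a + z)) y := by
    intro y
    change h (a + (y + t)) = h (a + y)
    rw [← add_assoc, ht]
  have e1 := sum_range_mul_of_periodic (h := fun z => h (a + z)) hshift (n / t)
  rw [sum_shift ht0 ht a] at e1
  have e2 : ∑ i ∈ Finset.range n, h (a + i) = ∑ i ∈ Finset.range (t * (n / t)), h (a + i) +
      ∑ i ∈ Finset.range (n % t), h (a + (t * (n / t) + i : ℕ)) := by
    rw [← Finset.sum_range_add, hn]
  have e3 : ∑ i ∈ Finset.range (n % t), h (a + (t * (n / t) + i : ℕ)) ≤ t := by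
    refine (Finset.sum_le_card_nsmul _ _ 1 fun i _ => h1 _).trans ?_
    rw [Finset.card_range, smul_eq_mul, mul_one]
    exact hr.le
  rw [e2, e1]
  have e4 := Nat.mul_le_mul_left Q e3
  have e5 : Q * (n / t * ∑ j ∈ Finset.range t, h j) = t * (n / t) := by
    rw [mul_left_comm, hQ, mul_comm]
  rw [Nat.cast_add, mul_add, ← Nat.cast_mul, e5, abs_le]
  constructor
  · have : (0 : ℤ) ≤ (Q : ℤ) * (∑ i ∈ Finset.range (n % t), h (a + (t * (n / t) + i : ℕ)) : ℕ) := by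
      positivity
    have : (0 : ℤ) ≤ (Q : ℤ) * t := by positivity
    omega
  · have : (Q : ℤ) * (∑ i ∈ Finset.range (n % t), h (a + (t * (n / t) + i : ℕ)) : ℕ) ≤ Q * t := by
      exact_mod_cast e4
    omega

/-- The number of residues modulo the diagonal period at which the diagonal label is the central
one. -/
def classCount (e : ℕ) : ℕ := diagPeriod e / (2 * Nat.sqrt e + 1)

/-- A proportion `1 / (2 ⌊√e⌋ + 1)` of the points of the diagonal has the central label. -/
theorem card_diagLabel (hcop : CoprimalityCondition (types e (diagIndex e) (diagIndex e))) :
    ∑ x ∈ Finset.range (diagPeriod e), (if diagLabel e lam x = centralLabel e then 1 else 0) =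
      classCount e ∧ (2 * Nat.sqrt e + 1) * classCount e = diagPeriod e := by
  have h := diagLabel_count (lam := lam) hcop (centralLabel_nonneg e) (centralLabel_lt e)
  have h' : ∑ x ∈ Finset.range (diagPeriod e), (if diagLabel e lam x = centralLabel e then 1 else 0)
      = classCount e := by
    unfold classCount
    exact (Nat.div_eq_of_eq_mul_right (by omega) h.symm).symm
  exact ⟨h', by rw [← h', h]⟩

theorem classCount_pos (hcop : CoprimalityCondition (types e (diagIndex e) (diagIndex e))) :
    0 < classCount e := by
  have h := (card_diagLabel (lam := 0) hcop).2
  have h2 := diagPeriod_pos e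
  rw [← h] at h2
  exact Nat.pos_of_mul_pos_left h2

/-- Up to a bounded error, the symmetric fixed points in `mid e lam` number one for every `2 ⌊√e⌋ +
1` values of the sum of the coordinates. -/
theorem abs_ncard_symmetricFixedPoints_mid_le (hs : Small (nextCritical e) lam)
    (hcop : CoprimalityCondition (types e (diagIndex e) (diagIndex e))) :
    |((2 * Nat.sqrt e + 1 : ℕ) : ℤ) * (symmetricFixedPoints lam (mid e lam)).ncard -
      sumCount e lam| ≤ (2 * Nat.sqrt e + 1 : ℕ) * diagPeriod e + diagPeriod e := by
  rw [ncard_symmetricFixedPoints_mid hs]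
  refine abs_sum_sub_le (h := fun s => if sumLabel e lam s = centralLabel e then 1 else 0)
    (diagPeriod_pos e) (fun y => ?_) (fun y => ?_) ?_ _ _
  · rw [sumLabel_periodic]
  · split_ifs <;> simp
  · obtain ⟨h1, h2⟩ := card_diagLabel (lam := lam) hcop
    have h3 := sum_affine (h := fun s => if sumLabel e lam s = centralLabel e then 1 else 0)
      (diagPeriod_pos e) (fun y => by rw [sumLabel_periodic]) (a := 2)
      (by
        rw [show (2 : ℤ) = ((2 : ℕ) : ℤ) from rfl, Nat.isCoprime_iff_coprime,
          Nat.coprime_two_left]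
        exact diagPeriod_odd e) 0
    simp only [zero_add, sumLabel_two_mul] at h3
    rw [← h3, h1, h2]

/-- A thin strip near the diagonal contains a bounded number of points. -/
theorem ncard_strip_le (hlam : 0 < lam) (D C : ℕ) (h : ℝ) {S : Set (ℤ × ℤ)}
    (hS : ∀ p ∈ S, 0 ≤ p.1 ∧ 0 ≤ p.2 ∧ |p.1 - p.2| ≤ D ∧ h ≤ ham (scaled lam p) ∧
      ham (scaled lam p) ≤ h + lam * C) : S.Finite ∧ S.ncard ≤ (2 * (C + 4 * D) + 1) ^ 2 := by
  rcases S.eq_empty_or_nonempty with rfl | ⟨p₀, hp₀⟩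
  · simp
  have key : ∀ p ∈ S, ∀ p' ∈ S, p'.1 + p'.2 - (p.1 + p.2) ≤ C + 2 * D := by
    intro p hp p' hp'
    obtain ⟨a1, a2, a3, a4, -⟩ := hS p hp
    obtain ⟨-, -, b3, -, b5⟩ := hS p' hp'
    rw [abs_le] at a3 b3
    by_contra hcon
    have mono : ∀ a b : ℤ, 0 ≤ a → a ≤ b → P (lam * a) + lam * (b - a) ≤ P (lam * b) := by
      intro a b ha hab
      rw [mul_sub]
      exact add_sub_le_P (mul_nonneg hlam.le (by exact_mod_cast ha))
        (mul_le_mul_of_nonneg_left (by exact_mod_cast hab) hlam.le)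
    have m1 := mono p.1 p'.1 a1 (by omega)
    have m2 := mono p.2 p'.2 a2 (by omega)
    unfold ham scaled at a4 b5
    simp only at a4 b5
    have h3 : (p'.1 : ℝ) - p.1 + (p'.2 - p.2) ≤ C := by
      refine le_of_mul_le_mul_left ?_ hlam
      rw [mul_add]
      linarith
    have h4 : p'.1 - p.1 + (p'.2 - p.2) ≤ C := by exact_mod_cast h3
    omega
  have hsub : S ⊆ ((Finset.Icc (p₀.1 - (C + 4 * D)) (p₀.1 + (C + 4 * D)) ×ˢ
      Finset.Icc (p₀.2 - (C + 4 * D)) (p₀.2 + (C + 4 * D)) : Finset (ℤ × ℤ)) : Set (ℤ × ℤ)) := by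
    intro p hp
    have k1 := key p hp p₀ hp₀
    have k2 := key p₀ hp₀ p hp
    have d1 := abs_le.1 (hS p hp).2.2.1
    have d2 := abs_le.1 (hS p₀ hp₀).2.2.1
    simp only [Finset.coe_product, Set.mem_prod, Finset.coe_Icc, Set.mem_Icc]
    omega
  refine ⟨(Finset.finite_toSet _).subset hsub, ?_⟩
  refine (Set.ncard_le_ncard hsub (Finset.finite_toSet _)).trans ?_
  rw [Set.ncard_coe_finset, Finset.card_product, Int.card_Icc, Int.card_Icc, sq]
  exact Nat.mul_le_mul (by omega) (by omega)

/-- A bound for the distance from the diagonal of the points of `X`. -/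
def diagWidth (E : ℕ) : ℕ := 8 * (E + 1) + 100 * (E + 1) * (2 * E + 1)

/-- The points of `X` lie in a strip about the diagonal whose width in lattice steps is bounded. -/
theorem abs_sub_le_diagWidth (hs : Small E lam) (hp : p ∈ X lam) (hE : ham (scaled lam p) ≤ E) :
    |p.1 - p.2| ≤ diagWidth E := by
  by_cases h : lam * roughConst E ≤ ham (scaled lam p)
  · have := abs_sub_le_of_mem_X hs hp (rough_of_ham hs.1 hE h)
    unfold diagWidth
    push_cast
    have : (0 : ℤ) ≤ 100 * ((E : ℤ) + 1) * (2 * E + 1) := by positivity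
    omega
  · rw [not_le] at h
    unfold ham scaled at h
    simp only at h
    have key : ∀ a b : ℤ, P (lam * a) + P (lam * b) < lam * roughConst E →
        a ≤ 100 * ((E : ℤ) + 1) * (2 * E + 1) := by
      intro a b hab
      have h1 := (le_abs_self _).trans (abs_le_P (lam * a))
      have h2 := P_nonneg (lam * b)
      have h3 : (a : ℝ) ≤ roughConst E := le_of_mul_le_mul_left (by linarith) hs.1
      unfold roughConst at h3
      exact_mod_cast h3
    have k1 := key _ _ h
    have k2 := key _ _ (by rw [add_comm]; exact h)
    have n1 := hp.1
    have n2 := hp.2.1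
    unfold diagWidth
    push_cast
    rw [abs_le]
    omega

/-- A bound for the number of points of `X` close to the ends of the critical interval. -/
def edgeConst (e : ℕ) : ℕ :=
  2 * (2 * (⌈marginConst (nextCritical e)⌉₊ + 4 * diagWidth (nextCritical e)) + 1) ^ 2

variable {J : Set ℝ}

theorem finite_domain (hlam : 0 < lam) (hJ : J ⊆ criticalInterval e) : (domain lam J).Finite :=
  (finite_ham_le hlam (nextCritical e)).subset fun _ hp => (hJ hp.2).2.le

/-- All but a bounded number of the points of the domain lie in `mid e lam`. -/
theorem ncard_domain_diff_le (hs : Small (nextCritical e) lam) (hJ : J ⊆ criticalInterval e) :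
    (domain lam J \ mid e lam).ncard ≤ edgeConst e := by
  set C := ⌈marginConst (nextCritical e)⌉₊ with hC
  have hmC : lam * marginConst (nextCritical e) ≤ lam * C :=
    mul_le_mul_of_nonneg_left (Nat.le_ceil _) hs.1.le
  set S1 := {p | p ∈ domain lam J ∧ ham (scaled lam p) ≤ e + lam * C} with hS1
  set S2 := {p | p ∈ domain lam J ∧ nextCritical e - lam * C ≤ ham (scaled lam p)} with hS2
  have h1 := ncard_strip_le (S := S1) hs.1 (diagWidth (nextCritical e)) C e fun p hp => by
    have hcr := hJ hp.1.2
    exact ⟨hp.1.1.1, hp.1.1.2.1, abs_sub_le_diagWidth hs hp.1.1 hcr.2.le, hcr.1.le, hp.2⟩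
  have h2 := ncard_strip_le (S := S2) hs.1 (diagWidth (nextCritical e)) C
    (nextCritical e - lam * C) fun p hp => by
    have hcr := hJ hp.1.2
    exact ⟨hp.1.1.1, hp.1.1.2.1, abs_sub_le_diagWidth hs hp.1.1 hcr.2.le, hp.2,
      by linarith [hcr.2]⟩
  have hsub : domain lam J \ mid e lam ⊆ S1 ∪ S2 := by
    rintro p ⟨hp, hp'⟩
    by_contra hcon
    refine hp' ⟨hp.1, ?_, ?_⟩
    · by_contra h
      exact hcon (Or.inl ⟨hp, by linarith⟩)
    · by_contra h
      exact hcon (Or.inr ⟨hp, by linarith⟩)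
  have h3 := Set.ncard_le_ncard hsub (h1.1.union h2.1)
  have h4 := Set.ncard_union_le S1 S2
  unfold edgeConst
  rw [← hC]
  have := h1.2
  have := h2.2
  omega

theorem mid_subset_domain
    (hJ : Set.Icc ((e : ℝ) + lam * marginConst (nextCritical e))
      (nextCritical e - lam * marginConst (nextCritical e)) ⊆ J) : mid e lam ⊆ domain lam J :=
  fun _ hp => ⟨hp.1, hJ ⟨hp.2.1, hp.2.2⟩⟩

/-- The number of classes of symmetric fixed points modulo the lattice. -/
theorem countModulo_eq (hs : Small (nextCritical e) lam)
    (hr : e = 0 ∨ lam * roughConst (nextCritical e) ≤ e)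
    (hcop : CoprimalityCondition (types e (diagIndex e) (diagIndex e)))
    (hJ : Set.Icc ((e : ℝ) + lam * marginConst (nextCritical e))
      (nextCritical e - lam * marginConst (nextCritical e)) ⊆ J)
    (hreg : IsRegularInterval e lam J) (hn : 2 * diagPeriod e ≤ sumCount e lam) :
    countModulo (lattice (types e (diagIndex e) (diagIndex e)))
      (symmetricFixedPoints lam (domain lam J)) = classCount e := by
  obtain ⟨hcard, -⟩ := card_diagLabel (lam := lam) hcop
  set ℓ := diagPeriod e with hℓ
  have hℓ0 : 0 < ℓ := diagPeriod_pos e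
  set T := (Finset.range ℓ).filter (fun x : ℕ => diagLabel e lam x = centralLabel e) with hT
  have hTcard : T.card = classCount e := by rw [hT, Finset.card_filter, hcard]
  have hper : ∀ x k : ℤ, diagLabel e lam (x + ℓ * k) = diagLabel e lam x := by
    intro x k
    have hp : Function.Periodic (diagLabel e lam) ℓ := diagLabel_periodic
    have := hp.int_mul k x
    rwa [mul_comm] at this
  -- The classes of the symmetric fixed points meet the diagonal.
  have hdiag : ∀ p ∈ symmetricFixedPoints lam (domain lam J), ∃ a : ℤ,
      diagLabel e lam a = centralLabel e ∧
        p - (a, a) ∈ lattice (types e (diagIndex e) (diagIndex e)) := by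
    rintro p ⟨hp, hsym, hfix⟩
    rcases hr with rfl | hr
    · -- For `e = 0` the lattice is the whole plane lattice, and any class will do.
      have hne : T.Nonempty := by
        rw [← Finset.card_pos, hTcard]
        exact classCount_pos hcop
      obtain ⟨a, ha⟩ := hne
      exact ⟨a, (Finset.mem_filter.1 ha).2, by rw [lattice_zero]; trivial⟩
    · have h := hreg.2.2 p hp
      obtain ⟨j, hj⟩ := h.exists_returnArc hs hr
      obtain ⟨h1, h2⟩ := hj.label_eq_of_symm hs h.2.2.2.1.1 hsym hfix
      obtain ⟨a, h3, h4⟩ := exists_diag_congr (lam := lam) h2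
      exact ⟨a, h3.symm.trans h1, h4⟩
  set mk : ℤ × ℤ → (ℤ × ℤ) ⧸ lattice (types e (diagIndex e) (diagIndex e)) :=
    fun p => QuotientAddGroup.mk p with hmk
  have hmkeq : ∀ p p', mk p = mk p' ↔
      p - p' ∈ lattice (types e (diagIndex e) (diagIndex e)) := by
    intro p p'
    rw [hmk]
    simp only
    rw [QuotientAddGroup.eq_iff_sub_mem]
  have hmkdiag : ∀ a b : ℤ, mk (a, a) = mk (b, b) ↔ (ℓ : ℤ) ∣ a - b := by
    intro a b
    rw [hmkeq, Prod.mk_sub_mk, diag_mem_lattice_iff]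
  have himg : mk '' symmetricFixedPoints lam (domain lam J) =
      (fun x : ℕ => mk ((x : ℤ), (x : ℤ))) '' (T : Set ℕ) := by
    refine Set.Subset.antisymm ?_ ?_
    · rintro _ ⟨p, hp, rfl⟩
      obtain ⟨a, h1, h2⟩ := hdiag p hp
      have hnn := Int.emod_nonneg a (b := (ℓ : ℤ)) (by omega)
      have hlt := Int.emod_lt_of_pos a (b := (ℓ : ℤ)) (by omega)
      have hdm := Int.emod_add_mul_ediv a ℓ
      have hcast : (((a % ℓ).toNat : ℕ) : ℤ) = a % ℓ := Int.toNat_of_nonneg hnn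
      refine ⟨(a % ℓ).toNat, ?_, ?_⟩
      · rw [hT]
        simp only [Finset.coe_filter, Finset.mem_range, Set.mem_ofPred_eq]
        refine ⟨by omega, ?_⟩
        rw [hcast, ← hper _ (a / ℓ), hdm, h1]
      · simp only
        rw [hcast, eq_comm, (hmkeq p (a, a)).2 h2, hmkdiag]
        exact ⟨a / ℓ, by omega⟩
    · rintro _ ⟨x, hx, rfl⟩
      rw [hT] at hx
      simp only [Finset.coe_filter, Finset.mem_range, Set.mem_ofPred_eq] at hx
      -- A representative on the diagonal whose sum of coordinates occurs in `mid e lam`.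
      obtain ⟨t, ht1, ht2⟩ : ∃ t : ℤ, sumLow e lam ≤ 2 * (x + ℓ * t) ∧
          2 * (x + ℓ * t) < sumLow e lam + 2 * ℓ := by
        have hdm := Int.emod_add_mul_ediv (sumLow e lam - 2 * x + 2 * ℓ - 1) (2 * ℓ)
        have hnn := Int.emod_nonneg (sumLow e lam - 2 * x + 2 * ℓ - 1) (b := 2 * (ℓ : ℤ)) (by omega)
        have hlt := Int.emod_lt_of_pos (sumLow e lam - 2 * x + 2 * ℓ - 1) (b := 2 * (ℓ : ℤ))
          (by omega)
        rw [mul_assoc] at hdm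
        exact ⟨(sumLow e lam - 2 * x + 2 * ℓ - 1) / (2 * ℓ), by omega, by omega⟩
      have hmid : ((x : ℤ) + ℓ * t, (x : ℤ) + ℓ * t) ∈ mid e lam := by
        rw [mem_mid_iff_sum hs]
        simp only
        omega
      refine ⟨((x : ℤ) + ℓ * t, (x : ℤ) + ℓ * t), ⟨mid_subset_domain hJ hmid, ?_⟩, ?_⟩
      · rw [symm_fixed_iff_of_mid hs hmid]
        exact ⟨(hper x t).trans hx.2, Or.inl rfl⟩
      · rw [hmkdiag]
        exact ⟨t, by ring⟩
  unfold countModulo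
  change (mk '' _).ncard = _
  rw [himg, Set.InjOn.ncard_image, Set.ncard_coe_finset, hTcard]
  intro x hx y hy hxy
  rw [hT] at hx hy
  simp only [Finset.coe_filter, Finset.mem_range, Set.mem_ofPred_eq] at hx hy
  simp only at hxy
  rw [hmkdiag] at hxy
  obtain ⟨k, hk⟩ := hxy
  have hk0 : k = 0 := by
    by_contra hne
    rcases lt_or_gt_of_ne hne with hl | hl
    · nlinarith
    · nlinarith
  rw [hk0] at hk
  omega

end

noncomputable section

/-! ### Densities -/

variable {lam : ℝ} {e : ℕ} {J : Set ℝ}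

theorem eventually_mul_le (C : ℝ) {c : ℝ} (hc : 0 < c) : ∀ᶠ lam : ℝ in 𝓝[>] 0, lam * C ≤ c := by
  have h : Tendsto (fun lam : ℝ => lam * C) (𝓝[>] 0) (𝓝 0) := by
    have : Tendsto (fun lam : ℝ => lam * C) (𝓝 0) (𝓝 (0 * C)) :=
      (continuous_id.mul continuous_const).tendsto 0
    rw [zero_mul] at this
    exact this.mono_left nhdsWithin_le_nhds
  exact (h.eventually (gt_mem_nhds hc)).mono fun _ h => h.le

theorem le_sumCount (hlam : 0 < lam) (hw : lam * marginConst (nextCritical e) ≤ 1 / 5) :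
    3 / (5 * (2 * (diagIndex e : ℝ) + 1)) * lam⁻¹ - 1 ≤ sumCount e lam := by
  have hlen := add_one_le_nextCritical e
  set R : ℝ := 2 * (diagIndex e : ℝ) + 1 with hR
  have hRpos : 0 < R := by positivity
  set A : ℝ := (e : ℝ) + lam * marginConst (nextCritical e) +
    2 * (diagIndex e * (diagIndex e + 1)) with hA
  set B : ℝ := (nextCritical e : ℝ) - lam * marginConst (nextCritical e) +
    2 * (diagIndex e * (diagIndex e + 1)) with hB
  have h1 : sumLow e lam < A / (R * lam) + 1 := Int.ceil_lt_add_one _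
  have h2 := Int.lt_floor_add_one (B / (R * lam))
  have h3 : (⌊B / (R * lam)⌋ + 1 - sumLow e lam : ℤ) ≤ sumCount e lam := Int.self_le_toNat _
  have h3' : (⌊B / (R * lam)⌋ : ℝ) + 1 - sumLow e lam ≤ sumCount e lam := by exact_mod_cast h3
  have h4 : 3 / (5 * R) * lam⁻¹ ≤ B / (R * lam) - A / (R * lam) := by
    rw [← sub_div, le_div_iff₀ (by positivity)]
    have : 3 / (5 * R) * lam⁻¹ * (R * lam) = 3 / 5 := by field_simp
    rw [this]
    linarith
  linarith

theorem tendsto_sumCount (e : ℕ) : Tendsto (fun lam => (sumCount e lam : ℝ)) (𝓝[>] 0) atTop := by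
  have h : Tendsto (fun lam : ℝ => 3 / (5 * (2 * (diagIndex e : ℝ) + 1)) * lam⁻¹ - 1)
      (𝓝[>] 0) atTop := by
    refine tendsto_atTop_add_const_right _ _ ?_
    exact Tendsto.const_mul_atTop (by positivity) tendsto_inv_nhdsGT_zero
  refine tendsto_atTop_mono' _ ?_ h
  filter_upwards [self_mem_nhdsWithin, eventually_mul_le (marginConst (nextCritical e))
    (show (0 : ℝ) < 1 / 5 by norm_num)] with lam h1 h2
  exact le_sumCount h1 h2

theorem eventually_small (E : ℕ) : ∀ᶠ lam : ℝ in 𝓝[>] 0, Small E lam := by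
  filter_upwards [self_mem_nhdsWithin, eventually_mul_le (32 * ((E : ℝ) + 1)) one_pos]
    with lam h1 h2
  exact ⟨h1, h2⟩

/-- The error term of the density, up to the factor `1 / sumCount e lam`. -/
def densityError (e : ℕ) : ℕ :=
  (2 * diagIndex e + 1) * ((2 * Nat.sqrt e + 1) * diagPeriod e + diagPeriod e) +
    (2 * Nat.sqrt e + 1) * (2 * diagIndex e + 1) * edgeConst e + edgeConst e

/-- The density differs from its limit by the bounded error terms of the two counts, divided by the
number of sums of coordinates. -/
theorem abs_delta_sub_le (hs : Small (nextCritical e) lam)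
    (hcop : CoprimalityCondition (types e (diagIndex e) (diagIndex e)))
    (hJ : Set.Icc ((e : ℝ) + lam * marginConst (nextCritical e))
      (nextCritical e - lam * marginConst (nextCritical e)) ⊆ J)
    (hJ' : J ⊆ criticalInterval e) (hn : 0 < sumCount e lam) :
    |δ lam (domain lam J) - 1 / ((2 * (Nat.sqrt e : ℝ) + 1) * (2 * (diagIndex e : ℝ) + 1))| ≤
      densityError e / sumCount e lam := by
  have hsub := mid_subset_domain hJ
  have hfin := finite_domain hs.1 hJ'
  set n := sumCount e lam with hn_def
  obtain ⟨K, hK⟩ : ∃ K, K = edgeConst e := ⟨_, rfl⟩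
  set N := (domain lam J).ncard with hN
  set S := (symmetricFixedPoints lam (domain lam J)).ncard with hS
  set s := (symmetricFixedPoints lam (mid e lam)).ncard with hs_def
  have h1 : (2 * diagIndex e + 1) * n ≤ N := by
    rw [← ncard_mid hs]
    exact Set.ncard_le_ncard hsub hfin
  have hedge := ncard_domain_diff_le hs hJ'
  rw [← hK] at hedge
  have h2 : N ≤ (2 * diagIndex e + 1) * n + K := by
    rw [← ncard_mid hs]
    have := Set.ncard_sdiff_add_ncard_of_subset hsub hfin
    omega
  have hSfin : (symmetricFixedPoints lam (domain lam J)).Finite := hfin.subset fun p hp => hp.1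
  have h3 : s ≤ S := Set.ncard_le_ncard (fun p hp => ⟨hsub hp.1, hp.2⟩) hSfin
  have h4 : S ≤ s + K := by
    have hsub' : symmetricFixedPoints lam (domain lam J) ⊆
        symmetricFixedPoints lam (mid e lam) ∪ (domain lam J \ mid e lam) := by
      intro p hp
      by_cases hm : p ∈ mid e lam
      · exact Or.inl ⟨hm, hp.2⟩
      · exact Or.inr ⟨hp.1, hm⟩
    have hf : (symmetricFixedPoints lam (mid e lam) ∪ (domain lam J \ mid e lam)).Finite :=
      (hfin.subset fun p hp => hsub hp.1).union hfin.sdiff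
    have a1 := Set.ncard_le_ncard hsub' hf
    have a2 := Set.ncard_union_le (symmetricFixedPoints lam (mid e lam)) (domain lam J \ mid e lam)
    omega
  have h5 := abs_ncard_symmetricFixedPoints_mid_le hs hcop
  rw [← hs_def, ← hn_def] at h5
  have h5' : |(2 * (Nat.sqrt e : ℝ) + 1) * s - n| ≤
      (2 * (Nat.sqrt e : ℝ) + 1) * diagPeriod e + diagPeriod e := by
    exact_mod_cast h5
  set Q : ℝ := 2 * (Nat.sqrt e : ℝ) + 1 with hQ
  set R : ℝ := 2 * (diagIndex e : ℝ) + 1 with hR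
  have hQ1 : 1 ≤ Q := by rw [hQ]; have : (0 : ℝ) ≤ Nat.sqrt e := by positivity
                         linarith
  have hR1 : 1 ≤ R := by rw [hR]; have : (0 : ℝ) ≤ diagIndex e := by positivity
                         linarith
  have g1 : R * n ≤ N := by rw [hR]; exact_mod_cast h1
  have g2 : (N : ℝ) ≤ R * n + K := by rw [hR]; exact_mod_cast h2
  have g3 : (s : ℝ) ≤ S := by exact_mod_cast h3
  have g4 : (S : ℝ) ≤ s + K := by exact_mod_cast h4
  have gn : (0 : ℝ) < n := by exact_mod_cast hn
  have gN : (n : ℝ) ≤ N := by nlinarith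
  have hC : (densityError e : ℝ) =
      R * (Q * diagPeriod e + diagPeriod e) + Q * R * K + K := by
    unfold densityError
    rw [← hK, hQ, hR]
    push_cast
    ring
  have hnum : |Q * R * S - N| ≤ densityError e := by
    rw [hC]
    have e1 : Q * R * S - N = R * (Q * s - n) + Q * R * (S - s) - (N - R * n) := by ring
    have e2 : |R * (Q * s - n)| ≤ R * (Q * diagPeriod e + diagPeriod e) := by
      rw [abs_mul, abs_of_nonneg (by linarith : 0 ≤ R)]
      exact mul_le_mul_of_nonneg_left h5' (by linarith)
    have e3 : 0 ≤ Q * R * (S - s) := by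
      have : 0 ≤ (S : ℝ) - s := by linarith
      positivity
    have e4 : Q * R * (S - s) ≤ Q * R * K :=
      mul_le_mul_of_nonneg_left (by linarith) (by positivity)
    have e5 : (0 : ℝ) ≤ K := by positivity
    have e6 := abs_le.1 e2
    rw [e1, abs_le]
    constructor
    · nlinarith
    · linarith
  have hδ : δ lam (domain lam J) - 1 / (Q * R) = (Q * R * S - N) / (Q * R * N) := by
    have : (N : ℝ) ≠ 0 := by linarith
    unfold δ
    rw [← hS, ← hN]
    field_simp
  rw [hδ, abs_div, abs_of_pos (show 0 < Q * R * N by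
    have : (0 : ℝ) < N := by linarith
    positivity)]
  refine div_le_div₀ (Nat.cast_nonneg _) hnum gn ?_
  have : 1 ≤ Q * R := by nlinarith
  nlinarith

theorem tendsto_delta (hcop : CoprimalityCondition (types e (diagIndex e) (diagIndex e)))
    {I : ℝ → Set ℝ} (hI : ∀ᶠ lam : ℝ in 𝓝[>] 0, IsRegularInterval e lam (I lam) ∧
      Set.Icc ((e : ℝ) + lam * marginConst (nextCritical e))
        (nextCritical e - lam * marginConst (nextCritical e)) ⊆ I lam) :
    Tendsto (fun lam : ℝ => δ lam (domain lam (I lam))) (𝓝[>] 0)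
      (𝓝 (1 / ((2 * (Nat.sqrt e : ℝ) + 1) * (2 * (diagIndex e : ℝ) + 1)))) := by
  rw [tendsto_iff_norm_sub_tendsto_zero]
  have hlim : Tendsto (fun lam => (densityError e : ℝ) / sumCount e lam) (𝓝[>] 0) (𝓝 0) :=
    tendsto_const_nhds.div_atTop (tendsto_sumCount e)
  refine squeeze_zero' (Eventually.of_forall fun _ => norm_nonneg _) ?_ hlim
  filter_upwards [hI, eventually_small (nextCritical e),
    (tendsto_sumCount e).eventually_gt_atTop 0] with lam h1 h2 h3
  exact abs_delta_sub_le h2 hcop h1.2 h1.1.2.1 (by exact_mod_cast h3)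

theorem delta_le_eta (hlam : 0 < lam) (hJ : J ⊆ criticalInterval e) :
    δ lam (domain lam J) ≤ η lam (domain lam J) ∧ η lam (domain lam J) ≤ 1 := by
  have hfin := finite_domain hlam hJ
  have hf : (fixedPoints lam (domain lam J)).Finite := hfin.subset fun p hp => hp.1
  unfold δ η
  constructor
  · refine div_le_div_of_nonneg_right ?_ (by positivity)
    have h : symmetricFixedPoints lam (domain lam J) ⊆ fixedPoints lam (domain lam J) :=
      fun p hp => ⟨hp.1, hp.2.2⟩
    exact_mod_cast Set.ncard_le_ncard h hf
  · refine div_le_one_of_le₀ ?_ (by positivity)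
    have h : fixedPoints lam (domain lam J) ⊆ domain lam J := fun p hp => hp.1
    exact_mod_cast Set.ncard_le_ncard h hfin

theorem floor_sqrt_half (e : ℕ) : ⌊√((e : ℝ) / 2)⌋₊ = diagIndex e := by
  have h1 : ((diagIndex e : ℝ)) ^ 2 + (diagIndex e : ℝ) ^ 2 ≤ e := by exact_mod_cast diagIndex_le e
  have h2 : (e : ℝ) < ((diagIndex e : ℝ) + 1) ^ 2 + ((diagIndex e : ℝ) + 1) ^ 2 := by
    exact_mod_cast lt_diagIndex e
  rw [Nat.floor_eq_iff (Real.sqrt_nonneg _)]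
  constructor
  · exact Real.le_sqrt_of_sq_le (by linarith)
  · rw [Real.sqrt_lt' (by positivity)]
    linarith

end

end DiscretisedRotation

theorem theorem4p2 (e : ℕ) (he : e ∈ criticalNumbers)
    (α : ℝ) (hα : α ∈ criticalInterval e)
    (hcop : CoprimalityCondition (vertexList α)) :
    (∀ᶠ lam : ℝ in 𝓝[>] 0, ∃! J : Set ℝ, IsLargestRegularInterval e lam J) ∧
    ∀ I : ℝ → Set ℝ, (∀ᶠ lam : ℝ in 𝓝[>] 0, IsLargestRegularInterval e lam (I lam)) →
      (∃ N : ℕ, 0 < N ∧ ∀ᶠ lam : ℝ in 𝓝[>] 0,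
        countModulo (lattice (vertexList α))
          (symmetricFixedPoints lam (domain lam (I lam))) = N) ∧
      Tendsto (fun lam : ℝ => δ lam (domain lam (I lam))) (𝓝[>] 0)
        (𝓝 (1 / ((2 * (⌊√(e : ℝ)⌋₊ : ℝ) + 1) * (2 * (⌊√((e : ℝ) / 2)⌋₊ : ℝ) + 1)))) ∧
      0 < 1 / ((2 * (⌊√(e : ℝ)⌋₊ : ℝ) + 1) * (2 * (⌊√((e : ℝ) / 2)⌋₊ : ℝ) + 1)) ∧
      1 / ((2 * (⌊√(e : ℝ)⌋₊ : ℝ) + 1) * (2 * (⌊√((e : ℝ) / 2)⌋₊ : ℝ) + 1)) ≤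
        liminf (fun lam : ℝ => η lam (domain lam (I lam))) (𝓝[>] 0) := by
  rw [vertexList_eq hα] at hcop ⊢
  rw [Real.nat_floor_real_sqrt_eq_nat_sqrt, floor_sqrt_half]
  have hgood : ∀ᶠ lam : ℝ in 𝓝[>] 0, Small (nextCritical e) lam ∧
      lam * marginConst (nextCritical e) ≤ 1 / 5 :=
    (eventually_small _).and (eventually_mul_le _ (by norm_num))
  have hrough : ∀ᶠ lam : ℝ in 𝓝[>] 0, e = 0 ∨ lam * roughConst (nextCritical e) ≤ e := by
    rcases Nat.eq_zero_or_pos e with h | h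
    · exact Eventually.of_forall fun _ => Or.inl h
    · exact (eventually_mul_le _ (by exact_mod_cast h)).mono fun _ h => Or.inr h
  refine ⟨hgood.mono fun lam h => ⟨regularComponent e lam,
    (isLargestRegularInterval_iff h.1 h.2).2 rfl,
    fun J hJ => (isLargestRegularInterval_iff h.1 h.2).1 hJ⟩, fun I hI => ?_⟩
  have hI' : ∀ᶠ lam : ℝ in 𝓝[>] 0, IsRegularInterval e lam (I lam) ∧
      Set.Icc ((e : ℝ) + lam * marginConst (nextCritical e))
        (nextCritical e - lam * marginConst (nextCritical e)) ⊆ I lam := by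
    filter_upwards [hI, hgood] with lam h1 h2
    refine ⟨h1.1, ?_⟩
    rw [(isLargestRegularInterval_iff h2.1 h2.2).1 h1]
    exact Icc_subset_regularComponent h2.1 h2.2
  have hδ := tendsto_delta hcop hI'
  have hle : ∀ᶠ lam : ℝ in 𝓝[>] 0, δ lam (domain lam (I lam)) ≤ η lam (domain lam (I lam)) ∧
      η lam (domain lam (I lam)) ≤ 1 := by
    filter_upwards [hI', self_mem_nhdsWithin] with lam h1 h2
    exact delta_le_eta h2 h1.1.2.1
  refine ⟨⟨classCount e, classCount_pos hcop, ?_⟩, hδ, by positivity, ?_⟩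
  · filter_upwards [hI', hgood, hrough, (tendsto_sumCount e).eventually_ge_atTop
      (2 * diagPeriod e : ℕ)] with lam h1 h2 h3 h4
    exact countModulo_eq h2.1 h3 hcop h1.2 h1.1 (by exact_mod_cast h4)
  · rw [← hδ.liminf_eq]
    refine liminf_le_liminf (hle.mono fun _ h => h.1) hδ.isBoundedUnder_ge ?_
    exact (isBoundedUnder_of_eventually_le (a := 1) (hle.mono fun _ h => h.2)).isCoboundedUnder_ge
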